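/- **Setting.** Let $G$ be a Lie group and $H\subset G$ a compact Lie subgroup which is a simple Lie group (connected, with simple Lie algebra $\mathfrak h$), such that $M=G/H$ is compact, connected and simply connected and $G$ acts almost effectively on $M$ (every normal subgroup of $G$ contained in $H$ is discrete). Let $\mathfrak g$ be the Lie algebra of $G$. A pair $(\mathfrak p,(\cdot,\cdot))$ is called *naturally reductive* if $\mathfrak p\subset\mathfrak g$ is an $\mathrm{Ad}(H)$-invariant complement to $\mathfrak h$, $(\cdot,\cdot)$ is an $\mathrm{Ad}(H)$-invariant inner product on $\mathfrak p$, and $([X,Y]_{\mathfrak p},X)=0$ for all $X,Y\in\mathfrak p$, where $[X,Y]_{\mathfrak p}$ is the $\mathfrak p$-component relative to $\mathfrak g=\mathfrak h\oplus\mathfrak p$. A $G$-invariant Riemannian metric $g$ on $M$ is *generated* by such a pair if the identification of $\mathfrak p$ with $T_{eH}M$ by the differential of $G\to G/H$ takes $(\cdot,\cdot)$ to $g_{eH}$; the metric is *$G$-naturally reductive* if it is generated by some naturally reductive pair. **Notation.** The Lie algebra $\mathfrak g$ is a direct sum $\mathfrak g=\bigoplus_{i=1}^N\mathfrak g_i$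 of simple ideals. Label them so that the projection of $\mathfrak h$ to $\mathfrak g_i$ is trivial for $1\le i\le N_0$, injective but not surjective for $N_0<i\le N_1$, and bijective for $N_1<i\le N$. Let $\langle\cdot,\cdot\rangle_i$ be minus the Killing form of $\mathfrak g_i$ if $i\le N_0$; for $i>N_0$, let it be the negative multiple of the Killing form of $\mathfrak g_i$ whose restriction to the projection of $\mathfrak h$ to $\mathfrak g_i$ equals minus the Killing form of $\mathfrak h$. Extend $\langle\cdot,\cdot\rangle_i$ to $\mathfrak g$ by means of the projection $\mathfrak g\to\mathfrak g_i$. **Theorem.** A $G$-invariant Riemannian metric on $M$ is $G$-naturally reductive if and only if it is generated by a pair $(\mathfrak p,(\cdot,\cdot))$ of one of the following two kinds. (a) $\mathfrak p=\bigoplus_{i\ne j}\mathfrak g_i$ for some $j\in\{N_1+1,\dots,N\}$, and $(\cdot,\cdot)$ is an $\mathrm{ad}(\mathfrak p)$-invariant inner product on $\mathfrak p$; equivalently, $(\cdot,\cdot)=\sum_{i\ne j}\beta_i\langle\cdot,\cdot\rangle_i$ with all $\beta_i>0$. (b) $\mathfrak p$ is the orthogonal complement to $\mathfrak h$ in $\mathfrak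 g$ relative to a form $Q=\sum_{i=1}^N\gamma_i\langle\cdot,\cdot\rangle_i$, and $(\cdot,\cdot)=Q|_{\mathfrak p}$, where either (i) $\gamma_i>0$ for all $i$; or (ii) there is $j\in\{N_1+1,\dots,N\}$ such that $\gamma_j<0$, $\gamma_i>0$ for all $i\ne j$, and $\sum_{i=N_0+1}^N\gamma_i<0$. Moreover, a pair $(\mathfrak p,(\cdot,\cdot))$ of a subspace of $\mathfrak g$ and a bilinear form on it is naturally reductive if and only if it is of kind (a) or (b). -/

import Mathlib

open scoped Manifold ContDiff

noncomputable section

/-- A smooth real Lie group has a Lie algebra (Mathlib asks for the regularity `minSmoothness ℝ 3`,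
which is `C^3`). -/
instance instLieGroupMinSmoothness {E : Type*} [NormedAddCommGroup E] [NormedSpace ℝ E]
    {G : Type*} [TopologicalSpace G] [ChartedSpace E G] [Group G] [LieGroup 𝓘(ℝ, E) ∞ G] :
    LieGroup 𝓘(ℝ, E) (minSmoothness ℝ 3) G :=
  LieGroup.of_le (n := ∞) (by
    rw [minSmoothness_of_isRCLikeNormedField]
    exact ENat.LEInfty.out)

/-! ### Decompositions of a Lie algebra into simple ideals -/

/-- A decomposition `L = ⨁ i, ideal i` of a real Lie algebra into simple ideals. -/
structure SimpleIdealDecomposition (L : Type*) [LieRing L] [LieAlgebra ℝ L]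
    (ι : Type*) [DecidableEq ι] where
  /-- the simple ideals -/
  ideal : ι → LieIdeal ℝ L
  isSimple : ∀ i, LieAlgebra.IsSimple ℝ (ideal i)
  isInternal : DirectSum.IsInternal fun i => (ideal i).toSubmodule

namespace SimpleIdealDecomposition

variable {L : Type*} [LieRing L] [LieAlgebra ℝ L] {ι : Type*} [DecidableEq ι]

theorem bijective_coeLinearMap (D : SimpleIdealDecomposition L ι) :
    Function.Bijective (DirectSum.coeLinearMap fun i => (D.ideal i).toSubmodule) :=
  D.isInternal

/-- The linear projection of `L` onto the `i`-th simple ideal. -/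
def proj (D : SimpleIdealDecomposition L ι) (i : ι) : L →ₗ[ℝ] D.ideal i :=
  DirectSum.component ℝ ι (fun i => (D.ideal i).toSubmodule) i ∘ₗ
    (LinearEquiv.ofBijective
      (DirectSum.coeLinearMap fun i => (D.ideal i).toSubmodule)
      D.bijective_coeLinearMap).symm.toLinearMap

/-- The bilinear form `(X, Y) ↦ - c i * κ_i (X_i, Y_i)` on `L`, where `X_i`, `Y_i` are the
components of `X`, `Y` in the `i`-th simple ideal and `κ_i` is the Killing form of that ideal. -/
def form (D : SimpleIdealDecomposition L ι) (c : ι → ℝ) (i : ι) : LinearMap.BilinForm ℝ L :=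
  (-c i) • (killingForm ℝ (D.ideal i)).compl₁₂ (D.proj i) (D.proj i)

variable {K : Type*} [LieRing K] [LieAlgebra ℝ K]

/-- The projection of a subalgebra, given by its inclusion map `inc : K → L`, to the `i`-th simple
ideal. -/
def subProj (D : SimpleIdealDecomposition L ι) (inc : K →ₗ[ℝ] L) (i : ι) :
    K →ₗ[ℝ] D.ideal i :=
  D.proj i ∘ₗ inc

/-- The normalization of the forms `D.form c i`: if the projection of `K` to the `i`-th ideal is
trivial, the form is minus the Killing form of the ideal; otherwise it is the negative multiple of
the Killing form of the ideal whose restriction to the projection of `K` is minus the Killing form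
of `K`. -/
def IsNormalization (D : SimpleIdealDecomposition L ι) (inc : K →ₗ[ℝ] L) (c : ι → ℝ) : Prop :=
  ∀ i, (D.subProj inc i = 0 → c i = 1) ∧
    (D.subProj inc i ≠ 0 → 0 < c i ∧
      ∀ Z W : K, -c i * killingForm ℝ (D.ideal i) (D.subProj inc i Z) (D.subProj inc i W)
        = -killingForm ℝ K Z W)

end SimpleIdealDecomposition

/-- A bilinear form on a real vector space is an inner product: symmetric and positive definite. -/
def IsInnerProduct {V : Type*} [AddCommGroup V] [Module ℝ V] (B : LinearMap.BilinForm ℝ V) :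
    Prop :=
  (∀ X Y, B X Y = B Y X) ∧ ∀ X, X ≠ 0 → 0 < B X X

/-- A bilinear form `B` on a subspace `p` of a Lie algebra is `ad(p)`-invariant. -/
def IsAdInvariant {L : Type*} [LieRing L] [LieAlgebra ℝ L] (p : Submodule ℝ L)
    (B : LinearMap.BilinForm ℝ p) : Prop :=
  ∀ Z X Y U V : p, (U : L) = ⁅(Z : L), (X : L)⁆ → (V : L) = ⁅(Z : L), (Y : L)⁆ →
    B U Y + B X V = 0

namespace SimpleIdealDecomposition

variable {L : Type*} [LieRing L] [LieAlgebra ℝ L] {ι : Type*} [DecidableEq ι] [Fintype ι]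
  {K : Type*} [LieRing K] [LieAlgebra ℝ K]

/-- The ideal `⨁ i ≠ j, ideal i`. -/
def complIdeal (D : SimpleIdealDecomposition L ι) (j : ι) : LieIdeal ℝ L :=
  ⨆ i : {i : ι // i ≠ j}, D.ideal i

/-- Pairs of the first kind: `p` is the sum of all the simple ideals but one, the `j`-th, where `K`
projects bijectively to the `j`-th ideal, and `B` is an `ad(p)`-invariant inner product on `p`. -/
def IsIdealPair (D : SimpleIdealDecomposition L ι) (inc : K →ₗ[ℝ] L) (p : Submodule ℝ L)
    (B : LinearMap.BilinForm ℝ p) : Prop :=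
  ∃ j, Function.Bijective (D.subProj inc j) ∧ p = (D.complIdeal j).toSubmodule ∧
    IsInnerProduct B ∧ IsAdInvariant p B

open Classical in
/-- Pairs of the second kind: `p` is the orthogonal complement of `K` with respect to
`Q = ∑ i, γ i • ⟨·,·⟩_i`, and `B` is the restriction of `Q` to `p`. Either all the `γ i` are
positive, or exactly one, `γ j`, is negative, where `K` projects bijectively to the `j`-th ideal,
the others are positive, and the sum of the `γ i` over all `i` such that the projection of `K` to
the `i`-th ideal is nontrivial is negative. -/
def IsFormPair (D : SimpleIdealDecomposition L ι) (inc : K →ₗ[ℝ] L) (c : ι → ℝ)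
    (p : Submodule ℝ L) (B : LinearMap.BilinForm ℝ p) : Prop :=
  ∃ γ : ι → ℝ,
    (∀ X : L, X ∈ p ↔ ∀ Z : K, (∑ i, γ i • D.form c i) (inc Z) X = 0) ∧
    (∀ X Y : p, B X Y = (∑ i, γ i • D.form c i) (X : L) (Y : L)) ∧
    ((∀ i, 0 < γ i) ∨
      ∃ j, Function.Bijective (D.subProj inc j) ∧ γ j < 0 ∧ (∀ i, i ≠ j → 0 < γ i) ∧
        ∑ i with D.subProj inc i ≠ 0, γ i < 0)

end SimpleIdealDecomposition

/-! ### Homogeneous spaces `G ⧸ H` -/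

section Homogeneous

variable (E : Type*) [NormedAddCommGroup E] [NormedSpace ℝ E]
  (EH : Type*) [NormedAddCommGroup EH] [NormedSpace ℝ EH]
  (EM : Type*) [NormedAddCommGroup EM] [NormedSpace ℝ EM]
  {G : Type*} [TopologicalSpace G] [ChartedSpace E G] [Group G]

/-- The adjoint representation `Ad a`, the differential at `1` of the conjugation by `a`. -/
def lieAd (a : G) : GroupLieAlgebra 𝓘(ℝ, E) G →ₗ[ℝ] GroupLieAlgebra 𝓘(ℝ, E) G :=
  (mfderiv 𝓘(ℝ, E) 𝓘(ℝ, E) (fun x : G => a * x * a⁻¹) 1 : E →L[ℝ] E).toLinearMap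

variable (H : Subgroup G) [ChartedSpace EH H] [ChartedSpace EM (G ⧸ H)]

/-- The inclusion of the Lie algebra of a subgroup `H` to the Lie algebra of `G`, the differential
at `1` of the inclusion of `H` to `G`. -/
def lieInclusion : GroupLieAlgebra 𝓘(ℝ, EH) H →ₗ[ℝ] GroupLieAlgebra 𝓘(ℝ, E) G :=
  (mfderiv 𝓘(ℝ, EH) 𝓘(ℝ, E) (fun x : H => (x : G)) 1).toLinearMap

/-- `H`, a Lie group for the subspace topology and the given smooth structure, is an (embedded) Lie
subgroup of `G`: its inclusion to `G` is a smooth immersion. -/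
structure IsLieSubgroup : Prop where
  smooth : ContMDiff 𝓘(ℝ, EH) 𝓘(ℝ, E) ∞ (fun x : H => (x : G))
  immersion : ∀ x : H,
    Function.Injective (mfderiv 𝓘(ℝ, EH) 𝓘(ℝ, E) (fun x : H => (x : G)) x)

/-- A Lie group is simple: it is connected and its Lie algebra is simple (hence not abelian). -/
structure IsSimpleLieGroup [FiniteDimensional ℝ EH] [LieGroup 𝓘(ℝ, EH) ∞ H] : Prop where
  connected : ConnectedSpace H
  isSimple : LieAlgebra.IsSimple ℝ (GroupLieAlgebra 𝓘(ℝ, EH) H)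

/-- `G` acts almost effectively on `G ⧸ H`: any normal subgroup of `G` contained in `H` is
discrete. -/
def IsAlmostEffective : Prop :=
  ∀ K : Subgroup G, K.Normal → K ≤ H → DiscreteTopology K

/-- The pair of a subspace `p` of the Lie algebra of `G` and a bilinear form `B` on `p` is naturally
reductive: `p` is an `Ad(H)`-invariant complement to the Lie algebra of `H`, the form `B` is an
`Ad(H)`-invariant inner product on `p`, and `B([X, Y]_p, X) = 0` for all `X, Y ∈ p`. -/
structure IsNaturallyReductivePair (p : Submodule ℝ (GroupLieAlgebra 𝓘(ℝ, E) G))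
    (B : LinearMap.BilinForm ℝ p) : Prop where
  isCompl : IsCompl p (LinearMap.range (lieInclusion E EH H))
  ad_mem : ∀ a ∈ H, ∀ X ∈ p, lieAd E a X ∈ p
  isInnerProduct : IsInnerProduct B
  ad_invariant : ∀ (a : G) (ha : a ∈ H) (X Y : p),
    B ⟨lieAd E a X, ad_mem a ha X X.2⟩ ⟨lieAd E a Y, ad_mem a ha Y Y.2⟩ = B X Y
  reductive : ∀ X Y : p,
    B (p.projectionOnto _ isCompl
      ⁅(X : GroupLieAlgebra 𝓘(ℝ, E) G), (Y : GroupLieAlgebra 𝓘(ℝ, E) G)⁆) X = 0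

/-- The differential at `1` of the projection `G → G ⧸ H`, which maps the Lie algebra of `G` to the
tangent space of `G ⧸ H` at the base point. -/
def projDeriv : GroupLieAlgebra 𝓘(ℝ, E) G →ₗ[ℝ] TangentSpace 𝓘(ℝ, EM) ((1 : G) : G ⧸ H) :=
  (mfderiv 𝓘(ℝ, E) 𝓘(ℝ, EM) (fun x : G => (x : G ⧸ H)) 1).toLinearMap

/-- Smooth Riemannian metrics on `G ⧸ H`. -/
abbrev MetricOnQuotient [IsManifold 𝓘(ℝ, EM) ∞ (G ⧸ H)] : Type _ :=
  Bundle.ContMDiffRiemannianMetric 𝓘(ℝ, EM) ∞ EM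
    (fun x : G ⧸ H => TangentSpace 𝓘(ℝ, EM) x)

variable {EM H} [IsManifold 𝓘(ℝ, EM) ∞ (G ⧸ H)]

/-- The metric `g` is `G`-invariant: every element of `G` acts by an isometry. -/
def IsInvariantMetric (g : MetricOnQuotient EM H) : Prop :=
  ∀ (a : G) (x : G ⧸ H) (v w : TangentSpace 𝓘(ℝ, EM) x),
    g.inner (a • x) (mfderiv 𝓘(ℝ, EM) 𝓘(ℝ, EM) (fun y : G ⧸ H => a • y) x v)
      (mfderiv 𝓘(ℝ, EM) 𝓘(ℝ, EM) (fun y : G ⧸ H => a • y) x w) = g.inner x v w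

/-- The metric `g` is (naturally reductive and) generated by the pair `(p, B)`: the pair is naturally
reductive, and `B` is the metric at the base point under the identification of `p` with the tangent
space of `G ⧸ H`. -/
def IsGeneratedBy (g : MetricOnQuotient EM H) (p : Submodule ℝ (GroupLieAlgebra 𝓘(ℝ, E) G))
    (B : LinearMap.BilinForm ℝ p) : Prop :=
  IsNaturallyReductivePair E EH H p B ∧
    ∀ X Y : p, g.inner ((1 : G) : G ⧸ H) (projDeriv E EM H X) (projDeriv E EM H Y) = B X Y

/-- The metric `g` is `G`-naturally reductive. -/
def IsNaturallyReductive (g : MetricOnQuotient EM H) : Prop :=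
  ∃ (p : Submodule ℝ (GroupLieAlgebra 𝓘(ℝ, E) G)) (B : LinearMap.BilinForm ℝ p),
    IsGeneratedBy E EH g p B

end Homogeneous

end

open scoped TensorProduct

set_option linter.unusedSectionVars false

/-! ### Invariant forms on Lie algebras of compact type -/

theorem exists_eigenvector_of_symm {V : Type*} [AddCommGroup V] [Module ℝ V]
    [FiniteDimensional ℝ V] [Nontrivial V] {S Q : LinearMap.BilinForm ℝ V}
    (hS : IsInnerProduct S) (hQ : ∀ X Y, Q X Y = Q Y X) :
    ∃ (t : ℝ) (X : V), X ≠ 0 ∧ ∀ Y, Q X Y = t * S X Y := by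
  let core : InnerProductSpace.Core ℝ V :=
    { inner := fun X Y => S X Y
      conj_inner_symm := fun X Y => by simpa using hS.1 Y X
      re_inner_nonneg := fun X => by
        by_cases hX : X = 0
        · simp [hX]
        · simpa using (hS.2 X hX).le
      add_left := fun X Y Z => by simp
      smul_left := fun X Y r => by simp
      definite := fun X hX => by
        by_contra h
        exact (hS.2 X h).ne' hX }
  let _ : NormedAddCommGroup V := core.toNormedAddCommGroup
  let _ : InnerProductSpace ℝ V := InnerProductSpace.ofCore core.toCore
  have hin : ∀ X Y : V, inner ℝ X Y = S X Y := fun X Y => rfl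
  have hSn : S.Nondegenerate := by
    refine (LinearMap.IsRefl.nondegenerate_iff_separatingLeft (B := S) ?_).2 ?_
    · intro X Y h
      rw [hS.1, h]
    · intro X h
      by_contra hX
      exact (hS.2 X hX).ne' (h X)
  let T : V →ₗ[ℝ] V := (S.toDual hSn).symm.toLinearMap ∘ₗ Q
  have hT : ∀ X Y, S (T X) Y = Q X Y := fun X Y => by
    simp [T, LinearMap.BilinForm.apply_toDual_symm_apply]
  have hTs : T.IsSymmetric := by
    intro X Y
    rw [hin, hin, hT, hS.1 X, hT, hQ]
  obtain ⟨X, hX⟩ := hTs.hasEigenvalue_iSup_of_finiteDimensional.exists_hasEigenvector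
  refine ⟨(⨆ x : { x : V // x ≠ 0 }, RCLike.re (inner ℝ (T x) (x : V)) / ‖(x : V)‖ ^ 2 : ℝ),
    X, hX.2, fun Y => ?_⟩
  rw [← hT, hX.apply_eq_smul, map_smul, LinearMap.smul_apply, smul_eq_mul]
  rfl

namespace LinearMap.BilinForm

open LinearMap (BilinForm)

variable {L : Type*} [LieRing L] [LieAlgebra ℝ L]

/-- The kernel of an invariant bilinear form is an ideal. -/
def lieKer (Q : BilinForm ℝ L) (hQ : Q.lieInvariant L) : LieIdeal ℝ L where
  __ := LinearMap.ker Q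
  lie_mem {X Y} hY := by
    have hY' : Q Y = 0 := hY
    change Q ⁅X, Y⁆ = 0
    ext Z
    rw [hQ, hY']
    simp

theorem mem_lieKer {Q : BilinForm ℝ L} (hQ : Q.lieInvariant L) (X : L) :
    X ∈ Q.lieKer hQ ↔ Q X = 0 := Iff.rfl

theorem lieInvariant.sub {Q R : BilinForm ℝ L} (hQ : Q.lieInvariant L) (hR : R.lieInvariant L) :
    (Q - R).lieInvariant L := fun X Y Z => by
  simp only [LinearMap.sub_apply]
  rw [hQ, hR]
  ring

theorem lieInvariant.smul {Q : BilinForm ℝ L} (hQ : Q.lieInvariant L) (t : ℝ) :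
    (t • Q).lieInvariant L := fun X Y Z => by
  simp only [LinearMap.smul_apply]
  rw [hQ]
  simp

theorem lieInvariant.compl₁₂ {K : Type*} [LieRing K] [LieAlgebra ℝ K] {Q : BilinForm ℝ L}
    (hQ : Q.lieInvariant L) (φ : K →ₗ⁅ℝ⁆ L) :
    BilinForm.lieInvariant K (Q.compl₁₂ (φ : K →ₗ[ℝ] L) (φ : K →ₗ[ℝ] L)) := fun X Y Z => by
  simp [hQ (φ X)]

end LinearMap.BilinForm

theorem eq_smul_of_lieInvariant {L : Type*} [LieRing L] [LieAlgebra ℝ L] [FiniteDimensional ℝ L]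
    (hL : LieAlgebra.IsSimple ℝ L) {S Q : LinearMap.BilinForm ℝ L} (hS : IsInnerProduct S)
    (hSL : S.lieInvariant L) (hQ : ∀ X Y, Q X Y = Q Y X) (hQL : Q.lieInvariant L) :
    ∃ t : ℝ, Q = t • S := by
  have := LieAlgebra.IsSimple.nontrivial ℝ L
  obtain ⟨t, X, hX, h⟩ := exists_eigenvector_of_symm hS hQ
  refine ⟨t, ?_⟩
  have hI := hQL.sub (hSL.smul t)
  rcases hL.eq_bot_or_eq_top (LinearMap.BilinForm.lieKer _ hI) with h' | h'
  · exfalso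
    apply hX
    have : X ∈ LinearMap.BilinForm.lieKer _ hI := by
      rw [LinearMap.BilinForm.mem_lieKer]
      ext Y
      simp [h]
    rw [h'] at this
    simpa using this
  · ext Y Z
    have : Y ∈ LinearMap.BilinForm.lieKer _ hI := by rw [h']; trivial
    rw [LinearMap.BilinForm.mem_lieKer] at this
    have := LinearMap.congr_fun this Z
    simp only [LinearMap.sub_apply, LinearMap.zero_apply] at this
    linarith

theorem exists_killingForm_eq_neg_sum {L : Type*} [LieRing L] [LieAlgebra ℝ L]
    [FiniteDimensional ℝ L] {S : LinearMap.BilinForm ℝ L} (hS : IsInnerProduct S)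
    (hSL : S.lieInvariant L) :
    ∃ v : Module.Basis (Fin (Module.finrank ℝ L)) ℝ L, ∀ X, killingForm ℝ L X X =
      -∑ i, S ⁅X, v i⁆ ⁅X, v i⁆ / S (v i) (v i) := by
  obtain ⟨v, hv⟩ := LinearMap.BilinForm.exists_orthogonal_basis (K := ℝ) (V := L) (B := S)
    ⟨fun X Y => hS.1 X Y⟩
  refine ⟨v, fun X => ?_⟩
  have hvi : ∀ i, S (v i) (v i) ≠ 0 := fun i => (hS.2 _ (v.ne_zero i)).ne'
  have hrepr : ∀ (W : L) i, v.repr W i = S W (v i) / S (v i) (v i) := fun W i => by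
    conv_rhs => rw [← v.sum_repr W]
    rw [map_sum, LinearMap.sum_apply, Finset.sum_eq_single i]
    · simp [hvi]
    · intro j _ hj
      have : S (v j) (v i) = 0 := hv hj
      simp [this]
    · simp
  rw [LieModule.traceForm_apply_apply, LinearMap.trace_eq_matrix_trace ℝ v, Matrix.trace,
    ← Finset.sum_neg_distrib]
  refine Finset.sum_congr rfl fun i _ => ?_
  rw [Matrix.diag_apply, LinearMap.toMatrix_apply, hrepr, ← neg_div]
  congr 1
  simp [hSL X ⁅X, v i⁆ (v i)]

theorem killingForm_self_nonpos {L : Type*} [LieRing L] [LieAlgebra ℝ L]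
    [FiniteDimensional ℝ L] {S : LinearMap.BilinForm ℝ L} (hS : IsInnerProduct S)
    (hSL : S.lieInvariant L) {X : L} (hX : ∃ Y : L, ⁅X, Y⁆ ≠ 0) : killingForm ℝ L X X < 0 := by
  obtain ⟨v, hv⟩ := exists_killingForm_eq_neg_sum hS hSL
  have h0 : ∀ Y, 0 ≤ S Y Y := fun Y => by
    by_cases hY : Y = 0
    · simp [hY]
    · exact (hS.2 Y hY).le
  rw [hv, neg_lt_zero]
  refine Finset.sum_pos' (fun i _ => div_nonneg (h0 _) (h0 _)) ?_
  by_contra! h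
  obtain ⟨Y, hY⟩ := hX
  apply hY
  have : LieAlgebra.ad ℝ L X = 0 := by
    refine v.ext fun i => ?_
    by_contra h'
    exact (h i (Finset.mem_univ i)).not_gt (div_pos (hS.2 _ h') (hS.2 _ (v.ne_zero i)))
  simpa using LinearMap.congr_fun this Y

theorem LieAlgebra.IsSimple.exists_lie_ne_zero {L : Type*} [LieRing L] [LieAlgebra ℝ L]
    (hL : LieAlgebra.IsSimple ℝ L) {X : L} (hX : X ≠ 0) : ∃ Y : L, ⁅X, Y⁆ ≠ 0 := by
  by_contra! h
  have hc : X ∈ LieAlgebra.center ℝ L := by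
    rw [LieModule.mem_maxTrivSubmodule]
    intro Y
    rw [← lie_skew, h, neg_zero]
  rcases hL.eq_bot_or_eq_top (LieAlgebra.center ℝ L) with h' | h'
  · rw [h'] at hc
    exact hX (by simpa using hc)
  · exact hL.non_abelian ((LieAlgebra.isLieAbelian_iff_center_eq_top ℝ L).2 h')

theorem isInnerProduct_neg_killingForm {L : Type*} [LieRing L] [LieAlgebra ℝ L]
    [FiniteDimensional ℝ L] (hL : LieAlgebra.IsSimple ℝ L) {S : LinearMap.BilinForm ℝ L}
    (hS : IsInnerProduct S) (hSL : S.lieInvariant L) : IsInnerProduct (-killingForm ℝ L) := by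
  refine ⟨fun X Y => ?_, fun X hX => ?_⟩
  · simp only [LinearMap.neg_apply]
    rw [LieModule.traceForm_comm]
  · simpa using killingForm_self_nonpos hS hSL (hL.exists_lie_ne_zero hX)

theorem lieInvariant_neg_killingForm (L : Type*) [LieRing L] [LieAlgebra ℝ L] :
    (-killingForm ℝ L).lieInvariant L := by
  intro X Y Z
  simp only [LinearMap.neg_apply]
  rw [LieModule.traceForm_lieInvariant]

theorem IsInnerProduct.compl₁₂ {V W : Type*} [AddCommGroup V] [Module ℝ V] [AddCommGroup W]
    [Module ℝ W] {S : LinearMap.BilinForm ℝ V} (hS : IsInnerProduct S) {φ : W →ₗ[ℝ] V}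
    (hφ : Function.Injective φ) : IsInnerProduct (S.compl₁₂ φ φ) :=
  ⟨fun X Y => hS.1 _ _, fun X hX => hS.2 _ fun h => hX (hφ (by simpa using h))⟩

theorem IsInnerProduct.self_nonneg {V : Type*} [AddCommGroup V] [Module ℝ V]
    {S : LinearMap.BilinForm ℝ V} (hS : IsInnerProduct S) (X : V) : 0 ≤ S X X := by
  by_cases hX : X = 0
  · simp [hX]
  · exact (hS.2 X hX).le

/-! ### Existence of a decomposition -/

theorem isSemisimple_of_isInnerProduct {L : Type*} [LieRing L] [LieAlgebra ℝ L]
    [FiniteDimensional ℝ L] {S : LinearMap.BilinForm ℝ L} (hS : IsInnerProduct S)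
    (hSL : S.lieInvariant L) (hper : ∀ f : L →ₗ[ℝ] ℝ, (∀ X Y : L, f ⁅X, Y⁆ = 0) → f = 0) :
    LieAlgebra.IsSemisimple ℝ L := by
  have hrefl : S.IsRefl := fun X Y h => by rw [hS.1, h]
  refine LieAlgebra.InvariantForm.isSemisimple_of_nondegenerate S
    ((LinearMap.IsRefl.nondegenerate_iff_separatingLeft hrefl).2 ?_) hSL hrefl ?_
  · intro X h
    by_contra hX
    exact (hS.2 X hX).ne' (h X)
  · intro I hI hab
    apply hI.1
    rw [LieSubmodule.eq_bot_iff]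
    intro X hX
    have hcen : ∀ Y : L, ⁅X, Y⁆ = 0 := fun Y => by
      by_contra h
      have hXY : ⁅X, Y⁆ ∈ I := lie_mem_left _ _ _ _ _ hX
      have h2 : ⁅X, ⁅X, Y⁆⁆ = 0 := by
        have := hab.trivial ⟨X, hX⟩ ⟨_, hXY⟩
        simpa using congrArg Subtype.val this
      have := hS.2 _ h
      rw [hSL, h2] at this
      simp at this
    have : S X = 0 := hper _ fun Y Z => by
      rw [hS.1, hSL, hS.1, ← lie_skew, map_neg, LinearMap.neg_apply, hSL] 
      have h1 := hSL X Y Z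
      have h2 := hSL X Z Y
      have h3 := hSL Y X Z
      rw [hcen] at h1 h2
      rw [← lie_skew, hcen] at h3
      simp at h1 h2 h3 ⊢
      linarith
    by_contra h
    have := hS.2 _ h
    simp_all

theorem exists_simpleIdealDecomposition {L : Type*} [LieRing L] [LieAlgebra ℝ L]
    [FiniteDimensional ℝ L] [LieAlgebra.IsSemisimple ℝ L] :
    ∃ N : ℕ, Nonempty (SimpleIdealDecomposition L (Fin N)) := by
  have hind : sSupIndep {I : LieIdeal ℝ L | IsAtom I} := LieAlgebra.IsSemisimple.sSupIndep_isAtom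
  have hfin : {I : LieIdeal ℝ L | IsAtom I}.Finite :=
    WellFoundedGT.finite_of_sSupIndep hind
  have := hfin.to_subtype
  obtain ⟨N, ⟨e⟩⟩ := Finite.exists_equiv_fin {I : LieIdeal ℝ L | IsAtom I}
  refine ⟨N, ⟨⟨fun i => (e.symm i).1,
    fun i => LieAlgebra.IsSemisimple.isSimple_of_isAtom _ (e.symm i).2, ?_⟩⟩⟩
  have hind2 : iSupIndep fun i : Fin N => ((e.symm i).1 : LieIdeal ℝ L) := by
    have := (sSupIndep_iff _).1 hind
    exact this.comp e.symm.injective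
  refine DirectSum.isInternal_submodule_of_iSupIndep_of_iSup_eq_top ?_ ?_
  · exact LieSubmodule.iSupIndep_toSubmodule.2 hind2
  · rw [← LieSubmodule.iSup_toSubmodule, e.symm.surjective.iSup_comp (g := fun x => x.1),
      ← sSup_eq_iSup', LieAlgebra.IsSemisimple.sSup_atoms_eq_top]
    rfl

theorem LieAlgebra.IsSimple.eq_zero_of_forall_lie_eq_zero {L : Type*} [LieRing L] [LieAlgebra ℝ L]
    (hL : LieAlgebra.IsSimple ℝ L) (f : L →ₗ[ℝ] ℝ) (hf : ∀ X Y : L, f ⁅X, Y⁆ = 0) : f = 0 := by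
  let I : LieIdeal ℝ L := { LinearMap.ker f with lie_mem := fun {X Y} _ => hf X Y }
  have hmem : ∀ X, X ∈ I ↔ f X = 0 := fun X => Iff.rfl
  rcases hL.eq_bot_or_eq_top I with h | h
  · exfalso
    refine hL.non_abelian ⟨fun X Y => ?_⟩
    have := (hmem _).2 (hf X Y)
    rw [h] at this
    simpa using this
  · ext X
    have : X ∈ I := by rw [h]; trivial
    exact (hmem X).1 this

theorem LieAlgebra.IsSimple.injective_of_ne_zero {L L' : Type*} [LieRing L] [LieAlgebra ℝ L]
    [LieRing L'] [LieAlgebra ℝ L'] (hL : LieAlgebra.IsSimple ℝ L) (φ : L →ₗ⁅ℝ⁆ L')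
    (hφ : φ ≠ 0) : Function.Injective φ := by
  rw [← LieHom.ker_eq_bot]
  refine (hL.eq_bot_or_eq_top _).resolve_right fun h => hφ ?_
  ext X
  have : X ∈ φ.ker := by rw [h]; trivial
  simpa using this

namespace SimpleIdealDecomposition

variable {L : Type*} [LieRing L] [LieAlgebra ℝ L] {ι : Type*} [DecidableEq ι]
  (D : SimpleIdealDecomposition L ι)

@[simp]
theorem proj_coe (i : ι) (X : D.ideal i) : D.proj i (X : L) = X :=
  D.isInternal.ofBijective_coeLinearMap_same X

theorem proj_of_ne {i j : ι} (hij : i ≠ j) (X : D.ideal i) : D.proj j (X : L) = 0 :=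
  D.isInternal.ofBijective_coeLinearMap_of_ne hij X

theorem proj_of_mem_of_ne {i j : ι} (hij : i ≠ j) {X : L} (hX : X ∈ D.ideal i) :
    D.proj j X = 0 :=
  D.proj_of_ne hij ⟨X, hX⟩

theorem proj_of_mem {i : ι} {X : L} (hX : X ∈ D.ideal i) : (D.proj i X : L) = X := by
  rw [D.proj_coe i ⟨X, hX⟩]

theorem lie_eq_zero_of_ne {i j : ι} (hij : i ≠ j) {X Y : L} (hX : X ∈ D.ideal i)
    (hY : Y ∈ D.ideal j) : ⁅X, Y⁆ = 0 := by
  have h1 : ⁅X, Y⁆ ∈ D.ideal i := lie_mem_left _ _ _ _ _ hX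
  have h2 : ⁅X, Y⁆ ∈ D.ideal j := lie_mem_right _ _ _ _ _ hY
  rw [← D.proj_of_mem h1, D.proj_of_mem_of_ne hij.symm h2]
  rfl

/-- The inclusion of a simple ideal. -/
noncomputable def inclHom (i : ι) : D.ideal i →ₗ⁅ℝ⁆ L :=
  { (D.ideal i).toSubmodule.subtype with map_lie' := rfl }

@[simp]
theorem inclHom_apply (i : ι) (X : D.ideal i) : D.inclHom i X = X := rfl

theorem inclHom_injective (i : ι) : Function.Injective (D.inclHom i) := Subtype.val_injective

theorem form_apply (c : ι → ℝ) (i : ι) (X Y : L) :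
    D.form c i X Y = -c i * killingForm ℝ (D.ideal i) (D.proj i X) (D.proj i Y) := by
  simp [form]

theorem form_comm (c : ι → ℝ) (i : ι) (X Y : L) : D.form c i X Y = D.form c i Y X := by
  rw [form_apply, form_apply, LieModule.traceForm_comm]

variable [Fintype ι]

theorem sum_proj (X : L) : ∑ i, (D.proj i X : L) = X := by
  obtain ⟨x, rfl⟩ := D.bijective_coeLinearMap.2 X
  have h : ∀ i, D.proj i (DirectSum.coeLinearMap (fun i => (D.ideal i).toSubmodule) x) = x i := by
    intro i
    simp only [proj, LinearMap.comp_apply]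
    change ((LinearEquiv.ofBijective _ D.bijective_coeLinearMap).symm
      ((LinearEquiv.ofBijective _ D.bijective_coeLinearMap) x)) i = _
    rw [LinearEquiv.symm_apply_apply]
  simp only [h]
  conv_rhs => rw [← DirectSum.sum_univ_of x]
  rw [map_sum]
  simp only [DirectSum.coeLinearMap_of]

theorem ext_proj {X Y : L} (h : ∀ i, D.proj i X = D.proj i Y) : X = Y := by
  rw [← D.sum_proj X, ← D.sum_proj Y]
  simp only [h]

theorem proj_lie (i : ι) (X Y : L) : D.proj i ⁅X, Y⁆ = ⁅D.proj i X, D.proj i Y⁆ := by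
  have h : ⁅X, Y⁆ = ∑ a, (⁅D.proj a X, D.proj a Y⁆ : D.ideal a) := by
    conv_lhs => rw [← D.sum_proj X, ← D.sum_proj Y]
    rw [sum_lie]
    refine Finset.sum_congr rfl fun a _ => ?_
    rw [lie_sum, Finset.sum_eq_single a]
    · rfl
    · intro b _ hb
      exact D.lie_eq_zero_of_ne hb.symm (D.proj a X).2 (D.proj b Y).2
    · simp
  rw [h, map_sum, Finset.sum_eq_single i]
  · exact D.proj_coe i _
  · intro b _ hb
    exact D.proj_of_ne hb _
  · simp

/-- The projection to a simple ideal, as a homomorphism of Lie algebras. -/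
noncomputable def projHom (i : ι) : L →ₗ⁅ℝ⁆ D.ideal i :=
  { D.proj i with map_lie' := D.proj_lie i _ _ }

theorem lieInvariant_form (c : ι → ℝ) (i : ι) : (D.form c i).lieInvariant L := by
  intro X Y Z
  rw [form_apply, form_apply, proj_lie, proj_lie, LieModule.traceForm_lieInvariant]
  ring

theorem mem_complIdeal {j : ι} {X : L} : X ∈ D.complIdeal j ↔ D.proj j X = 0 := by
  constructor
  · have : (D.complIdeal j).toSubmodule ≤ LinearMap.ker (D.proj j) := by
      rw [complIdeal, LieSubmodule.iSup_toSubmodule]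
      exact iSup_le fun i Y hY => D.proj_of_mem_of_ne i.2 hY
    exact fun h => this h
  · intro h
    rw [← D.sum_proj X]
    refine sum_mem fun i _ => ?_
    by_cases hi : i = j
    · subst hi
      rw [h]
      exact (D.complIdeal i).zero_mem
    · exact (le_iSup (fun i : {i : ι // i ≠ j} => D.ideal i) ⟨i, hi⟩) (D.proj i X).2

variable [FiniteDimensional ℝ L]

theorem isInnerProduct_neg_killingForm {S : LinearMap.BilinForm ℝ L} (hS : IsInnerProduct S)
    (hSL : S.lieInvariant L) (i : ι) : IsInnerProduct (-killingForm ℝ (D.ideal i)) :=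
  _root_.isInnerProduct_neg_killingForm (D.isSimple i) (hS.compl₁₂ (D.inclHom_injective i))
    (hSL.compl₁₂ (D.inclHom i))

theorem form_self_nonneg {S : LinearMap.BilinForm ℝ L} (hS : IsInnerProduct S)
    (hSL : S.lieInvariant L) {c : ι → ℝ} (hc : ∀ i, 0 < c i) (i : ι) (X : L) :
    0 ≤ D.form c i X X := by
  have := (D.isInnerProduct_neg_killingForm hS hSL i).self_nonneg (D.proj i X)
  rw [form_apply, neg_mul, ← mul_neg]
  exact mul_nonneg (hc i).le this

theorem form_self_pos {S : LinearMap.BilinForm ℝ L} (hS : IsInnerProduct S)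
    (hSL : S.lieInvariant L) {c : ι → ℝ} (hc : ∀ i, 0 < c i) {i : ι} {X : L}
    (hX : D.proj i X ≠ 0) : 0 < D.form c i X X := by
  have := (D.isInnerProduct_neg_killingForm hS hSL i).2 _ hX
  rw [form_apply, neg_mul, ← mul_neg]
  exact mul_pos (hc i) this

theorem sum_form_apply (c γ : ι → ℝ) (X Y : L) :
    (∑ i, γ i • D.form c i) X Y = ∑ i, γ i * D.form c i X Y := by
  simp [LinearMap.sum_apply]

theorem sum_form_comm (c γ : ι → ℝ) (X Y : L) :
    (∑ i, γ i • D.form c i) X Y = (∑ i, γ i • D.form c i) Y X := by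
  simp only [sum_form_apply, D.form_comm c _ X Y]

theorem lieInvariant_sum_form (c γ : ι → ℝ) : (∑ i, γ i • D.form c i).lieInvariant L := by
  intro X Y Z
  rw [sum_form_apply, sum_form_apply, ← Finset.sum_neg_distrib]
  refine Finset.sum_congr rfl fun i _ => ?_
  rw [D.lieInvariant_form c i]
  ring

theorem sum_form_of_mem_left {c γ : ι → ℝ} {j : ι} {X : L} (hX : X ∈ D.ideal j) (Y : L) :
    (∑ i, γ i • D.form c i) X Y = γ j * D.form c j X Y := by
  rw [sum_form_apply, Finset.sum_eq_single j]
  · intro i _ hi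
    rw [form_apply, D.proj_of_mem_of_ne hi.symm hX]
    simp
  · simp

/-- An invariant symmetric bilinear form is a combination of the Killing forms of the simple
ideals. -/
theorem exists_eq_sum_form {S : LinearMap.BilinForm ℝ L} (hS : IsInnerProduct S)
    (hSL : S.lieInvariant L) {c : ι → ℝ} (hc : ∀ i, 0 < c i) {Q : LinearMap.BilinForm ℝ L}
    (hQ : ∀ X Y, Q X Y = Q Y X) (hQL : Q.lieInvariant L) :
    ∃ γ : ι → ℝ, Q = ∑ i, γ i • D.form c i := by
  have h1 : ∀ i, ∃ t : ℝ, Q.compl₁₂ (D.inclHom i : D.ideal i →ₗ[ℝ] L)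
      (D.inclHom i : D.ideal i →ₗ[ℝ] L) = t • (-killingForm ℝ (D.ideal i)) := fun i =>
    eq_smul_of_lieInvariant (D.isSimple i) (D.isInnerProduct_neg_killingForm hS hSL i)
      (lieInvariant_neg_killingForm _) (fun X Y => hQ _ _) (hQL.compl₁₂ (D.inclHom i))
  choose t ht using h1
  have hne : ∀ i j, i ≠ j → ∀ (X : D.ideal i) (Y : D.ideal j), Q X Y = 0 := by
    intro i j hij X Y
    have := (D.isSimple i).eq_zero_of_forall_lie_eq_zero
      (Q.flip (Y : L) ∘ₗ (D.ideal i).toSubmodule.subtype) fun U V => by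
        change Q ⁅(U : L), (V : L)⁆ (Y : L) = 0
        rw [hQL, D.lie_eq_zero_of_ne hij U.2 Y.2]
        simp
    exact LinearMap.congr_fun this X
  refine ⟨fun i => t i / c i, ?_⟩
  ext X Y
  rw [sum_form_apply]
  conv_lhs => rw [← D.sum_proj X, ← D.sum_proj Y]
  simp only [map_sum, LinearMap.sum_apply]
  refine Finset.sum_congr rfl fun i _ => ?_
  rw [Finset.sum_eq_single i]
  · have := LinearMap.congr_fun₂ (ht i) (D.proj i X) (D.proj i Y)
    simp only [LinearMap.compl₁₂_apply, LieHom.coe_toLinearMap, inclHom_apply,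
      LinearMap.smul_apply, LinearMap.neg_apply, smul_eq_mul] at this
    rw [this, form_apply]
    have := (hc i).ne'
    field_simp
  · intro j _ hj
    exact hne _ _ (by tauto) _ _
  · simp

/-- The linear projection to the sum of all the simple ideals but one. -/
noncomputable def projCompl (j : ι) : L →ₗ[ℝ] (D.complIdeal j).toSubmodule :=
  (LinearMap.id - (D.ideal j).toSubmodule.subtype ∘ₗ D.proj j).codRestrict _ fun X =>
    D.mem_complIdeal.2 (by simp)

theorem coe_projCompl (j : ι) (X : L) : (D.projCompl j X : L) = X - D.proj j X := rfl

theorem projCompl_coe (j : ι) (X : (D.complIdeal j).toSubmodule) : D.projCompl j (X : L) = X := by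
  ext
  rw [coe_projCompl, D.mem_complIdeal.1 X.2]
  simp

theorem isInnerProduct_and_isAdInvariant_iff {S : LinearMap.BilinForm ℝ L} (hS : IsInnerProduct S)
    (hSL : S.lieInvariant L) {c : ι → ℝ} (hc : ∀ i, 0 < c i) (j : ι)
    (B : LinearMap.BilinForm ℝ (D.complIdeal j).toSubmodule) :
    (IsInnerProduct B ∧ IsAdInvariant (D.complIdeal j).toSubmodule B) ↔
      ∃ β : ι → ℝ, (∀ i, i ≠ j → 0 < β i) ∧ ∀ X Y : (D.complIdeal j).toSubmodule,
        B X Y = ∑ i ∈ Finset.univ.erase j, β i * D.form c i X Y := by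
  constructor
  · rintro ⟨hB, hB2⟩
    have hlie : ∀ X Y : L, ((D.projCompl j ⁅X, Y⁆ : (D.complIdeal j).toSubmodule) : L) =
        ⁅(D.projCompl j X : L), (D.projCompl j Y : L)⁆ := fun X Y => by
      apply D.ext_proj
      intro i
      rw [proj_lie]
      simp only [coe_projCompl, map_sub]
      by_cases hi : i = j
      · subst hi
        simp
      · simp [D.proj_of_ne (Ne.symm hi), proj_lie]
    have hQL : LinearMap.BilinForm.lieInvariant L
        (B.compl₁₂ (D.projCompl j) (D.projCompl j)) := fun X Y Z => by
      have := hB2 (D.projCompl j X) (D.projCompl j Y) (D.projCompl j Z) _ _ (hlie X Y) (hlie X Z)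
      simp only [LinearMap.compl₁₂_apply]
      linarith
    obtain ⟨γ, hγ⟩ := D.exists_eq_sum_form hS hSL hc
      (Q := B.compl₁₂ (D.projCompl j) (D.projCompl j)) (fun X Y => hB.1 _ _) hQL
    have hBγ : ∀ X Y : (D.complIdeal j).toSubmodule,
        B X Y = (∑ i, γ i • D.form c i) (X : L) (Y : L) := fun X Y => by
      rw [← hγ, LinearMap.compl₁₂_apply, projCompl_coe, projCompl_coe]
    refine ⟨γ, fun i hi => ?_, fun X Y => ?_⟩
    · have := D.isSimple i
      have := LieAlgebra.IsSimple.nontrivial ℝ (D.ideal i)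
      obtain ⟨X, hX⟩ := exists_ne (0 : D.ideal i)
      have hXj : (X : L) ∈ D.complIdeal j := D.mem_complIdeal.2 (D.proj_of_ne hi X)
      have hpos := hB.2 ⟨(X : L), hXj⟩ fun h => hX (Subtype.ext (Subtype.ext_iff.1 h :))
      rw [hBγ, D.sum_form_of_mem_left X.2] at hpos
      exact pos_of_mul_pos_left hpos (D.form_self_nonneg hS hSL hc i _)
    · rw [hBγ, sum_form_apply, ← Finset.add_sum_erase _ _ (Finset.mem_univ j), form_apply,
        D.mem_complIdeal.1 X.2]
      simp
  · rintro ⟨β, hβ, hB⟩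
    refine ⟨⟨fun X Y => ?_, fun X hX => ?_⟩, fun Z X Y U V hU hV => ?_⟩
    · rw [hB, hB]
      exact Finset.sum_congr rfl fun i _ => by rw [D.form_comm]
    · rw [hB]
      refine Finset.sum_pos' (fun i hi => mul_nonneg (hβ i (Finset.ne_of_mem_erase hi)).le
        (D.form_self_nonneg hS hSL hc i _)) ?_
      by_contra! h
      apply hX
      ext
      apply D.ext_proj
      intro i
      rw [ZeroMemClass.coe_zero, map_zero]
      by_cases hi : i = j
      · subst hi
        exact D.mem_complIdeal.1 X.2
      · by_contra h'
        exact (h i (by simp [hi])).not_gt (mul_pos (hβ i hi) (D.form_self_pos hS hSL hc h'))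
    · rw [hB, hB, ← Finset.sum_add_distrib]
      refine Finset.sum_eq_zero fun i _ => ?_
      rw [hU, hV, D.lieInvariant_form c i]
      ring

variable {K : Type*} [LieRing K] [LieAlgebra ℝ K] [FiniteDimensional ℝ K]

/-- The projection of a subalgebra to a simple ideal, as a homomorphism of Lie algebras. -/
noncomputable def subProjHom (inc : K →ₗ⁅ℝ⁆ L) (i : ι) : K →ₗ⁅ℝ⁆ D.ideal i := (D.projHom i).comp inc

theorem subProj_apply (inc : K →ₗ[ℝ] L) (i : ι) (Z : K) :
    D.subProj inc i Z = D.proj i (inc Z) := rfl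

theorem subProj_injective (hK : LieAlgebra.IsSimple ℝ K) (inc : K →ₗ⁅ℝ⁆ L) {i : ι}
    (hi : D.subProj (inc : K →ₗ[ℝ] L) i ≠ 0) :
    Function.Injective (D.subProj (inc : K →ₗ[ℝ] L) i) := by
  refine hK.injective_of_ne_zero (D.subProjHom inc i) fun h => hi ?_
  ext Z
  exact congrArg Subtype.val (LieHom.congr_fun h Z)

theorem exists_isNormalization {S : LinearMap.BilinForm ℝ L} (hS : IsInnerProduct S)
    (hSL : S.lieInvariant L) (hK : LieAlgebra.IsSimple ℝ K) (inc : K →ₗ⁅ℝ⁆ L)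
    (hinc : Function.Injective inc) :
    ∃ c : ι → ℝ, D.IsNormalization (inc : K →ₗ[ℝ] L) c := by
  suffices h : ∀ i, ∃ c : ℝ, (D.subProj (inc : K →ₗ[ℝ] L) i = 0 → c = 1) ∧
      (D.subProj (inc : K →ₗ[ℝ] L) i ≠ 0 → 0 < c ∧
      ∀ Z W : K, -c * killingForm ℝ (D.ideal i) (D.subProj (inc : K →ₗ[ℝ] L) i Z)
        (D.subProj (inc : K →ₗ[ℝ] L) i W) = -killingForm ℝ K Z W) by
    choose c hc using h
    exact ⟨c, hc⟩
  intro i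
  by_cases hi : D.subProj (inc : K →ₗ[ℝ] L) i = 0
  · exact ⟨1, fun _ => rfl, fun h => absurd hi h⟩
  have hKS := _root_.isInnerProduct_neg_killingForm hK
    (hS.compl₁₂ (φ := (inc : K →ₗ[ℝ] L)) hinc) (hSL.compl₁₂ inc)
  have hinj := D.subProj_injective hK inc hi
  have hQ := (D.isInnerProduct_neg_killingForm hS hSL i).compl₁₂ hinj
  obtain ⟨t, ht⟩ := eq_smul_of_lieInvariant hK hKS (lieInvariant_neg_killingForm K) hQ.1
    ((lieInvariant_neg_killingForm (D.ideal i)).compl₁₂ (D.subProjHom inc i))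
  have := LieAlgebra.IsSimple.nontrivial ℝ K
  obtain ⟨Z, hZ⟩ := exists_ne (0 : K)
  have h1 := hQ.2 Z hZ
  have h2 := hKS.2 Z hZ
  rw [ht] at h1
  have htpos : 0 < t := by
    rw [LinearMap.smul_apply, LinearMap.smul_apply, smul_eq_mul] at h1
    exact pos_of_mul_pos_left h1 h2.le
  refine ⟨t⁻¹, fun h => absurd h hi, fun _ => ⟨inv_pos.2 htpos, fun Z W => ?_⟩⟩
  have := LinearMap.congr_fun₂ ht Z W
  simp only [LinearMap.compl₁₂_apply, LinearMap.smul_apply, LinearMap.neg_apply,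
    smul_eq_mul] at this
  rw [neg_mul, ← mul_neg, this]
  field_simp

theorem IsNormalization.pos {inc : K →ₗ[ℝ] L} {c : ι → ℝ} (hc : D.IsNormalization inc c) (i : ι) :
    0 < c i := by
  by_cases hi : D.subProj inc i = 0
  · rw [(hc i).1 hi]
    exact one_pos
  · exact ((hc i).2 hi).1

open Classical in
theorem sum_form_inc {inc : K →ₗ[ℝ] L} {c : ι → ℝ} (hc : D.IsNormalization inc c) (γ : ι → ℝ)
    (Z W : K) : (∑ i, γ i • D.form c i) (inc Z) (inc W) =
      (∑ i with D.subProj inc i ≠ 0, γ i) * -killingForm ℝ K Z W := by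
  rw [sum_form_apply, Finset.sum_mul, Finset.sum_filter]
  refine Finset.sum_congr rfl fun i _ => ?_
  rw [form_apply, ← subProj_apply, ← subProj_apply]
  split_ifs with h
  · rw [((hc i).2 h).2]
  · rw [not_not.1 h]
    simp

end SimpleIdealDecomposition

/-! ### Naturally reductive pairs in a Lie algebra -/

section

variable {L K : Type*} [LieRing L] [LieAlgebra ℝ L] [LieRing K] [LieAlgebra ℝ K]

/-- The infinitesimal version of a naturally reductive pair: the invariance under a group is
replaced with the invariance under the Lie algebra `K`. -/
structure IsInfinitesimallyNaturallyReductive (inc : K →ₗ⁅ℝ⁆ L) (p : Submodule ℝ L)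
    (B : LinearMap.BilinForm ℝ p) : Prop where
  isCompl : IsCompl p (LinearMap.range (inc : K →ₗ[ℝ] L))
  lie_mem : ∀ Z : K, ∀ X ∈ p, ⁅inc Z, X⁆ ∈ p
  isInnerProduct : IsInnerProduct B
  lie_invariant : ∀ (Z : K) (X Y : p),
    B ⟨⁅inc Z, (X : L)⁆, lie_mem Z X X.2⟩ Y + B X ⟨⁅inc Z, (Y : L)⁆, lie_mem Z Y Y.2⟩ = 0
  reductive : ∀ X Y : p, B (p.projectionOnto _ isCompl ⁅(X : L), (Y : L)⁆) X = 0

namespace IsInfinitesimallyNaturallyReductive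

variable {inc : K →ₗ⁅ℝ⁆ L} {p : Submodule ℝ L} {B : LinearMap.BilinForm ℝ p}
  (h : IsInfinitesimallyNaturallyReductive inc p B)

include h

theorem exists_decomposition (hinc : Function.Injective inc) :
    ∃ (P : L →ₗ[ℝ] L) (ρ : L →ₗ[ℝ] K) (F : LinearMap.BilinForm ℝ L),
      (∀ X, P X ∈ p) ∧ (∀ X, P X + inc (ρ X) = X) ∧ (∀ X ∈ p, P X = X) ∧ (∀ X ∈ p, ρ X = 0) ∧
      (∀ Z, P (inc Z) = 0) ∧ (∀ Z, ρ (inc Z) = Z) ∧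
      (∀ X Y, F X Y = F Y X) ∧ (∀ X Y, F (P X) Y = F X Y) ∧ (∀ Z X, F (inc Z) X = 0) ∧
      (∀ X ∈ p, X ≠ 0 → 0 < F X X) ∧ (∀ X Y : p, F X Y = B X Y) ∧
      (∀ Z X Y, F ⁅inc Z, X⁆ Y + F X ⁅inc Z, Y⁆ = 0) ∧
      (∀ X ∈ p, ∀ Y ∈ p, ∀ Z ∈ p, F ⁅X, Y⁆ Z + F Y ⁅X, Z⁆ = 0) := by
  let π := p.projectionOnto _ h.isCompl
  let e := LinearEquiv.ofInjective (inc : K →ₗ[ℝ] L) hinc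
  let ρ : L →ₗ[ℝ] K := e.symm.toLinearMap ∘ₗ Submodule.projectionOnto _ p h.isCompl.symm
  have hπ : ∀ X ∈ p, (π X : L) = X := fun X hX => by
    simp only [π]
    rw [Submodule.projectionOnto_apply_of_mem_left h.isCompl hX]
  have hπ2 : ∀ X : p, π (X : L) = X := fun X => Subtype.ext (hπ X X.2)
  have hπK : ∀ Z, π (inc Z) = 0 := fun Z =>
    (Submodule.projectionOnto_apply_eq_zero_iff h.isCompl).2 ⟨Z, rfl⟩
  have hρp : ∀ X ∈ p, ρ X = 0 := fun X hX => by
    simp only [ρ, LinearMap.comp_apply]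
    rw [(Submodule.projectionOnto_apply_eq_zero_iff h.isCompl.symm).2 hX, map_zero]
  have hρK : ∀ Z, ρ (inc Z) = Z := fun Z => by
    simp only [ρ, LinearMap.comp_apply]
    rw [Submodule.projectionOnto_apply_of_mem_left h.isCompl.symm (x := inc Z) ⟨Z, rfl⟩]
    exact e.symm_apply_apply Z
  have hdec : ∀ X, ((π X : p) : L) + inc (ρ X) = X := fun X => by
    have hX : X ∈ p ⊔ LinearMap.range (inc : K →ₗ[ℝ] L) := by
      rw [h.isCompl.sup_eq_top]
      trivial
    obtain ⟨Y, hY, _, ⟨Z, rfl⟩, rfl⟩ := Submodule.mem_sup.1 hX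
    change ((π (Y + inc Z) : p) : L) + inc (ρ (Y + inc Z)) = Y + inc Z
    rw [map_add, map_add, hπK, hρp _ hY, hρK, add_zero, zero_add, hπ Y hY]
  have hπinc : ∀ Z X, π ⁅inc Z, X⁆ = ⟨⁅inc Z, (π X : L)⁆, h.lie_mem Z _ (π X).2⟩ := fun Z X => by
    conv_lhs => rw [← hdec X]
    rw [lie_add, map_add, ← LieHom.map_lie, hπK, add_zero]
    exact Subtype.ext (hπ _ (h.lie_mem Z _ (π X).2))
  refine ⟨p.subtype ∘ₗ π, ρ, B.compl₁₂ π π, fun X => (π X).2, hdec, hπ, hρp,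
    fun Z => by simp [hπK], hρK, fun X Y => h.isInnerProduct.1 _ _, fun X Y => by simp [hπ2],
    fun Z X => by simp [hπK], fun X hX h0 => ?_, fun X Y => by simp [hπ2], fun Z X Y => ?_, ?_⟩
  · refine h.isInnerProduct.2 _ fun h' => h0 ?_
    rw [← hπ X hX, h']
    rfl
  · simp only [LinearMap.compl₁₂_apply, hπinc]
    exact h.lie_invariant Z _ _
  · intro X hX Y hY Z hZ
    have hsk : ∀ U V W : p, B (π ⁅(U : L), (V : L)⁆) W + B (π ⁅(W : L), (V : L)⁆) U = 0 := by
      intro U V W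
      have h1 := h.reductive (U + W) V
      simp only [Submodule.coe_add, add_lie, map_add, LinearMap.add_apply] at h1
      have h2 := h.reductive U V
      have h3 := h.reductive W V
      simp only [π]
      linarith
    simp only [LinearMap.compl₁₂_apply]
    have h1 := hsk ⟨Y, hY⟩ ⟨X, hX⟩ ⟨Z, hZ⟩
    rw [← lie_skew, ← lie_skew X Z, map_neg, map_neg, map_neg, LinearMap.neg_apply]
    have hY' : π Y = ⟨Y, hY⟩ := hπ2 ⟨Y, hY⟩
    have hZ' : π Z = ⟨Z, hZ⟩ := hπ2 ⟨Z, hZ⟩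
    rw [hY', hZ', h.isInnerProduct.1 ⟨Y, hY⟩, map_neg, LinearMap.neg_apply]
    simp only at h1
    linarith

/-- Kostant's theorem for a simple isotropy algebra: a naturally reductive form on a complement
which is not an ideal is the restriction of an invariant form on the whole algebra. -/
theorem isIdeal_or_exists_lieInvariant (hinc : Function.Injective inc)
    (hK : LieAlgebra.IsSimple ℝ K) :
    (∀ X : L, ∀ Y ∈ p, ⁅X, Y⁆ ∈ p) ∨ ∃ Q : LinearMap.BilinForm ℝ L, (∀ X Y, Q X Y = Q Y X) ∧
      Q.lieInvariant L ∧ (∀ Z, ∀ X ∈ p, Q (inc Z) X = 0) ∧ ∀ X Y : p, Q X Y = B X Y := by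
  obtain ⟨P, ρ, F, hPp, hdec, hPid, hρp, hPinc, hρinc, hF, hFP, hFinc, -, hFB, hFK, hFp⟩ :=
    h.exists_decomposition hinc
  have hρlie : ∀ Z, ∀ X, ρ ⁅inc Z, X⁆ = ⁅Z, ρ X⁆ := fun Z X => by
    conv_lhs => rw [← hdec X]
    rw [lie_add, map_add, hρp _ (h.lie_mem Z _ (hPp X)), zero_add, ← LieHom.map_lie, hρinc]
  have hPlie : ∀ Z, ∀ X, P ⁅inc Z, X⁆ = ⁅inc Z, P X⁆ := fun Z X => by
    conv_lhs => rw [← hdec X]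
    rw [lie_add, map_add, hPid _ (h.lie_mem Z _ (hPp X)), ← LieHom.map_lie, hPinc, add_zero]
  -- the bracket of two elements of `p`, projected to `K`
  let s : L →ₗ[ℝ] L →ₗ[ℝ] K :=
    ((LieModule.toEnd ℝ L L : L →ₗ[ℝ] Module.End ℝ L).compr₂ ρ).compl₁₂ P P
  have hs : ∀ X Y, s X Y = ρ ⁅P X, P Y⁆ := fun X Y => rfl
  let r : L →ₗ[ℝ] L →ₗ[ℝ] K →ₗ[ℝ] ℝ := LinearMap.mk₂ ℝ
    (fun X Y => F.flip (P Y) ∘ₗ (LieModule.toEnd ℝ L L : L →ₗ[ℝ] Module.End ℝ L).flip (P X) ∘ₗ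
      (inc : K →ₗ[ℝ] L))
    (fun _ _ _ => by ext; simp) (fun _ _ _ => by ext; simp) (fun _ _ _ => by ext; simp)
    (fun _ _ _ => by ext; simp)
  have hr : ∀ X Y Z, r X Y Z = F ⁅inc Z, P X⁆ (P Y) := fun X Y Z => rfl
  let σ : L ⊗[ℝ] L →ₗ[ℝ] K := TensorProduct.lift s
  let R : L ⊗[ℝ] L →ₗ[ℝ] K →ₗ[ℝ] ℝ := TensorProduct.lift r
  have hσ : ∀ X Y, σ (X ⊗ₜ Y) = ρ ⁅P X, P Y⁆ := fun X Y => by simp [σ, hs]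
  have hR : ∀ X Y Z, R (X ⊗ₜ Y) Z = F ⁅inc Z, P X⁆ (P Y) := fun X Y Z => by simp [R, hr]
  -- the pair symmetry of the curvature
  have hsymm0 : ∀ X ∈ p, ∀ Y ∈ p, ∀ U ∈ p, ∀ V ∈ p,
      F ⁅inc (ρ ⁅X, Y⁆), U⁆ V = F ⁅inc (ρ ⁅U, V⁆), X⁆ Y := by
    have key : ∀ X ∈ p, ∀ Y ∈ p, ∀ U ∈ p, ∀ V ∈ p,
        F ⁅inc (ρ ⁅X, Y⁆), U⁆ V = F ⁅⁅X, Y⁆, U⁆ V - F ⁅X, Y⁆ ⁅U, V⁆ := by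
      intro X hX Y hY U hU V hV
      have h1 : inc (ρ ⁅X, Y⁆) = ⁅X, Y⁆ - P ⁅X, Y⁆ := by
        rw [eq_sub_iff_add_eq, add_comm, hdec]
      have h2 : F ⁅P ⁅X, Y⁆, U⁆ V = F ⁅X, Y⁆ ⁅U, V⁆ := by
        have := hFp U hU _ (hPp ⁅X, Y⁆) V hV
        rw [hFP] at this
        rw [← lie_skew, map_neg, LinearMap.neg_apply]
        linarith
      rw [h1, sub_lie, map_sub, LinearMap.sub_apply, h2]
    intro X hX Y hY U hU V hV
    have anti : ∀ X ∈ p, ∀ Y ∈ p, ∀ U ∈ p, ∀ V ∈ p,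
        F ⁅⁅X, Y⁆, U⁆ V = - F ⁅⁅X, Y⁆, V⁆ U := by
      intro X hX Y hY U hU V hV
      have h1 := key X hX Y hY U hU V hV
      have h2 := key X hX Y hY V hV U hU
      have h3 := hFK (ρ ⁅X, Y⁆) U V
      rw [hF U] at h3
      have h4 : F ⁅X, Y⁆ ⁅V, U⁆ = - F ⁅X, Y⁆ ⁅U, V⁆ := by
        rw [← lie_skew V U, map_neg]
      linarith
    have skew : ∀ X Y U V : L, F ⁅⁅X, Y⁆, U⁆ V = - F ⁅⁅Y, X⁆, U⁆ V := fun X Y U V => by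
      rw [← lie_skew X Y, neg_lie, map_neg, LinearMap.neg_apply]
    have jac : ∀ X Y U V : L, F ⁅⁅X, Y⁆, U⁆ V + F ⁅⁅Y, U⁆, X⁆ V + F ⁅⁅U, X⁆, Y⁆ V = 0 := by
      intro X Y U V
      have := lie_jacobi X Y U
      rw [← lie_skew X ⁅Y, U⁆, ← lie_skew Y ⁅U, X⁆, ← lie_skew U ⁅X, Y⁆] at this
      rw [← LinearMap.add_apply, ← LinearMap.add_apply, ← map_add, ← map_add]
      have h2 : ⁅⁅X, Y⁆, U⁆ + ⁅⁅Y, U⁆, X⁆ + ⁅⁅U, X⁆, Y⁆ = 0 := by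
        rw [← neg_eq_zero, ← this]
        abel
      rw [h2]
      simp
    rw [key X hX Y hY U hU V hV, key U hU V hV X hX Y hY, hF ⁅X, Y⁆]
    have j1 := jac X Y U V
    have j2 := jac Y U V X
    have j3 := jac U V X Y
    have j4 := jac V X Y U
    have a1 := anti X hX Y hY U hU V hV
    have a2 := anti Y hY U hU V hV X hX
    have a3 := anti U hU X hX V hV Y hY
    have a4 := anti U hU V hV X hX Y hY
    have a5 := anti V hV Y hY U hU X hX
    have a6 := anti V hV X hX Y hY U hU
    have s1 := skew U X V Y
    have s2 := skew V Y U X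
    have s3 := skew V Y X U
    have s4 := skew U X Y V
    linarith
  have hsymm : ∀ θ η, R θ (σ η) = R η (σ θ) := by
    intro θ η
    induction θ with
    | zero => simp
    | add a b ha hb => simp only [map_add, LinearMap.add_apply, ha, hb]
    | tmul X Y =>
      induction η with
      | zero => simp
      | add a b ha hb => simp only [map_add, LinearMap.add_apply, ha, hb]
      | tmul U V =>
        rw [hR, hR, hσ, hσ]
        exact hsymm0 _ (hPp U) _ (hPp V) _ (hPp X) _ (hPp Y)
  -- the image of `σ` is an ideal of `K`
  let I : LieIdeal ℝ K :=
    { LinearMap.range σ with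
      lie_mem := by
        rintro Z _ ⟨θ, rfl⟩
        change ⁅Z, σ θ⁆ ∈ LinearMap.range σ
        induction θ with
        | zero => simp
        | add a b ha hb =>
          rw [map_add, lie_add]
          exact add_mem ha hb
        | tmul X Y =>
          refine ⟨⁅inc Z, X⁆ ⊗ₜ Y + X ⊗ₜ ⁅inc Z, Y⁆, ?_⟩
          rw [map_add, hσ, hσ, hσ, ← hρlie, hPlie, hPlie, ← map_add, ← leibniz_lie] }
  have hI : ∀ Z, Z ∈ I ↔ ∃ θ, σ θ = Z := fun Z => Iff.rfl
  rcases hK.eq_bot_or_eq_top I with hbot | htop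
  · left
    intro X Y hY
    rw [← hdec X, add_lie]
    refine add_mem ?_ (h.lie_mem _ _ hY)
    have h1 : ρ ⁅P X, Y⁆ = 0 := by
      have : σ (X ⊗ₜ Y) ∈ I := (hI _).2 ⟨_, rfl⟩
      rw [hbot, hσ, hPid Y hY] at this
      simpa using this
    rw [← hdec ⁅P X, Y⁆, h1, map_zero, add_zero]
    exact hPp _
  · right
    obtain ⟨τ, hτ⟩ := σ.exists_rightInverse_of_surjective (LinearMap.range_eq_top.2 fun Z =>
      (hI Z).1 (by rw [htop]; trivial))
    replace hτ : ∀ Z, σ (τ Z) = Z := fun Z => LinearMap.congr_fun hτ Z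
    let C : LinearMap.BilinForm ℝ K := R ∘ₗ τ
    have hC : ∀ θ W, C (σ θ) W = R θ W := fun θ W => by
      change R (τ (σ θ)) W = _
      rw [← hτ W, hsymm, hτ, hsymm]
    have hCs : ∀ Z W, C Z W = C W Z := fun Z W => by
      rw [← hτ Z, hC, ← hτ W, hC, hsymm]
    have hC2 : ∀ X ∈ p, ∀ Y ∈ p, ∀ Z, C (ρ ⁅X, Y⁆) Z = F ⁅inc Z, X⁆ Y := fun X hX Y hY Z => by
      have := hC (X ⊗ₜ Y) Z
      rwa [hσ, hR, hPid X hX, hPid Y hY] at this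
    have hCinv : ∀ W Z Z' : K, C ⁅W, Z⁆ Z' + C Z ⁅W, Z'⁆ = 0 := by
      intro W Z Z'
      rw [← hτ Z]
      generalize τ Z = θ
      induction θ with
      | zero => simp
      | add a b ha hb =>
        simp only [map_add, lie_add, LinearMap.add_apply]
        linarith
      | tmul X Y =>
        rw [hσ]
        have h1 : ⁅W, ρ ⁅P X, P Y⁆⁆ = ρ ⁅⁅inc W, P X⁆, P Y⁆ + ρ ⁅P X, ⁅inc W, P Y⁆⁆ := by
          rw [← hρlie, leibniz_lie, map_add]
        rw [h1, map_add, LinearMap.add_apply, hC2 _ (h.lie_mem _ _ (hPp X)) _ (hPp Y),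
          hC2 _ (hPp X) _ (h.lie_mem _ _ (hPp Y)), hC2 _ (hPp X) _ (hPp Y)]
        have h2 := hFK W ⁅inc Z', P X⁆ (P Y)
        have h3 : ⁅inc ⁅W, Z'⁆, P X⁆ = ⁅inc W, ⁅inc Z', P X⁆⁆ - ⁅inc Z', ⁅inc W, P X⁆⁆ := by
          rw [LieHom.map_lie, lie_lie]
        rw [h3, map_sub, LinearMap.sub_apply]
        linarith
    refine ⟨F + C.compl₁₂ ρ ρ, fun X Y => ?_, ?_, fun Z X hX => ?_, fun X Y => ?_⟩
    · simp only [LinearMap.add_apply, LinearMap.compl₁₂_apply]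
      rw [hF, hCs]
    · have hinv : ∀ X Y Z : L, F ⁅X, Y⁆ Z + C (ρ ⁅X, Y⁆) (ρ Z) + (F Y ⁅X, Z⁆ + C (ρ Y) (ρ ⁅X, Z⁆)) = 0 := by
        intro X Y Z
        have hFinc' : ∀ Z X, F X (inc Z) = 0 := fun Z X => by rw [hF, hFinc]
        rw [← hdec X, ← hdec Y, ← hdec Z]
        simp only [add_lie, lie_add, map_add, LinearMap.add_apply, hρinc, hFinc, hFinc',
          ← LieHom.map_lie, hρp _ (hPp _), add_zero, zero_add,
          hρp _ (h.lie_mem _ _ (hPp _))]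
        have e1 := hFp _ (hPp X) _ (hPp Y) _ (hPp Z)
        have e2 := hFK (ρ X) (P Y) (P Z)
        have e3 := hCinv (ρ X) (ρ Y) (ρ Z)
        have e4 := hC2 _ (hPp X) _ (hPp Y) (ρ Z)
        have e5 := hC2 _ (hPp X) _ (hPp Z) (ρ Y)
        have e6 : ∀ (W : K) (V : L), F ⁅V, inc W⁆ = - F ⁅inc W, V⁆ := fun W V => by rw [← lie_skew, map_neg]
        have e7 : ∀ W, ρ ⁅P X, inc W⁆ = 0 := fun W => by
          rw [← lie_skew, map_neg, hρp _ (h.lie_mem _ _ (hPp _)), neg_zero]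
        rw [hF (P Y) ⁅P X, inc (ρ Z)⁆, hCs (ρ Y) (ρ ⁅P X, P Z⁆)]
        simp only [e6, e7, LinearMap.neg_apply, map_zero, LinearMap.zero_apply] at *
        linarith
      intro X Y Z
      have := hinv X Y Z
      simp only [LinearMap.add_apply, LinearMap.compl₁₂_apply]
      linarith
    · simp [hFinc, hρp X hX]
    · simp [hFB, hρp _ X.2]

end IsInfinitesimallyNaturallyReductive

end

namespace IsInfinitesimallyNaturallyReductive

variable {L K : Type*} [LieRing L] [LieAlgebra ℝ L] [LieRing K] [LieAlgebra ℝ K]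
  {inc : K →ₗ⁅ℝ⁆ L} {p : Submodule ℝ L} {B : LinearMap.BilinForm ℝ p}

theorem of_lieInvariant (hp : IsCompl p (LinearMap.range (inc : K →ₗ[ℝ] L)))
    {Q : LinearMap.BilinForm ℝ L} (hQL : Q.lieInvariant L)
    (hB : IsInnerProduct B) (hQB : ∀ X Y : p, B X Y = Q X Y)
    (hpK : ∀ Z, ∀ X ∈ p, ⁅inc Z, X⁆ ∈ p)
    (h : (∀ X : L, ∀ Y ∈ p, ⁅X, Y⁆ ∈ p) ∨ ∀ Z, ∀ X ∈ p, Q (inc Z) X = 0) :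
    IsInfinitesimallyNaturallyReductive inc p B where
  isCompl := hp
  lie_mem := hpK
  isInnerProduct := hB
  lie_invariant Z X Y := by
    rw [hQB, hQB, hQL (inc Z)]
    simp
  reductive X Y := by
    have h1 : Q ⁅(X : L), (Y : L)⁆ X = 0 := by
      have h2 := hQL (X : L) Y X
      rw [lie_self, map_zero, neg_zero] at h2
      exact h2
    rw [hQB]
    rcases h with h | h
    · rw [Submodule.projectionOnto_apply_of_mem_left hp (h _ _ Y.2)]
      exact h1
    · have h2 := Submodule.projection_add_projection_eq_self hp ⁅(X : L), (Y : L)⁆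
      obtain ⟨Z, hZ⟩ : Submodule.projection _ _ hp.symm ⁅(X : L), (Y : L)⁆ ∈
        LinearMap.range (inc : K →ₗ[ℝ] L) := Submodule.projection_apply_mem hp.symm _
      rw [← h2, ← hZ, map_add, LinearMap.add_apply] at h1
      have h3 := h Z X X.2
      simp only [LieHom.coe_toLinearMap] at h1
      rw [h3, add_zero] at h1
      exact h1

end IsInfinitesimallyNaturallyReductive

namespace SimpleIdealDecomposition

variable {L : Type*} [LieRing L] [LieAlgebra ℝ L] [FiniteDimensional ℝ L]
  {ι : Type*} [DecidableEq ι] [Fintype ι] (D : SimpleIdealDecomposition L ι)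
  {K : Type*} [LieRing K] [LieAlgebra ℝ K] [FiniteDimensional ℝ K]
  {S : LinearMap.BilinForm ℝ L} {inc : K →ₗ⁅ℝ⁆ L}
  {c : ι → ℝ} {p : Submodule ℝ L} {B : LinearMap.BilinForm ℝ p}

include D

theorem le_or_proj_eq_zero (hp : ∀ X : L, ∀ Y ∈ p, ⁅X, Y⁆ ∈ p) (i : ι) :
    (∀ X ∈ D.ideal i, X ∈ p) ∨ ∀ X ∈ p, D.proj i X = 0 := by
  let J : LieIdeal ℝ (D.ideal i) :=
    { p.comap (D.ideal i).toSubmodule.subtype with lie_mem := fun {X Y} hY => hp X Y hY }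
  have hJ : ∀ X : D.ideal i, X ∈ J ↔ (X : L) ∈ p := fun X => Iff.rfl
  rcases (D.isSimple i).eq_bot_or_eq_top J with h | h
  · right
    intro X hX
    by_contra h'
    obtain ⟨Y, hY⟩ := (D.isSimple i).exists_lie_ne_zero h'
    apply hY
    have h1 : ⁅X, (Y : L)⁆ ∈ D.ideal i := lie_mem_right _ _ _ _ _ Y.2
    have h2 : (⟨⁅X, (Y : L)⁆, h1⟩ : D.ideal i) ∈ J := by
      have h2 := p.neg_mem (hp (Y : L) X hX)
      rw [lie_skew] at h2
      exact (hJ _).2 h2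
    rw [h, LieSubmodule.mem_bot] at h2
    have h3 : ⁅X, (Y : L)⁆ = 0 := Subtype.ext_iff.1 h2
    rw [← D.proj_coe i Y, ← proj_lie, h3, map_zero]
  · left
    intro X hX
    rw [← hJ ⟨X, hX⟩, h]
    trivial

theorem isIdealPair_of_isIdeal (hK : LieAlgebra.IsSimple ℝ K) (hinc : Function.Injective inc)
    (h : IsInfinitesimallyNaturallyReductive inc p B) (hp : ∀ X : L, ∀ Y ∈ p, ⁅X, Y⁆ ∈ p) :
    D.IsIdealPair (inc : K →ₗ[ℝ] L) p B := by
  obtain ⟨P, ρ, F, hPp, hdec, hPid, hρp, hPinc, hρinc, hF, hFP, hFinc, -, hFB, hFK, hFp⟩ :=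
    h.exists_decomposition hinc
  have hle := D.le_or_proj_eq_zero hp
  have hsurj : ∀ i, (∀ X ∈ p, D.proj i X = 0) →
      ∀ X, D.subProj (inc : K →ₗ[ℝ] L) i (ρ X) = D.proj i X := by
    intro i hi X
    conv_rhs => rw [← hdec X]
    rw [map_add, hi _ (hPp X), zero_add]
    rfl
  have hbij : ∀ i, (∀ X ∈ p, D.proj i X = 0) →
      Function.Bijective (D.subProj (inc : K →ₗ[ℝ] L) i) := by
    intro i hi
    have hs : Function.Surjective (D.subProj (inc : K →ₗ[ℝ] L) i) := fun W =>
      ⟨ρ W, by rw [hsurj i hi, proj_coe]⟩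
    refine ⟨D.subProj_injective hK inc fun h0 => ?_, hs⟩
    have := D.isSimple i
    have := LieAlgebra.IsSimple.nontrivial ℝ (D.ideal i)
    obtain ⟨W, hW⟩ := exists_ne (0 : D.ideal i)
    obtain ⟨Z, rfl⟩ := hs W
    simp [h0] at hW
  have hex : ∃ j, ∀ X ∈ p, D.proj j X = 0 := by
    by_contra! hno
    have := LieAlgebra.IsSimple.nontrivial ℝ K
    obtain ⟨Z, hZ⟩ := exists_ne (0 : K)
    have hZp : inc Z ∈ p := by
      rw [← D.sum_proj (inc Z)]
      refine sum_mem fun i _ => ?_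
      rcases hle i with hi | hi
      · exact hi _ (D.proj i _).2
      · obtain ⟨X, hX, hX'⟩ := hno i
        exact absurd (hi X hX) hX'
    exact hZ (by rw [← hρinc Z, hρp _ hZp])
  obtain ⟨j, hj⟩ := hex
  have hother : ∀ i, i ≠ j → ∀ X ∈ D.ideal i, X ∈ p := by
    intro i hij
    refine (hle i).resolve_right fun hi => ?_
    have := D.isSimple i
    have := LieAlgebra.IsSimple.nontrivial ℝ (D.ideal i)
    obtain ⟨W, hW⟩ := exists_ne (0 : D.ideal i)
    have h1 : ρ (W : L) = 0 := by
      apply (hbij j hj).1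
      rw [hsurj j hj, D.proj_of_ne hij, map_zero]
    have h2 : (W : L) ∈ p := by
      rw [← hdec (W : L), h1, map_zero, add_zero]
      exact hPp _
    have h3 := hi _ h2
    rw [proj_coe] at h3
    exact hW h3
  refine ⟨j, hbij j hj, ?_, h.isInnerProduct, fun Z X Y U V hU hV => ?_⟩
  · ext X
    refine ⟨fun hX => D.mem_complIdeal.2 (hj X hX), fun hX => ?_⟩
    have hX : D.proj j X = 0 := D.mem_complIdeal.1 hX
    rw [← D.sum_proj X]
    refine sum_mem fun i _ => ?_
    by_cases hij : i = j
    · subst hij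
      rw [hX]
      exact p.zero_mem
    · exact hother i hij _ (D.proj i X).2
  · rw [← hFB, ← hFB, hU, hV]
    exact hFp _ Z.2 _ X.2 _ Y.2

theorem isFormPair_of_lieInvariant (hS : IsInnerProduct S) (hSL : S.lieInvariant L)
    (hK : LieAlgebra.IsSimple ℝ K) (hinc : Function.Injective inc)
    (hc : D.IsNormalization (inc : K →ₗ[ℝ] L) c)
    (hker : ∀ Q : LinearMap.BilinForm ℝ L, Q.lieInvariant L →
      LinearMap.ker Q ≠ LinearMap.range (inc : K →ₗ[ℝ] L))
    (h : IsInfinitesimallyNaturallyReductive inc p B) {Q : LinearMap.BilinForm ℝ L}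
    (hQ : ∀ X Y, Q X Y = Q Y X) (hQL : Q.lieInvariant L)
    (hQp : ∀ Z, ∀ X ∈ p, Q (inc Z) X = 0) (hQB : ∀ X Y : p, Q X Y = B X Y) :
    D.IsFormPair (inc : K →ₗ[ℝ] L) c p B := by
  classical
  obtain ⟨P, ρ, F, hPp, hdec, hPid, hρp, hPinc, hρinc, -⟩ := h.exists_decomposition hinc
  have hcp := IsNormalization.pos D hc
  obtain ⟨γ, rfl⟩ := D.exists_eq_sum_form hS hSL hcp hQ hQL
  have hKS := _root_.isInnerProduct_neg_killingForm hK
    (hS.compl₁₂ (φ := (inc : K →ₗ[ℝ] L)) hinc) (hSL.compl₁₂ inc)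
  have hinc2 := D.sum_form_inc hc γ
  set Q := ∑ i, γ i • D.form c i with hQdef
  set t := ∑ i with D.subProj (inc : K →ₗ[ℝ] L) i ≠ 0, γ i with ht
  have hself : ∀ X, Q X X = Q (P X) (P X) + t * -killingForm ℝ K (ρ X) (ρ X) := by
    intro X
    conv_lhs => rw [← hdec X]
    have h1 := hinc2 (ρ X) (ρ X)
    have h2 := hQp (ρ X) _ (hPp X)
    have h3 := hQ (P X) (inc (ρ X))
    simp only [LieHom.coe_toLinearMap] at h1
    simp only [map_add, LinearMap.add_apply]
    rw [h1, h3, h2]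
    ring
  have hpos : ∀ X ∈ p, X ≠ 0 → 0 < Q X X := fun X hX h0 => by
    have := hQB ⟨X, hX⟩ ⟨X, hX⟩
    rw [this]
    exact h.isInnerProduct.2 _ fun h' => h0 (Subtype.ext_iff.1 h')
  have hρ0 : ∀ X, ρ X = 0 → X ∈ p := fun X hX => by
    rw [← hdec X, hX, map_zero, add_zero]
    exact hPp X
  have ht0 : t ≠ 0 := by
    intro ht0
    apply hker Q hQL
    ext X
    rw [LinearMap.mem_ker]
    constructor
    · intro hX
      have h1 : Q (P X) (P X) = 0 := by
        have := hself X
        rw [hX, ht0] at this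
        simpa using this.symm
      have h2 : P X = 0 := by
        by_contra h2
        exact (hpos _ (hPp X) h2).ne' h1
      refine ⟨ρ X, ?_⟩
      conv_rhs => rw [← hdec X, h2, zero_add]
      rfl
    · rintro ⟨Z, rfl⟩
      ext Y
      rw [← hdec Y, map_add]
      have h1 := hinc2 Z (ρ Y)
      have h2 := hQp Z _ (hPp Y)
      simp only [LieHom.coe_toLinearMap] at h1 ⊢
      rw [h1, h2, ht0]
      simp
  refine ⟨γ, fun X => ⟨fun hX Z => hQp Z X hX, fun hX => hρ0 X ?_⟩, fun X Y => (hQB X Y).symm, ?_⟩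
  · by_contra h'
    have h1 := hX (ρ X)
    have h2 := hinc2 (ρ X) (ρ X)
    have h3 := hQp (ρ X) _ (hPp X)
    rw [← hQdef] at h1
    nth_rewrite 2 [← hdec X] at h1
    simp only [LieHom.coe_toLinearMap] at h1 h2
    rw [map_add, h2, h3, zero_add] at h1
    have h4 := hKS.2 _ h'
    simp only [LinearMap.neg_apply] at h4
    exact mul_ne_zero ht0 h4.ne' h1
  have hideal : ∀ i, ∀ X ∈ D.ideal i, Q X X = γ i * D.form c i X X := fun i X hX =>
    D.sum_form_of_mem_left hX X
  have hformpos : ∀ i (X : D.ideal i), X ≠ 0 → 0 < D.form c i X X := fun i X hX =>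
    D.form_self_pos hS hSL hcp (by rwa [proj_coe])
  rcases ht0.lt_or_gt with hneg | htpos
  · right
    obtain ⟨j, hj0, hj⟩ : ∃ j, D.subProj (inc : K →ₗ[ℝ] L) j ≠ 0 ∧ γ j < 0 := by
      by_contra! hno
      exact hneg.not_ge (Finset.sum_nonneg fun i hi => hno i (Finset.mem_filter.1 hi).2)
    have hinj := D.subProj_injective hK inc hj0
    let r : D.ideal j →ₗ[ℝ] K := ρ ∘ₗ (D.ideal j).toSubmodule.subtype
    have hr : Function.Injective r := by
      rw [injective_iff_map_eq_zero]
      intro X hX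
      by_contra hX0
      have h1 := hpos X (hρ0 X hX) fun h' => hX0 (Subtype.ext h')
      rw [hideal j X X.2] at h1
      exact h1.not_ge (mul_nonpos_of_nonpos_of_nonneg hj.le (hformpos j X hX0).le)
    have hdim : Module.finrank ℝ K = Module.finrank ℝ (D.ideal j) :=
      le_antisymm (LinearMap.finrank_le_finrank_of_injective hinj)
        (LinearMap.finrank_le_finrank_of_injective hr)
    refine ⟨j, ⟨hinj, (LinearMap.injective_iff_surjective_of_finrank_eq_finrank hdim).1 hinj⟩,
      hj, fun i hi => ?_, hneg⟩
    by_contra! hγ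
    have := D.isSimple i
    have := LieAlgebra.IsSimple.nontrivial ℝ (D.ideal i)
    obtain ⟨X, hX⟩ := exists_ne (0 : D.ideal i)
    obtain ⟨Y, hY⟩ := (LinearMap.injective_iff_surjective_of_finrank_eq_finrank hdim.symm).1 hr
      (-ρ X)
    have hXY : (X : L) + Y ∈ p := hρ0 _ (by
      rw [map_add]
      change _ + r Y = 0
      rw [hY, add_neg_cancel])
    have hne : (X : L) + Y ≠ 0 := fun h0 => hX (by
      have := congrArg (D.proj i) h0
      rwa [map_add, proj_coe, D.proj_of_ne hi.symm, add_zero, map_zero] at this)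
    have h1 := hpos _ hXY hne
    have h2 : Q (X : L) (Y : L) = 0 := by
      rw [D.sum_form_of_mem_left X.2, form_apply, D.proj_of_ne hi.symm]
      simp
    simp only [map_add, LinearMap.add_apply] at h1
    rw [hQ (Y : L) (X : L), h2, hideal i X X.2, hideal j Y Y.2] at h1
    have h3 := mul_nonpos_of_nonpos_of_nonneg hγ (hformpos i X hX).le
    have h4 := mul_nonpos_of_nonpos_of_nonneg hj.le (D.form_self_nonneg hS hSL hcp j (Y : L))
    linarith
  · left
    intro i
    have := D.isSimple i
    have := LieAlgebra.IsSimple.nontrivial ℝ (D.ideal i)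
    obtain ⟨X, hX⟩ := exists_ne (0 : D.ideal i)
    refine pos_of_mul_pos_left ?_ (hformpos i X hX).le
    rw [← hideal i X X.2, hself]
    have h1 : 0 ≤ t * -killingForm ℝ K (ρ X) (ρ X) := mul_nonneg htpos.le (hKS.self_nonneg _)
    by_cases hP : P X = 0
    · rw [hP, map_zero, zero_add]
      refine mul_pos htpos (hKS.2 _ fun h0 => hX ?_)
      have h2 := hdec (X : L)
      rw [hP, h0, map_zero, add_zero] at h2
      exact Subtype.ext h2.symm
    · exact add_pos_of_pos_of_nonneg (hpos _ (hPp _) hP) h1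

/-- Both kinds of pairs are described by invariant forms on the Lie algebra. -/
theorem exists_lieInvariant_of_pair (hS : IsInnerProduct S) (hSL : S.lieInvariant L)
    (hc : D.IsNormalization (inc : K →ₗ[ℝ] L) c)
    (h : D.IsIdealPair (inc : K →ₗ[ℝ] L) p B ∨ D.IsFormPair (inc : K →ₗ[ℝ] L) c p B) :
    ∃ Q : LinearMap.BilinForm ℝ L, (∀ X Y, Q X Y = Q Y X) ∧ Q.lieInvariant L ∧
      (∀ X Y : p, B X Y = Q X Y) ∧
      ((∃ R : LinearMap.BilinForm ℝ L, R.lieInvariant L ∧ ∀ X, X ∈ p ↔ R X = 0) ∨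
        ∀ X, X ∈ p ↔ ∀ Z, Q (inc Z) X = 0) := by
  have hcp := IsNormalization.pos D hc
  rcases h with ⟨j, hj, rfl, hB⟩ | ⟨γ, hp, hB, -⟩
  · obtain ⟨β, -, hβ⟩ := (D.isInnerProduct_and_isAdInvariant_iff hS hSL hcp j B).1 hB
    refine ⟨∑ i, (if i = j then 0 else β i) • D.form c i, D.sum_form_comm c _,
      D.lieInvariant_sum_form c _, fun X Y => ?_, Or.inl ⟨D.form c j, D.lieInvariant_form c j,
        fun X => ?_⟩⟩
    · rw [hβ, sum_form_apply, ← Finset.add_sum_erase _ _ (Finset.mem_univ j), if_pos rfl, zero_mul,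
        zero_add]
      exact Finset.sum_congr rfl fun i hi => by rw [if_neg (Finset.ne_of_mem_erase hi)]
    · change X ∈ D.complIdeal j ↔ _
      rw [D.mem_complIdeal]
      constructor
      · intro hX
        ext Y
        rw [form_apply, hX]
        simp
      · intro hX
        by_contra h'
        have := D.form_self_pos hS hSL hcp h'
        rw [hX] at this
        simp at this
  · exact ⟨_, D.sum_form_comm c γ, D.lieInvariant_sum_form c γ, hB, Or.inr hp⟩

theorem isInfinitesimallyNaturallyReductive_of_isIdealPair (hS : IsInnerProduct S)
    (hSL : S.lieInvariant L) (hc : D.IsNormalization (inc : K →ₗ[ℝ] L) c)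
    (h : D.IsIdealPair (inc : K →ₗ[ℝ] L) p B) : IsInfinitesimallyNaturallyReductive inc p B := by
  obtain ⟨Q, -, hQL, hQB, -⟩ := D.exists_lieInvariant_of_pair hS hSL hc (Or.inl h)
  obtain ⟨j, hj, rfl, hB⟩ := h
  have hideal : ∀ X : L, ∀ Y ∈ (D.complIdeal j).toSubmodule, ⁅X, Y⁆ ∈ (D.complIdeal j).toSubmodule :=
    fun X Y hY => (D.complIdeal j).lie_mem hY
  refine .of_lieInvariant ⟨?_, ?_⟩ hQL hB.1 hQB (fun Z => hideal _) (Or.inl hideal)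
  · rw [Submodule.disjoint_def]
    rintro _ hX ⟨Z, rfl⟩
    have h1 : D.subProj (inc : K →ₗ[ℝ] L) j Z = 0 := D.mem_complIdeal.1 hX
    rw [hj.1 (h1.trans (map_zero _).symm), map_zero]
  · rw [codisjoint_iff, eq_top_iff]
    intro X _
    obtain ⟨Z, hZ⟩ := hj.2 (D.proj j X)
    refine Submodule.mem_sup.2 ⟨X - inc Z, D.mem_complIdeal.2 ?_, inc Z, ⟨Z, rfl⟩,
      sub_add_cancel _ _⟩
    rw [map_sub, ← hZ]
    exact sub_self _

theorem isInfinitesimallyNaturallyReductive_of_isFormPair (hS : IsInnerProduct S)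
    (hSL : S.lieInvariant L) (hK : LieAlgebra.IsSimple ℝ K) (hinc : Function.Injective inc)
    (hc : D.IsNormalization (inc : K →ₗ[ℝ] L) c)
    (h : D.IsFormPair (inc : K →ₗ[ℝ] L) c p B) : IsInfinitesimallyNaturallyReductive inc p B := by
  classical
  have hcp := IsNormalization.pos D hc
  obtain ⟨γ, hp, hB, hγ⟩ := h
  have hKS := _root_.isInnerProduct_neg_killingForm hK
    (hS.compl₁₂ (φ := (inc : K →ₗ[ℝ] L)) hinc) (hSL.compl₁₂ inc)
  have hinc2 := D.sum_form_inc hc γ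
  have hQ := D.sum_form_comm c γ
  have hQL := D.lieInvariant_sum_form c γ
  have hself := fun X => D.sum_form_apply c γ X X
  set Q := ∑ i, γ i • D.form c i with hQdef
  set t := ∑ i with D.subProj (inc : K →ₗ[ℝ] L) i ≠ 0, γ i with ht
  simp only [LieHom.coe_toLinearMap] at hp hinc2
  -- positivity on `p`
  have hpos : ∀ X ∈ p, X ≠ 0 → 0 < Q X X := by
    intro X hX hX0
    rcases hγ with hγ | ⟨j, hj, hγj, hγ, htneg⟩
    · rw [hself]
      refine Finset.sum_pos' (fun i _ => mul_nonneg (hγ i).le (D.form_self_nonneg hS hSL hcp i X)) ?_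
      by_contra! hno
      exact hX0 (D.ext_proj fun i => by
        rw [map_zero]
        by_contra h'
        exact (hno i (Finset.mem_univ i)).not_gt (mul_pos (hγ i) (D.form_self_pos hS hSL hcp h')))
    · obtain ⟨Z, hZ⟩ := hj.2 (D.proj j X)
      have hYj : D.proj j (X - inc Z) = 0 := by
        rw [map_sub, ← hZ]
        exact sub_self _
      have h1 : Q (X - inc Z) (X - inc Z) = Q X X + t * -killingForm ℝ K Z Z := by
        have h2 := (hp X).1 hX Z
        have h3 := hQ X (inc Z)
        simp only [map_sub, LinearMap.sub_apply]
        rw [hinc2, h3, h2]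
        ring
      have hterm : ∀ i, 0 ≤ γ i * D.form c i (X - inc Z) (X - inc Z) := by
        intro i
        by_cases hi : i = j
        · subst hi
          rw [form_apply, hYj]
          simp
        · exact mul_nonneg (hγ i hi).le (D.form_self_nonneg hS hSL hcp i _)
      have h4 : 0 ≤ Q (X - inc Z) (X - inc Z) := by
        rw [hself]
        exact Finset.sum_nonneg fun i _ => hterm i
      by_cases hZ0 : Z = 0
      · subst hZ0
        rw [map_zero, sub_zero] at hterm hYj
        rw [hself]
        refine Finset.sum_pos' (fun i _ => hterm i) ?_
        by_contra! hno
        refine hX0 (D.ext_proj fun i => ?_)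
        rw [map_zero]
        by_cases hi : i = j
        · subst hi
          exact hYj
        · by_contra h'
          exact (hno i (Finset.mem_univ i)).not_gt
            (mul_pos (hγ i hi) (D.form_self_pos hS hSL hcp h'))
      · have h5 : t * -killingForm ℝ K Z Z < 0 := mul_neg_of_neg_of_pos htneg (hKS.2 _ hZ0)
        linarith
  have := LieAlgebra.IsSimple.nontrivial ℝ K
  have ht0 : t ≠ 0 := by
    rcases hγ with hγ | ⟨j, hj, hγj, hγ, htneg⟩
    · have hne : ∃ i, D.subProj (inc : K →ₗ[ℝ] L) i ≠ 0 := by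
        by_contra! hno
        obtain ⟨Z, hZ⟩ := exists_ne (0 : K)
        refine hZ (hinc (D.ext_proj fun i => ?_))
        rw [map_zero, map_zero]
        exact LinearMap.congr_fun (hno i) Z
      obtain ⟨i, hi⟩ := hne
      exact (Finset.sum_pos (fun i _ => hγ i) ⟨i, by simpa using hi⟩).ne'
    · exact htneg.ne
  -- the restriction of `Q` to `K` is nondegenerate
  have hcompl : IsCompl p (LinearMap.range (inc : K →ₗ[ℝ] L)) := by
    constructor
    · rw [Submodule.disjoint_def]
      rintro _ hX ⟨Z, rfl⟩
      by_contra hne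
      have h1 := (hp _).1 hX Z
      simp only [LieHom.coe_toLinearMap] at h1
      rw [hinc2] at h1
      have hZ : Z ≠ 0 := by
        rintro rfl
        simp at hne
      have := hKS.2 _ hZ
      simp only [LinearMap.neg_apply] at this
      exact mul_ne_zero ht0 this.ne' h1
    · rw [codisjoint_iff, eq_top_iff]
      intro X _
      have hnd : (-killingForm ℝ K : LinearMap.BilinForm ℝ K).Nondegenerate := by
        refine (LinearMap.IsRefl.nondegenerate_iff_separatingLeft
          (B := (-killingForm ℝ K : LinearMap.BilinForm ℝ K)) ?_).2 ?_
        · intro X Y h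
          rw [hKS.1, h]
        · intro X h
          by_contra hX
          exact (hKS.2 X hX).ne' (h X)
      let f : K →ₗ[ℝ] ℝ := t⁻¹ • (Q X ∘ₗ (inc : K →ₗ[ℝ] L))
      let W := (LinearMap.BilinForm.toDual (-killingForm ℝ K) hnd).symm f
      have hW : ∀ Z, -killingForm ℝ K Z W = f Z := fun Z => by
        have := LinearMap.BilinForm.apply_toDual_symm_apply (hB := hnd) f Z
        rw [← this]
        exact hKS.1 Z W
      refine Submodule.mem_sup.2 ⟨X - inc W, (hp _).2 fun Z => ?_, inc W, ⟨W, rfl⟩,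
        sub_add_cancel _ _⟩
      rw [map_sub, hinc2, hW, hQ]
      simp only [f, LinearMap.smul_apply, LinearMap.comp_apply, LieHom.coe_toLinearMap,
        smul_eq_mul]
      field_simp
      ring
  refine .of_lieInvariant hcompl hQL ⟨fun X Y => ?_, fun X hX => ?_⟩ hB (fun Z X hX => ?_)
    (Or.inr fun Z X hX => (hp X).1 hX Z)
  · rw [hB, hB, hQ]
  · rw [hB]
    exact hpos X X.2 fun h => hX (Subtype.ext h)
  · rw [hp]
    intro Z'
    have h1 := hQL (inc Z) (inc Z') X
    rw [← LieHom.map_lie, (hp X).1 hX] at h1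
    linarith

/-- The classification of naturally reductive pairs, on the level of Lie algebras. -/
theorem isInfinitesimallyNaturallyReductive_iff (hS : IsInnerProduct S)
    (hSL : S.lieInvariant L) (hK : LieAlgebra.IsSimple ℝ K) (hinc : Function.Injective inc)
    (hc : D.IsNormalization (inc : K →ₗ[ℝ] L) c)
    (hker : ∀ Q : LinearMap.BilinForm ℝ L, Q.lieInvariant L →
      LinearMap.ker Q ≠ LinearMap.range (inc : K →ₗ[ℝ] L)) :
    IsInfinitesimallyNaturallyReductive inc p B ↔
      D.IsIdealPair (inc : K →ₗ[ℝ] L) p B ∨ D.IsFormPair (inc : K →ₗ[ℝ] L) c p B := by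
  refine ⟨fun h => ?_, fun h => h.elim
    (D.isInfinitesimallyNaturallyReductive_of_isIdealPair hS hSL hc)
    (D.isInfinitesimallyNaturallyReductive_of_isFormPair hS hSL hK hinc hc)⟩
  rcases h.isIdeal_or_exists_lieInvariant hinc hK with hp | ⟨Q, hQ, hQL, hQp, hQB⟩
  · exact Or.inl (D.isIdealPair_of_isIdeal hK hinc h hp)
  · exact Or.inr (D.isFormPair_of_lieInvariant hS hSL hK hinc hc hker h hQ hQL hQp hQB)

end SimpleIdealDecomposition

theorem mlieBracket_eq_lieBracket {E : Type*} [NormedAddCommGroup E] [NormedSpace ℝ E]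
    (V W : ∀ x : E, TangentSpace 𝓘(ℝ, E) x) (y : E) :
    VectorField.mlieBracket 𝓘(ℝ, E) V W y = VectorField.lieBracket ℝ V W y := by
  rw [← VectorField.mlieBracketWithin_univ, VectorField.mlieBracketWithin_eq_lieBracketWithin]
  exact congrFun VectorField.lieBracketWithin_univ y

/-! ### The multiplication of a Lie group in the chart at the identity -/

section ChartMul

variable (E : Type*) [NormedAddCommGroup E] [NormedSpace ℝ E]
  (G : Type*) [TopologicalSpace G] [ChartedSpace E G] [Group G]

/-- The chart of a Lie group at the identity. -/
noncomputable abbrev unitChart : PartialEquiv G E := extChartAt 𝓘(ℝ, E) (1 : G)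

/-- The multiplication in the chart at the identity. -/
noncomputable def chartMul (z : E × E) : E :=
  unitChart E G ((unitChart E G).symm z.1 * (unitChart E G).symm z.2)

/-- The derivative of the left translations at the identity, in the chart at the identity. -/
noncomputable def chartLeft (y : E) : E →L[ℝ] E :=
  fderiv ℝ (chartMul E G) (y, unitChart E G 1) ∘L ContinuousLinearMap.inr ℝ E E

/-- The derivative of the right translations at the identity, in the chart at the identity. -/
noncomputable def chartRight (y : E) : E →L[ℝ] E :=
  fderiv ℝ (chartMul E G) (unitChart E G 1, y) ∘L ContinuousLinearMap.inl ℝ E E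

variable {E G}

theorem unitChart_one_mem_target : unitChart E G 1 ∈ (unitChart E G).target :=
  mem_extChartAt_target _

theorem unitChart_symm_one : (unitChart E G).symm (unitChart E G 1) = 1 :=
  extChartAt_to_inv _

theorem unitChart_symm_mem_source {y : E} (hy : y ∈ (unitChart E G).target) :
    (unitChart E G).symm y ∈ (unitChart E G).source :=
  (unitChart E G).map_target hy

theorem unitChart_target_mem_nhds {y : E} (hy : y ∈ (unitChart E G).target) :
    (unitChart E G).target ∈ nhds y :=
  (isOpen_extChartAt_target (1 : G)).mem_nhds hy

theorem chartMul_left_one {y : E} (hy : y ∈ (unitChart E G).target) :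
    chartMul E G (unitChart E G 1, y) = y := by
  rw [chartMul, unitChart_symm_one, one_mul, (unitChart E G).right_inv hy]

theorem chartMul_right_one {y : E} (hy : y ∈ (unitChart E G).target) :
    chartMul E G (y, unitChart E G 1) = y := by
  rw [chartMul, unitChart_symm_one, mul_one, (unitChart E G).right_inv hy]

variable [LieGroup 𝓘(ℝ, E) ∞ G]

theorem contMDiffAt_unitChart_symm {y : E} (hy : y ∈ (unitChart E G).target) :
    ContMDiffAt 𝓘(ℝ, E) 𝓘(ℝ, E) ∞ (unitChart E G).symm y :=
  (contMDiffOn_extChartAt_symm (n := ∞) (1 : G)).contMDiffAt (unitChart_target_mem_nhds hy)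

theorem contMDiffAt_unitChart {g : G} (hg : g ∈ (unitChart E G).source) :
    ContMDiffAt 𝓘(ℝ, E) 𝓘(ℝ, E) ∞ (unitChart E G) g :=
  contMDiffAt_extChartAt' (by simpa using hg)

theorem contDiffAt_chartMul {x y : E} (hx : x ∈ (unitChart E G).target)
    (hy : y ∈ (unitChart E G).target)
    (hxy : (unitChart E G).symm x * (unitChart E G).symm y ∈ (unitChart E G).source) :
    ContDiffAt ℝ ∞ (chartMul E G) (x, y) := by
  rw [← contMDiffAt_iff_contDiffAt]
  have h1 : ContMDiffAt 𝓘(ℝ, E × E) 𝓘(ℝ, E) ∞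
      (fun z : E × E => (unitChart E G).symm z.1) (x, y) :=
    ContMDiffAt.comp (x, y) (contMDiffAt_unitChart_symm hx) contDiff_fst.contMDiff.contMDiffAt
  have h2 : ContMDiffAt 𝓘(ℝ, E × E) 𝓘(ℝ, E) ∞
      (fun z : E × E => (unitChart E G).symm z.2) (x, y) :=
    ContMDiffAt.comp (x, y) (contMDiffAt_unitChart_symm hy) contDiff_snd.contMDiff.contMDiffAt
  exact ContMDiffAt.comp (x, y) (contMDiffAt_unitChart hxy) (h1.mul h2)

theorem contDiffAt_chartMul_right {y : E} (hy : y ∈ (unitChart E G).target) :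
    ContDiffAt ℝ ∞ (chartMul E G) (y, unitChart E G 1) :=
  contDiffAt_chartMul hy unitChart_one_mem_target (by
    rw [unitChart_symm_one, mul_one]
    exact unitChart_symm_mem_source hy)

theorem contDiffAt_chartMul_left {y : E} (hy : y ∈ (unitChart E G).target) :
    ContDiffAt ℝ ∞ (chartMul E G) (unitChart E G 1, y) :=
  contDiffAt_chartMul unitChart_one_mem_target hy (by
    rw [unitChart_symm_one, one_mul]
    exact unitChart_symm_mem_source hy)

theorem contDiffAt_chartLeft {y : E} (hy : y ∈ (unitChart E G).target) :
    ContDiffAt ℝ ∞ (chartLeft E G) y := by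
  have h1 : ContDiffAt ℝ ∞ (fderiv ℝ (chartMul E G)) (y, unitChart E G 1) :=
    (contDiffAt_chartMul_right hy).fderiv_right (by simp)
  exact (h1.comp y (contDiffAt_id.prodMk contDiffAt_const)).clm_comp contDiffAt_const

theorem contDiffAt_chartRight {y : E} (hy : y ∈ (unitChart E G).target) :
    ContDiffAt ℝ ∞ (chartRight E G) y := by
  have h1 : ContDiffAt ℝ ∞ (fderiv ℝ (chartMul E G)) (unitChart E G 1, y) :=
    (contDiffAt_chartMul_left hy).fderiv_right (by simp)
  exact (h1.comp y (contDiffAt_const.prodMk contDiffAt_id)).clm_comp contDiffAt_const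

theorem hasFDerivAt_chartMul_right {y : E} (hy : y ∈ (unitChart E G).target) :
    HasFDerivAt (fun x => chartMul E G (y, x)) (chartLeft E G y) (unitChart E G 1) :=
  ((contDiffAt_chartMul_right hy).differentiableAt (by simp)).hasFDerivAt.comp _
    (hasFDerivAt_prodMk_right y (unitChart E G 1))

theorem hasFDerivAt_chartMul_left {y : E} (hy : y ∈ (unitChart E G).target) :
    HasFDerivAt (fun x => chartMul E G (x, y)) (chartRight E G y) (unitChart E G 1) :=
  HasFDerivAt.comp (f := fun x => (x, y)) _
    ((contDiffAt_chartMul_left hy).differentiableAt (by simp)).hasFDerivAt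
    (hasFDerivAt_prodMk_left (unitChart E G 1) y)

theorem chartLeft_one : chartLeft E G (unitChart E G 1) = ContinuousLinearMap.id ℝ E := by
  refine (hasFDerivAt_chartMul_right unitChart_one_mem_target).unique
    ((hasFDerivAt_id _).congr_of_eventuallyEq ?_)
  filter_upwards [unitChart_target_mem_nhds unitChart_one_mem_target] with x hx
  exact chartMul_left_one hx

theorem chartRight_one : chartRight E G (unitChart E G 1) = ContinuousLinearMap.id ℝ E := by
  refine (hasFDerivAt_chartMul_left unitChart_one_mem_target).unique
    ((hasFDerivAt_id _).congr_of_eventuallyEq ?_)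
  filter_upwards [unitChart_target_mem_nhds unitChart_one_mem_target] with x hx
  exact chartMul_right_one hx

theorem hasMFDerivAt_unitChart :
    HasMFDerivAt 𝓘(ℝ, E) 𝓘(ℝ, E) (unitChart E G) (1 : G) (ContinuousLinearMap.id ℝ E) := by
  have := (mdifferentiableAt_extChartAt (I := 𝓘(ℝ, E)) (x := (1 : G)) (y := 1)
    (mem_chart_source E _)).hasMFDerivAt
  rwa [mfderiv_extChartAt_self] at this

theorem hasMFDerivAt_unitChart_symm {y : E} (hy : y ∈ (unitChart E G).target) :
    HasMFDerivAt 𝓘(ℝ, E) 𝓘(ℝ, E) (unitChart E G).symm y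
      (mfderiv 𝓘(ℝ, E) 𝓘(ℝ, E) (unitChart E G).symm y) :=
  ((contMDiffAt_unitChart_symm hy).mdifferentiableAt (by simp)).hasMFDerivAt

/-- A map which is given in the chart at the identity. -/
theorem mfderiv_eq_of_chart {f : G → G} {k : E → E} {k' : E →L[ℝ] E} {y : E}
    (hy : y ∈ (unitChart E G).target) (hk : HasFDerivAt k k' (unitChart E G 1))
    (hk1 : k (unitChart E G 1) = y)
    (hf : ∀ᶠ x in nhds (1 : G), f x = (unitChart E G).symm (k (unitChart E G x))) :
    (mfderiv 𝓘(ℝ, E) 𝓘(ℝ, E) f 1 : E →L[ℝ] E) =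
      (mfderiv 𝓘(ℝ, E) 𝓘(ℝ, E) (unitChart E G).symm y : E →L[ℝ] E) ∘L k' := by
  have h2 : HasMFDerivAt 𝓘(ℝ, E) 𝓘(ℝ, E) k (unitChart E G 1) k' := hk.hasMFDerivAt
  have h3 := hasMFDerivAt_unitChart_symm hy
  subst hk1
  have h4 := HasMFDerivAt.comp (1 : G) h3 (HasMFDerivAt.comp (1 : G) h2 hasMFDerivAt_unitChart)
  exact (h4.congr_of_eventuallyEq hf).mfderiv

theorem mfderiv_mul_left_chart {y : E} (hy : y ∈ (unitChart E G).target) :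
    (mfderiv 𝓘(ℝ, E) 𝓘(ℝ, E) (fun x => (unitChart E G).symm y * x) 1 : E →L[ℝ] E) =
      (mfderiv 𝓘(ℝ, E) 𝓘(ℝ, E) (unitChart E G).symm y : E →L[ℝ] E) ∘L chartLeft E G y := by
  refine mfderiv_eq_of_chart hy (hasFDerivAt_chartMul_right hy) (chartMul_right_one hy) ?_
  have hc : ContinuousAt (fun x : G => (unitChart E G).symm y * x) 1 :=
    (contMDiff_mul_left (I := 𝓘(ℝ, E)) (n := ∞)).continuous.continuousAt
  have h1 : ∀ᶠ x in nhds (1 : G), (unitChart E G).symm y * x ∈ (unitChart E G).source := by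
    refine hc.eventually_mem ((isOpen_extChartAt_source (1 : G)).mem_nhds ?_)
    rw [mul_one]
    exact unitChart_symm_mem_source hy
  filter_upwards [h1, extChartAt_source_mem_nhds (I := 𝓘(ℝ, E)) (1 : G)] with x hx hx'
  simp only [chartMul]
  rw [(unitChart E G).left_inv hx', (unitChart E G).left_inv hx]

theorem mfderiv_mul_right_chart {y : E} (hy : y ∈ (unitChart E G).target) :
    (mfderiv 𝓘(ℝ, E) 𝓘(ℝ, E) (fun x => x * (unitChart E G).symm y) 1 : E →L[ℝ] E) =
      (mfderiv 𝓘(ℝ, E) 𝓘(ℝ, E) (unitChart E G).symm y : E →L[ℝ] E) ∘L chartRight E G y := by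
  refine mfderiv_eq_of_chart hy (hasFDerivAt_chartMul_left hy) (chartMul_left_one hy) ?_
  have hc : ContinuousAt (fun x : G => x * (unitChart E G).symm y) 1 :=
    (contMDiff_mul_right (I := 𝓘(ℝ, E)) (n := ∞)).continuous.continuousAt
  have h1 : ∀ᶠ x in nhds (1 : G), x * (unitChart E G).symm y ∈ (unitChart E G).source := by
    refine hc.eventually_mem ((isOpen_extChartAt_source (1 : G)).mem_nhds ?_)
    rw [one_mul]
    exact unitChart_symm_mem_source hy
  filter_upwards [h1, extChartAt_source_mem_nhds (I := 𝓘(ℝ, E)) (1 : G)] with x hx hx'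
  simp only [chartMul]
  rw [(unitChart E G).left_inv hx', (unitChart E G).left_inv hx]

theorem isInvertible_mfderiv_unitChart_symm {y : E} (hy : y ∈ (unitChart E G).target) :
    (mfderiv 𝓘(ℝ, E) 𝓘(ℝ, E) (unitChart E G).symm y : E →L[ℝ] E).IsInvertible := by
  have := isInvertible_mfderivWithin_extChartAt_symm (I := 𝓘(ℝ, E)) (x := (1 : G)) hy
  simpa [mfderivWithin_univ] using! this

theorem mpullback_mulInvariantVectorField_chart {y : E} (hy : y ∈ (unitChart E G).target)
    (v : GroupLieAlgebra 𝓘(ℝ, E) G) :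
    VectorField.mpullback 𝓘(ℝ, E) 𝓘(ℝ, E) (unitChart E G).symm (mulInvariantVectorField v) y =
      chartLeft E G y v := by
  rw [VectorField.mpullback_apply]
  have h1 := DFunLike.congr_fun (mfderiv_mul_left_chart hy) v
  have h2 := (isInvertible_mfderiv_unitChart_symm hy)
  have h3 : mulInvariantVectorField v ((unitChart E G).symm y) =
      (mfderiv 𝓘(ℝ, E) 𝓘(ℝ, E) (unitChart E G).symm y : E →L[ℝ] E) (chartLeft E G y v) := h1
  rw [h3]
  exact ContinuousLinearMap.IsInvertible.inverse_apply_eq h2 |>.2 rfl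

variable [CompleteSpace E]

/-- The Maurer–Cartan equation, in the chart at the identity. -/
theorem chartLeft_lie {y : E} (hy : y ∈ (unitChart E G).target)
    (v w : GroupLieAlgebra 𝓘(ℝ, E) G) :
    chartLeft E G y (⁅v, w⁆ : GroupLieAlgebra 𝓘(ℝ, E) G) =
      fderiv ℝ (chartLeft E G) y (chartLeft E G y v) w -
        fderiv ℝ (chartLeft E G) y (chartLeft E G y w) v := by
  have h1 : VectorField.mpullback 𝓘(ℝ, E) 𝓘(ℝ, E) (unitChart E G).symm
      (VectorField.mlieBracket 𝓘(ℝ, E) (mulInvariantVectorField v) (mulInvariantVectorField w)) y =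
      VectorField.mlieBracket 𝓘(ℝ, E)
        (VectorField.mpullback 𝓘(ℝ, E) 𝓘(ℝ, E) (unitChart E G).symm (mulInvariantVectorField v))
        (VectorField.mpullback 𝓘(ℝ, E) 𝓘(ℝ, E) (unitChart E G).symm (mulInvariantVectorField w)) y :=
    VectorField.mpullback_mlieBracket (n := ∞) (mdifferentiableAt_mulInvariantVectorField v)
      (mdifferentiableAt_mulInvariantVectorField w) (contMDiffAt_unitChart_symm hy) (by
        rw [minSmoothness_of_isRCLikeNormedField]
        exact ENat.LEInfty.out)
  rw [← mulInvariantVector_mlieBracket, mpullback_mulInvariantVectorField_chart hy] at h1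
  have hev : ∀ u : GroupLieAlgebra 𝓘(ℝ, E) G, VectorField.mpullback 𝓘(ℝ, E) 𝓘(ℝ, E)
      (unitChart E G).symm (mulInvariantVectorField u) =ᶠ[nhds y] fun z => chartLeft E G z u :=
    fun u => by
      filter_upwards [unitChart_target_mem_nhds hy] with z hz
      exact mpullback_mulInvariantVectorField_chart hz u
  rw [(hev v).mlieBracket_vectorField_eq (hev w)] at h1
  have hd : ∀ u : E, fderiv ℝ (fun z => chartLeft E G z u) y =
      (fderiv ℝ (chartLeft E G) y).flip u := fun u => by
    have := ((contDiffAt_chartLeft hy).differentiableAt (by simp)).hasFDerivAt.clm_apply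
      (hasFDerivAt_const u y)
    rw [this.fderiv]
    ext
    simp
  have h2 : ∀ a b : E, VectorField.lieBracket ℝ (fun z => chartLeft E G z a)
      (fun z => chartLeft E G z b) y = fderiv ℝ (chartLeft E G) y (chartLeft E G y a) b -
        fderiv ℝ (chartLeft E G) y (chartLeft E G y b) a := fun a b => by
    rw [VectorField.lieBracket, hd, hd]
    rfl
  exact h1.trans ((mlieBracket_eq_lieBracket _ _ y).trans (h2 v w))

end ChartMul

/-! ### The adjoint representation -/

section LieAd

variable {E : Type*} [NormedAddCommGroup E] [NormedSpace ℝ E]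
  {G : Type*} [TopologicalSpace G] [ChartedSpace E G] [Group G] [LieGroup 𝓘(ℝ, E) ∞ G]

theorem contMDiff_conj (a : G) :
    ContMDiff 𝓘(ℝ, E) 𝓘(ℝ, E) ∞ (fun x : G => a * x * a⁻¹) :=
  (contMDiff_const.mul contMDiff_id).mul contMDiff_const

variable (E) in
/-- The adjoint representation, as a continuous linear map of the model space. -/
noncomputable def lieAdCLM (a : G) : E →L[ℝ] E :=
  mfderiv 𝓘(ℝ, E) 𝓘(ℝ, E) (fun x : G => a * x * a⁻¹) 1

theorem lieAd_mul (a b : G) (v : GroupLieAlgebra 𝓘(ℝ, E) G) :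
    lieAd E (a * b) v = lieAd E a (lieAd E b v) := by
  have h1 : (fun x : G => a * b * x * (a * b)⁻¹) =
      (fun x : G => a * x * a⁻¹) ∘ fun x : G => b * x * b⁻¹ := by
    ext x
    simp [mul_assoc]
  have h2 := mfderiv_comp (I := 𝓘(ℝ, E)) (I' := 𝓘(ℝ, E)) (I'' := 𝓘(ℝ, E)) (1 : G)
    ((contMDiff_conj (E := E) a).mdifferentiable (by simp) (b * 1 * b⁻¹))
    ((contMDiff_conj (E := E) b).mdifferentiable (by simp) 1)
  have h3 := mfderiv_congr_point (I := 𝓘(ℝ, E)) (I' := 𝓘(ℝ, E)) (f := fun x : G => a * x * a⁻¹)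
    (show b * 1 * b⁻¹ = 1 by simp)
  rw [← h1] at h2
  have h4 := DFunLike.congr_fun h2 v
  exact h4.trans (DFunLike.congr_fun h3 _)

theorem lieAd_one (v : GroupLieAlgebra 𝓘(ℝ, E) G) : lieAd E (1 : G) v = v := by
  have h1 : (fun x : G => 1 * x * 1⁻¹) = id := by
    ext x
    simp
  have h2 : mfderiv 𝓘(ℝ, E) 𝓘(ℝ, E) (fun x : G => 1 * x * 1⁻¹) 1 =
      mfderiv 𝓘(ℝ, E) 𝓘(ℝ, E) id (1 : G) := by rw [h1]
  exact DFunLike.congr_fun (h2.trans mfderiv_id) v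

theorem lieAd_lieAd_inv (a : G) (v : GroupLieAlgebra 𝓘(ℝ, E) G) :
    lieAd E a (lieAd E a⁻¹ v) = v := by
  rw [← lieAd_mul, mul_inv_cancel, lieAd_one]

theorem mfderiv_mul_left_eq_mul_right_lieAd (a : G) (v : GroupLieAlgebra 𝓘(ℝ, E) G) :
    (mfderiv 𝓘(ℝ, E) 𝓘(ℝ, E) (fun x : G => x * a) 1 : E →L[ℝ] E) (lieAd E a v) =
      (mfderiv 𝓘(ℝ, E) 𝓘(ℝ, E) (fun x : G => a * x) 1 : E →L[ℝ] E) v := by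
  have h1 : (fun x : G => a * x) = (fun x : G => x * a) ∘ fun x : G => a * x * a⁻¹ := by
    ext x
    simp
  have h2 := mfderiv_comp (I := 𝓘(ℝ, E)) (I' := 𝓘(ℝ, E)) (I'' := 𝓘(ℝ, E)) (1 : G)
    ((contMDiff_mul_right (I := 𝓘(ℝ, E)) (n := ∞) (a := a)).mdifferentiable (by simp)
      (a * 1 * a⁻¹))
    ((contMDiff_conj (E := E) a).mdifferentiable (by simp) 1)
  have h3 := mfderiv_congr_point (I := 𝓘(ℝ, E)) (I' := 𝓘(ℝ, E)) (f := fun x : G => x * a)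
    (show a * 1 * a⁻¹ = 1 by simp)
  rw [← h1] at h2
  exact ((DFunLike.congr_fun h2 v).trans (DFunLike.congr_fun h3 _)).symm

theorem chartRight_lieAd {y : E} (hy : y ∈ (unitChart E G).target)
    (v : GroupLieAlgebra 𝓘(ℝ, E) G) :
    chartRight E G y (lieAdCLM E ((unitChart E G).symm y) v) = chartLeft E G y v := by
  have h := mfderiv_mul_left_eq_mul_right_lieAd ((unitChart E G).symm y) v
  have h1 := DFunLike.congr_fun (mfderiv_mul_right_chart (G := G) hy)
    (lieAd E ((unitChart E G).symm y) v)
  have h2 := DFunLike.congr_fun (mfderiv_mul_left_chart (G := G) hy) v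
  have h3 := (h1.symm.trans h).trans h2
  obtain ⟨e, he⟩ := isInvertible_mfderiv_unitChart_symm (G := G) hy
  rw [← he] at h3
  exact e.injective h3

theorem fderiv_chartLeft_one (u v : E) :
    fderiv ℝ (chartLeft E G) (unitChart E G 1) u v =
      fderiv ℝ (fderiv ℝ (chartMul E G)) (unitChart E G 1, unitChart E G 1) (u, 0) (0, v) := by
  have h1 : ContDiffAt ℝ ∞ (fderiv ℝ (chartMul E G)) (unitChart E G 1, unitChart E G 1) :=
    (contDiffAt_chartMul_right unitChart_one_mem_target).fderiv_right (by simp)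
  have h2 := (HasFDerivAt.comp (f := fun y => (y, unitChart E G 1)) _
    (h1.differentiableAt (by simp)).hasFDerivAt
    (hasFDerivAt_prodMk_left (𝕜 := ℝ) (unitChart E G 1) (unitChart E G 1))).clm_comp
    (hasFDerivAt_const (ContinuousLinearMap.inr ℝ E E) _)
  have h3 : HasFDerivAt (chartLeft E G) _ _ := h2
  rw [h3.fderiv]
  simp

theorem fderiv_chartRight_one (u v : E) :
    fderiv ℝ (chartRight E G) (unitChart E G 1) u v =
      fderiv ℝ (fderiv ℝ (chartMul E G)) (unitChart E G 1, unitChart E G 1) (0, u) (v, 0) := by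
  have h1 : ContDiffAt ℝ ∞ (fderiv ℝ (chartMul E G)) (unitChart E G 1, unitChart E G 1) :=
    (contDiffAt_chartMul_right unitChart_one_mem_target).fderiv_right (by simp)
  have h2 := (HasFDerivAt.comp (f := fun y => (unitChart E G 1, y)) _
    (h1.differentiableAt (by simp)).hasFDerivAt
    (hasFDerivAt_prodMk_right (𝕜 := ℝ) (unitChart E G 1) (unitChart E G 1))).clm_comp
    (hasFDerivAt_const (ContinuousLinearMap.inl ℝ E E) _)
  have h3 : HasFDerivAt (chartRight E G) _ _ := h2
  rw [h3.fderiv]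
  simp

theorem fderiv_chartRight_one_eq (u v : E) :
    fderiv ℝ (chartRight E G) (unitChart E G 1) u v =
      fderiv ℝ (chartLeft E G) (unitChart E G 1) v u := by
  rw [fderiv_chartRight_one, fderiv_chartLeft_one]
  refine ((contDiffAt_chartMul_right unitChart_one_mem_target).isSymmSndFDerivAt ?_).eq _ _
  rw [minSmoothness_of_isRCLikeNormedField]
  exact ENat.LEInfty.out

variable [CompleteSpace E]

theorem lie_eq_fderiv_sub (u v : GroupLieAlgebra 𝓘(ℝ, E) G) :
    (⁅u, v⁆ : GroupLieAlgebra 𝓘(ℝ, E) G) =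
      (fderiv ℝ (chartLeft E G) (unitChart E G 1) u v -
        fderiv ℝ (chartRight E G) (unitChart E G 1) u v : E) := by
  have h := chartLeft_lie (G := G) unitChart_one_mem_target u v
  rw [chartLeft_one] at h
  have h2 := fderiv_chartRight_one_eq (E := E) (G := G) u v
  exact h.trans (congrArg (fderiv ℝ (chartLeft E G) (unitChart E G 1) u v - ·) h2.symm)

theorem hasFDerivAt_inverse_chartRight_chartLeft (v : E) :
    HasFDerivAt (fun y => Ring.inverse (chartRight E G y) (chartLeft E G y v))
      ((fderiv ℝ (chartLeft E G) (unitChart E G 1)).flip v -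
        (fderiv ℝ (chartRight E G) (unitChart E G 1)).flip v) (unitChart E G 1) := by
  set e := unitChart E G 1 with he
  have het : e ∈ (unitChart E G).target := unitChart_one_mem_target
  have hR : HasFDerivAt (chartRight E G) (fderiv ℝ (chartRight E G) e) e :=
    ((contDiffAt_chartRight het).differentiableAt (by simp)).hasFDerivAt
  have hA : HasFDerivAt (chartLeft E G) (fderiv ℝ (chartLeft E G) e) e :=
    ((contDiffAt_chartLeft het).differentiableAt (by simp)).hasFDerivAt
  have hR1 : chartRight E G e = ((1 : (E →L[ℝ] E)ˣ) : E →L[ℝ] E) := chartRight_one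
  have hinv : HasFDerivAt (fun y => Ring.inverse (chartRight E G y))
      (-fderiv ℝ (chartRight E G) e) e := by
    have h1 := hasFDerivAt_ringInverse (𝕜 := ℝ) (1 : (E →L[ℝ] E)ˣ)
    rw [← hR1] at h1
    have h2 := h1.comp e hR
    refine h2.congr_fderiv ?_
    ext u w
    simp
  have hF := hinv.clm_apply (hA.clm_apply (hasFDerivAt_const v e))
  have h1 : chartLeft E G e v = v := by rw [he, chartLeft_one]; rfl
  have h2 : Ring.inverse (chartRight E G e) = ContinuousLinearMap.id ℝ E := by
    rw [hR1, Ring.inverse_unit]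
    rfl
  refine hF.congr_fderiv ?_
  rw [h1, h2]
  ext u
  simp [sub_eq_add_neg]

/-- The derivative of the adjoint representation is the Lie bracket. -/
theorem exists_hasMFDerivAt_lieAd (v : GroupLieAlgebra 𝓘(ℝ, E) G) :
    ∃ A : E →L[ℝ] E, (∀ u : GroupLieAlgebra 𝓘(ℝ, E) G, A u = ⁅u, v⁆) ∧
      HasMFDerivAt 𝓘(ℝ, E) 𝓘(ℝ, E) (fun a : G => lieAdCLM E a v) 1 A := by
  set e := unitChart E G 1 with he
  have het : e ∈ (unitChart E G).target := unitChart_one_mem_target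
  have hR : HasFDerivAt (chartRight E G) (fderiv ℝ (chartRight E G) e) e :=
    ((contDiffAt_chartRight het).differentiableAt (by simp)).hasFDerivAt
  have hR1 : chartRight E G e = ((1 : (E →L[ℝ] E)ˣ) : E →L[ℝ] E) := chartRight_one
  have hunit : ∀ᶠ y in nhds e, IsUnit (chartRight E G y) :=
    hR.continuousAt.eventually_mem (Units.isOpen.mem_nhds (by rw [hR1]; exact Units.isUnit _))
  have hev : ∀ᶠ y in nhds e, lieAdCLM E ((unitChart E G).symm y) v =
      Ring.inverse (chartRight E G y) (chartLeft E G y v) := by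
    filter_upwards [hunit, unitChart_target_mem_nhds het] with y hy hyt
    rw [← chartRight_lieAd hyt]
    have h1 := Ring.inverse_mul_cancel _ hy
    exact (DFunLike.congr_fun h1 _).symm
  have hF2 := hasFDerivAt_inverse_chartRight_chartLeft (E := E) (G := G) v
  refine ⟨((fderiv ℝ (chartLeft E G) e).flip v - (fderiv ℝ (chartRight E G) e).flip v : E →L[ℝ] E),
    fun u => (lie_eq_fderiv_sub u v).symm, ?_⟩
  refine (HasMFDerivAt.comp (1 : G) hF2.hasMFDerivAt
    hasMFDerivAt_unitChart).congr_of_eventuallyEq ?_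
  have h3 : ∀ᶠ x in nhds (1 : G), lieAdCLM E ((unitChart E G).symm (unitChart E G x)) v =
      Ring.inverse (chartRight E G (unitChart E G x)) (chartLeft E G (unitChart E G x) v) :=
    (continuousAt_extChartAt (I := 𝓘(ℝ, E)) (1 : G)).eventually hev
  filter_upwards [h3, extChartAt_source_mem_nhds (I := 𝓘(ℝ, E)) (1 : G)] with x hx hxs
  rw [(unitChart E G).left_inv hxs] at hx
  exact hx

end LieAd

/-! ### The Lie algebra of a Lie subgroup -/

section LieSubgroup

variable {E : Type*} [NormedAddCommGroup E] [NormedSpace ℝ E]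
  {EH : Type*} [NormedAddCommGroup EH] [NormedSpace ℝ EH]
  {G : Type*} [TopologicalSpace G] [ChartedSpace E G] [Group G] [LieGroup 𝓘(ℝ, E) ∞ G]
  {H : Subgroup G} [ChartedSpace EH H] [LieGroup 𝓘(ℝ, EH) ∞ H]

theorem lieInclusion_injective (hsub : IsLieSubgroup E EH H) :
    Function.Injective (lieInclusion E EH H) :=
  hsub.immersion 1

theorem lieInclusion_lieAd (hsub : IsLieSubgroup E EH H) (a : H)
    (v : GroupLieAlgebra 𝓘(ℝ, EH) H) :
    lieInclusion E EH H (lieAd EH a v) = lieAd E (a : G) (lieInclusion E EH H v) := by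
  have h1 := mfderiv_comp (I := 𝓘(ℝ, EH)) (I' := 𝓘(ℝ, EH)) (I'' := 𝓘(ℝ, E)) (1 : H)
    (hsub.smooth.mdifferentiable (by simp) (a * 1 * a⁻¹))
    ((contMDiff_conj (E := EH) a).mdifferentiable (by simp) 1)
  have h2 := mfderiv_congr_point (I := 𝓘(ℝ, EH)) (I' := 𝓘(ℝ, E)) (f := fun x : H => (x : G))
    (show a * 1 * a⁻¹ = 1 by simp)
  have h3 := mfderiv_comp (I := 𝓘(ℝ, EH)) (I' := 𝓘(ℝ, E)) (I'' := 𝓘(ℝ, E)) (1 : H)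
    (g := fun x : G => (a : G) * x * (a : G)⁻¹)
    ((contMDiff_conj (E := E) (a : G)).mdifferentiable (by simp) ((1 : H) : G))
    (hsub.smooth.mdifferentiable (by simp) 1)
  have h4 : (fun x : H => (x : G)) ∘ (fun x : H => a * x * a⁻¹) =
      (fun x : G => (a : G) * x * (a : G)⁻¹) ∘ fun x : H => (x : G) := by
    ext x
    simp
  rw [h4] at h1
  have h5 := DFunLike.congr_fun (h1.symm.trans h3) v
  exact (DFunLike.congr_fun h2 _).symm.trans h5

variable [CompleteSpace E] [CompleteSpace EH]

theorem lieInclusion_lie (hsub : IsLieSubgroup E EH H) (v w : GroupLieAlgebra 𝓘(ℝ, EH) H) :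
    lieInclusion E EH H ⁅v, w⁆ = ⁅lieInclusion E EH H v, lieInclusion E EH H w⁆ := by
  obtain ⟨A, hA, hA'⟩ := exists_hasMFDerivAt_lieAd (E := EH) (G := H) w
  obtain ⟨B, hB, hB'⟩ := exists_hasMFDerivAt_lieAd (E := E) (G := G) (lieInclusion E EH H w)
  have hi : HasMFDerivAt 𝓘(ℝ, EH) 𝓘(ℝ, E) (fun x : H => (x : G)) 1
      (mfderiv 𝓘(ℝ, EH) 𝓘(ℝ, E) (fun x : H => (x : G)) 1) :=
    (hsub.smooth.mdifferentiable (by simp) 1).hasMFDerivAt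
  let i : EH →L[ℝ] E := mfderiv 𝓘(ℝ, EH) 𝓘(ℝ, E) (fun x : H => (x : G)) 1
  have h1 : HasMFDerivAt 𝓘(ℝ, EH) 𝓘(ℝ, E) (fun a : H => i (lieAdCLM EH a w)) 1 (i ∘L A) :=
    HasMFDerivAt.comp (1 : H) i.hasMFDerivAt hA'
  have h2 : HasMFDerivAt 𝓘(ℝ, EH) 𝓘(ℝ, E)
      (fun a : H => lieAdCLM E (a : G) (lieInclusion E EH H w)) 1 (B ∘L i) :=
    HasMFDerivAt.comp (1 : H) hB' hi
  have h3 : (fun a : H => i (lieAdCLM EH a w)) =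
      fun a : H => lieAdCLM E (a : G) (lieInclusion E EH H w) :=
    funext fun a => lieInclusion_lieAd hsub a w
  rw [h3] at h1
  have h4 := DFunLike.congr_fun (hasMFDerivAt_unique h1 h2) v
  exact ((congrArg i (hA v)).symm.trans h4).trans (hB _)

/-- The inclusion of the Lie algebra of a Lie subgroup, as a homomorphism of Lie algebras. -/
noncomputable def lieInclusionHom (hsub : IsLieSubgroup E EH H) :
    GroupLieAlgebra 𝓘(ℝ, EH) H →ₗ⁅ℝ⁆ GroupLieAlgebra 𝓘(ℝ, E) G :=
  { lieInclusion E EH H with map_lie' := fun {v w} => lieInclusion_lie hsub v w }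

theorem lieInclusionHom_apply (hsub : IsLieSubgroup E EH H) (v : GroupLieAlgebra 𝓘(ℝ, EH) H) :
    lieInclusionHom hsub v = lieInclusion E EH H v := rfl

end LieSubgroup

/-! ### Differentiation along a connected Lie group -/

section Derivation

variable {E : Type*} [NormedAddCommGroup E] [NormedSpace ℝ E]
  {F : Type*} [NormedAddCommGroup F] [NormedSpace ℝ F]
  {N : Type*} [TopologicalSpace N] [ChartedSpace F N] [IsManifold 𝓘(ℝ, F) ∞ N]

theorem eventually_eq_of_hasMFDerivAt_zero {M : Type*} [TopologicalSpace M] [ChartedSpace E M]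
    [IsManifold 𝓘(ℝ, E) ∞ M] {f : M → N} {a : M}
    (hf : ∀ᶠ x in nhds a, HasMFDerivAt 𝓘(ℝ, E) 𝓘(ℝ, F) f x 0) :
    ∀ᶠ x in nhds a, f x = f a := by
  set φ := extChartAt 𝓘(ℝ, E) a with hφ
  set ψ := extChartAt 𝓘(ℝ, F) (f a) with hψ
  have hta : φ a ∈ φ.target := mem_extChartAt_target _
  have hsymm : ∀ y ∈ φ.target, ContMDiffAt 𝓘(ℝ, E) 𝓘(ℝ, E) ∞ φ.symm y := fun y hy =>
    (contMDiffOn_extChartAt_symm (n := ∞) a).contMDiffAt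
      ((isOpen_extChartAt_target a).mem_nhds hy)
  have hfa : f (φ.symm (φ a)) = f a := by rw [hφ, extChartAt_to_inv]
  have hc : ContinuousAt (fun y => f (φ.symm y)) (φ a) :=
    ContinuousAt.comp (by rw [hφ, extChartAt_to_inv]; exact hf.self_of_nhds.continuousAt)
      (hsymm _ hta).continuousAt
  have hev : ∀ᶠ y in nhds (φ a), y ∈ φ.target ∧ f (φ.symm y) ∈ ψ.source ∧
      HasMFDerivAt 𝓘(ℝ, E) 𝓘(ℝ, F) f (φ.symm y) 0 := by
    have h1 : ∀ᶠ y in nhds (φ a), y ∈ φ.target := (isOpen_extChartAt_target a).mem_nhds hta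
    refine h1.and ((hc.eventually_mem ?_).and ?_)
    · rw [hfa]
      exact extChartAt_source_mem_nhds _
    · have h2 := (hsymm _ hta).continuousAt
      rw [ContinuousAt, hφ, extChartAt_to_inv] at h2
      exact h2.eventually hf
  obtain ⟨r, hr, hball⟩ := Metric.eventually_nhds_iff_ball.1 hev
  have hder : ∀ y ∈ Metric.ball (φ a) r,
      HasFDerivAt (fun z => ψ (f (φ.symm z))) (0 : E →L[ℝ] F) y := fun y hy => by
    obtain ⟨h1, h2, hfy⟩ := hball y hy
    have h3 := (hsymm y h1).mdifferentiableAt (by simp) |>.hasMFDerivAt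
    have h4 := (mdifferentiableAt_extChartAt (I := 𝓘(ℝ, F)) (x := f a) (y := f (φ.symm y))
      (by simpa [hψ] using h2)).hasMFDerivAt
    have h5 := HasMFDerivAt.comp y h4 (HasMFDerivAt.comp y hfy h3)
    refine hasMFDerivAt_iff_hasFDerivAt.1 (h5.congr_mfderiv ?_)
    rw [ContinuousLinearMap.zero_comp, ContinuousLinearMap.comp_zero]
    rfl
  have hconst : ∀ y ∈ Metric.ball (φ a) r, f (φ.symm y) = f a := fun y hy => by
    have h1 := (convex_ball (φ a) r).is_const_of_fderivWithin_eq_zero (𝕜 := ℝ)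
      (f := fun z => ψ (f (φ.symm z)))
      (fun z hz => (hder z hz).differentiableAt.differentiableWithinAt)
      (fun z hz => ((hder z hz).hasFDerivWithinAt).fderivWithin
        (Metric.isOpen_ball.uniqueDiffWithinAt hz)) hy (Metric.mem_ball_self hr)
    have h2 := ψ.injOn (hball y hy).2.1 (hball _ (Metric.mem_ball_self hr)).2.1 h1
    exact h2.trans hfa
  filter_upwards [extChartAt_source_mem_nhds (I := 𝓘(ℝ, E)) a,
    (continuousAt_extChartAt (I := 𝓘(ℝ, E)) a).eventually_mem (Metric.ball_mem_nhds _ hr)]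
    with x hx hx'
  have := hconst (φ x) hx'
  rwa [φ.left_inv hx] at this

/-- A map with zero derivative is locally constant. -/
theorem isLocallyConstant_of_hasMFDerivAt_zero {M : Type*} [TopologicalSpace M] [ChartedSpace E M]
    [IsManifold 𝓘(ℝ, E) ∞ M] {f : M → N}
    (hf : ∀ a, HasMFDerivAt 𝓘(ℝ, E) 𝓘(ℝ, F) f a 0) : IsLocallyConstant f :=
  (IsLocallyConstant.iff_eventually_eq f).2 fun _ =>
    eventually_eq_of_hasMFDerivAt_zero (Filter.Eventually.of_forall hf)

variable {G : Type*} [TopologicalSpace G] [ChartedSpace E G] [Group G] [LieGroup 𝓘(ℝ, E) ∞ G]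

/-- If all the right translates of a function have zero derivative at the identity, the function is
constant. -/
theorem eq_of_hasMFDerivAt_mul_right_zero [PreconnectedSpace G] {f : G → N}
    (hf : ∀ a, HasMFDerivAt 𝓘(ℝ, E) 𝓘(ℝ, F) (fun x => f (x * a)) 1 0) (a b : G) :
    f a = f b := by
  refine (isLocallyConstant_of_hasMFDerivAt_zero (E := E) (F := F) fun a => ?_).apply_eq_of_preconnectedSpace
    a b
  have h1 : HasMFDerivAt 𝓘(ℝ, E) 𝓘(ℝ, E) (fun x : G => x * a⁻¹) a
      (mfderiv 𝓘(ℝ, E) 𝓘(ℝ, E) (fun x : G => x * a⁻¹) a) :=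
    (contMDiff_mul_right (I := 𝓘(ℝ, E)) (n := ∞) (a := a⁻¹)).mdifferentiable (by simp) a
      |>.hasMFDerivAt
  have h2 := hf a
  rw [← mul_inv_cancel a] at h2
  have h3 := HasMFDerivAt.comp a h2 h1
  have h4 : (fun x => f (x * a)) ∘ (fun x => x * a⁻¹) = f := by
    ext x
    simp
  rw [h4] at h3
  exact h3.congr_mfderiv (ContinuousLinearMap.zero_comp _)

end Derivation

/-! ### Invariant forms on the Lie algebra of a Lie group -/

section InvariantForms

variable {E : Type*} [NormedAddCommGroup E] [NormedSpace ℝ E] [FiniteDimensional ℝ E]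
  {EH : Type*} [NormedAddCommGroup EH] [NormedSpace ℝ EH] [FiniteDimensional ℝ EH]
  {G : Type*} [TopologicalSpace G] [ChartedSpace E G] [Group G] [LieGroup 𝓘(ℝ, E) ∞ G]
  {H : Subgroup G} [ChartedSpace EH H] [LieGroup 𝓘(ℝ, EH) ∞ H]

theorem exists_hasMFDerivAt_form_lieAd
    (Q : LinearMap.BilinForm ℝ (GroupLieAlgebra 𝓘(ℝ, E) G))
    (X Y : GroupLieAlgebra 𝓘(ℝ, E) G) :
    ∃ A : E →L[ℝ] ℝ, (∀ u : GroupLieAlgebra 𝓘(ℝ, E) G, A u = Q X ⁅u, Y⁆ + Q ⁅u, X⁆ Y) ∧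
      HasMFDerivAt 𝓘(ℝ, E) 𝓘(ℝ, ℝ) (fun a : G => Q (lieAd E a X) (lieAd E a Y)) 1 A := by
  obtain ⟨A, hA, hA'⟩ := exists_hasMFDerivAt_lieAd (E := E) (G := G) X
  obtain ⟨B, hB, hB'⟩ := exists_hasMFDerivAt_lieAd (E := E) (G := G) Y
  let q : E →L[ℝ] E →L[ℝ] ℝ := LinearMap.toContinuousBilinearMap (E := E) (F := E) Q
  set φ := extChartAt 𝓘(ℝ, E) (1 : G) with hφ
  have hX : lieAdCLM E (φ.symm (φ (1 : G))) X = X := by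
    rw [hφ, extChartAt_to_inv]
    exact lieAd_one X
  have hY : lieAdCLM E (φ.symm (φ (1 : G))) Y = Y := by
    rw [hφ, extChartAt_to_inv]
    exact lieAd_one Y
  have h1 := q.isBoundedBilinearMap.hasFDerivAt
    (lieAdCLM E (φ.symm (φ (1 : G))) X, lieAdCLM E (φ.symm (φ (1 : G))) Y)
  have h2 := h1.comp_hasFDerivWithinAt (φ (1 : G)) (hA'.2.prodMk hB'.2)
  rw [hX, hY] at h2
  have hc : ContinuousAt (fun a : G => q (lieAdCLM E a X) (lieAdCLM E a Y)) 1 :=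
    q.continuous₂.continuousAt.comp (hA'.1.prodMk hB'.1)
  refine ⟨_, fun u => ?_, hc, h2⟩
  exact (congrArg₂ (· + ·) (congrArg (q X) (hB u)) (congrArg (fun z => q z Y) (hA u)))

theorem form_lieAd_lieAd [PreconnectedSpace G]
    {Q : LinearMap.BilinForm ℝ (GroupLieAlgebra 𝓘(ℝ, E) G)}
    (hQ : Q.lieInvariant (GroupLieAlgebra 𝓘(ℝ, E) G)) (a : G)
    (X Y : GroupLieAlgebra 𝓘(ℝ, E) G) : Q (lieAd E a X) (lieAd E a Y) = Q X Y := by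
  have h := eq_of_hasMFDerivAt_mul_right_zero (E := E) (F := ℝ)
    (f := fun a : G => Q (lieAd E a X) (lieAd E a Y)) (fun b => ?_) a 1
  · simpa only [lieAd_one] using h
  · obtain ⟨A, hA, hA'⟩ := exists_hasMFDerivAt_form_lieAd Q (lieAd E b X) (lieAd E b Y)
    have hm : (fun x : G => Q (lieAd E (x * b) X) (lieAd E (x * b) Y)) =
        fun x => Q (lieAd E x (lieAd E b X)) (lieAd E x (lieAd E b Y)) :=
      funext fun x => by rw [lieAd_mul, lieAd_mul]
    rw [hm]
    refine hA'.congr_mfderiv ?_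
    ext u
    refine (hA u).trans ?_
    rw [hQ u]
    exact add_neg_cancel _

theorem lieInvariant_of_lieAd {Q : LinearMap.BilinForm ℝ (GroupLieAlgebra 𝓘(ℝ, E) G)}
    (hQ : ∀ (a : G) X Y, Q (lieAd E a X) (lieAd E a Y) = Q X Y) :
    Q.lieInvariant (GroupLieAlgebra 𝓘(ℝ, E) G) := by
  intro u X Y
  obtain ⟨A, hA, hA'⟩ := exists_hasMFDerivAt_form_lieAd Q X Y
  rw [funext fun a : G => hQ a X Y] at hA'
  have h1 := hasMFDerivAt_unique hA' (hasMFDerivAt_const _ _)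
  have h2 := (hA u).symm.trans (DFunLike.congr_fun h1 u)
  have h3 : Q X ⁅u, Y⁆ + Q ⁅u, X⁆ Y = 0 := h2
  linarith

theorem lie_mem_of_lieAd_mem (hsub : IsLieSubgroup E EH H)
    {p : Submodule ℝ (GroupLieAlgebra 𝓘(ℝ, E) G)} (hp : ∀ a ∈ H, ∀ X ∈ p, lieAd E a X ∈ p)
    (Z : GroupLieAlgebra 𝓘(ℝ, EH) H) {X : GroupLieAlgebra 𝓘(ℝ, E) G} (hX : X ∈ p) :
    ⁅lieInclusion E EH H Z, X⁆ ∈ p := by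
  by_contra hn
  obtain ⟨f, hf, hfp⟩ := Submodule.exists_le_ker_of_notMem hn
  obtain ⟨A, hA, hA'⟩ := exists_hasMFDerivAt_lieAd (E := E) (G := G) X
  have hi : HasMFDerivAt 𝓘(ℝ, EH) 𝓘(ℝ, E) (fun x : H => (x : G)) 1
      (mfderiv 𝓘(ℝ, EH) 𝓘(ℝ, E) (fun x : H => (x : G)) 1) :=
    (hsub.smooth.mdifferentiable (by simp) 1).hasMFDerivAt
  let q : E →L[ℝ] ℝ := LinearMap.toContinuousLinearMap (E := E) f
  have h1 := HasMFDerivAt.comp (1 : H) q.hasMFDerivAt (HasMFDerivAt.comp (1 : H) hA' hi)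
  have h2 : (q ∘ (fun a : G => lieAdCLM E a X) ∘ fun x : H => (x : G)) = fun _ => (0 : ℝ) :=
    funext fun a => hfp (hp a a.2 X hX)
  rw [h2] at h1
  have h3 := DFunLike.congr_fun (hasMFDerivAt_unique h1 (hasMFDerivAt_const _ _)) Z
  exact hf ((congrArg q (hA _)).symm.trans h3)

theorem form_lie_of_lieAd (hsub : IsLieSubgroup E EH H)
    {Q : LinearMap.BilinForm ℝ (GroupLieAlgebra 𝓘(ℝ, E) G)} {X Y : GroupLieAlgebra 𝓘(ℝ, E) G}
    (hQ : ∀ a ∈ H, Q (lieAd E a X) (lieAd E a Y) = Q X Y) (Z : GroupLieAlgebra 𝓘(ℝ, EH) H) :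
    Q ⁅lieInclusion E EH H Z, X⁆ Y + Q X ⁅lieInclusion E EH H Z, Y⁆ = 0 := by
  obtain ⟨A, hA, hA'⟩ := exists_hasMFDerivAt_form_lieAd Q X Y
  have hi : HasMFDerivAt 𝓘(ℝ, EH) 𝓘(ℝ, E) (fun x : H => (x : G)) 1
      (mfderiv 𝓘(ℝ, EH) 𝓘(ℝ, E) (fun x : H => (x : G)) 1) :=
    (hsub.smooth.mdifferentiable (by simp) 1).hasMFDerivAt
  have h1 := HasMFDerivAt.comp (1 : H) hA' hi
  have h2 : ((fun a : G => Q (lieAd E a X) (lieAd E a Y)) ∘ fun x : H => (x : G)) =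
      fun _ => Q X Y := funext fun a => hQ a a.2
  rw [h2] at h1
  have h3 := DFunLike.congr_fun (hasMFDerivAt_unique h1 (hasMFDerivAt_const _ _)) Z
  have h4 := (hA _).symm.trans h3
  have h5 : Q X ⁅lieInclusion E EH H Z, Y⁆ + Q ⁅lieInclusion E EH H Z, X⁆ Y = 0 := h4
  linarith

variable {p : Submodule ℝ (GroupLieAlgebra 𝓘(ℝ, E) G)} {B : LinearMap.BilinForm ℝ p}

theorem IsNaturallyReductivePair.isInfinitesimallyNaturallyReductive
    (hsub : IsLieSubgroup E EH H) (h : IsNaturallyReductivePair E EH H p B) :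
    IsInfinitesimallyNaturallyReductive (lieInclusionHom hsub) p B where
  isCompl := h.isCompl
  lie_mem Z X hX := lie_mem_of_lieAd_mem hsub h.ad_mem Z hX
  isInnerProduct := h.isInnerProduct
  lie_invariant Z X Y := by
    have hpr : ∀ X : p, p.projectionOnto _ h.isCompl X = X := fun X =>
      Submodule.projectionOnto_apply_left h.isCompl X
    have h1 := form_lie_of_lieAd hsub (X := (X : GroupLieAlgebra 𝓘(ℝ, E) G))
      (Y := (Y : GroupLieAlgebra 𝓘(ℝ, E) G))
      (Q := B.compl₁₂ (p.projectionOnto _ h.isCompl) (p.projectionOnto _ h.isCompl))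
      (fun a ha => by
        have h2 := hpr ⟨lieAd E a X, h.ad_mem a ha X X.2⟩
        have h3 := hpr ⟨lieAd E a Y, h.ad_mem a ha Y Y.2⟩
        simp only at h2 h3
        rw [LinearMap.compl₁₂_apply, LinearMap.compl₁₂_apply, h2, h3, hpr, hpr]
        exact h.ad_invariant a ha X Y) Z
    have h2 := hpr ⟨⁅lieInclusion E EH H Z, (X : GroupLieAlgebra 𝓘(ℝ, E) G)⁆,
      lie_mem_of_lieAd_mem hsub h.ad_mem Z X.2⟩
    have h3 := hpr ⟨⁅lieInclusion E EH H Z, (Y : GroupLieAlgebra 𝓘(ℝ, E) G)⁆,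
      lie_mem_of_lieAd_mem hsub h.ad_mem Z Y.2⟩
    simp only at h2 h3
    rw [LinearMap.compl₁₂_apply, LinearMap.compl₁₂_apply, h2, h3, hpr, hpr] at h1
    exact h1
  reductive := h.reductive

theorem lieAd_mem_of_ker [PreconnectedSpace G]
    {R : LinearMap.BilinForm ℝ (GroupLieAlgebra 𝓘(ℝ, E) G)}
    (hR : R.lieInvariant (GroupLieAlgebra 𝓘(ℝ, E) G)) (a : G)
    {X : GroupLieAlgebra 𝓘(ℝ, E) G} (hX : R X = 0) : R (lieAd E a X) = 0 := by
  ext Y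
  rw [← lieAd_lieAd_inv a Y, form_lieAd_lieAd hR, hX]
  rfl

theorem IsInfinitesimallyNaturallyReductive.isNaturallyReductivePair [PreconnectedSpace G]
    {hsub : IsLieSubgroup E EH H}
    (h : IsInfinitesimallyNaturallyReductive (lieInclusionHom hsub) p B)
    {Q : LinearMap.BilinForm ℝ (GroupLieAlgebra 𝓘(ℝ, E) G)}
    (hQ : Q.lieInvariant (GroupLieAlgebra 𝓘(ℝ, E) G)) (hB : ∀ X Y : p, B X Y = Q X Y)
    (hp : (∃ R : LinearMap.BilinForm ℝ (GroupLieAlgebra 𝓘(ℝ, E) G),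
        R.lieInvariant (GroupLieAlgebra 𝓘(ℝ, E) G) ∧ ∀ X, X ∈ p ↔ R X = 0) ∨
      ∀ X, X ∈ p ↔ ∀ Z, Q (lieInclusionHom hsub Z) X = 0) :
    IsNaturallyReductivePair E EH H p B where
  isCompl := h.isCompl
  ad_mem a ha X hX := by
    rcases hp with ⟨R, hR, hp⟩ | hp
    · rw [hp] at hX ⊢
      exact lieAd_mem_of_ker hR a hX
    · rw [hp] at hX ⊢
      intro Z
      rw [← lieAd_lieAd_inv (⟨a, ha⟩ : H) Z, lieInclusionHom_apply, lieInclusion_lieAd hsub,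
        form_lieAd_lieAd hQ]
      exact hX _
  isInnerProduct := h.isInnerProduct
  ad_invariant a ha X Y := by
    rw [hB, hB]
    exact form_lieAd_lieAd hQ a X Y
  reductive := h.reductive

end InvariantForms

/-! ### Gluing local primitives on a simply connected space -/

section Primitive

/-- The covering space of the primitives of a family of functions with locally constant
differences. -/
noncomputable def primitiveCore {X ι A : Type*} [TopologicalSpace X] [AddCommGroup A]
    [TopologicalSpace A] [DiscreteTopology A] (U : ι → Set X) (hU : ∀ i, IsOpen (U i))
    (ix : X → ι) (hix : ∀ x, x ∈ U (ix x)) (φ : ι → X → A)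
    (hφ : ∀ i j, ∀ x ∈ U i ∩ U j, ∀ᶠ y in nhds x, φ i y - φ j y = φ i x - φ j x) :
    FiberBundleCore ι X A where
  baseSet := U
  isOpen_baseSet := hU
  indexAt := ix
  mem_baseSet_at := hix
  coordChange i j x r := r + (φ i x - φ j x)
  coordChange_self i x _ r := by rw [sub_self, add_zero]
  continuousOn_coordChange i j := by
    rintro ⟨x, r⟩ ⟨hx, -⟩
    refine ContinuousAt.continuousWithinAt ?_
    have h1 : ∀ᶠ z : X × A in nhds (x, r), z.2 = r :=
      continuous_snd.continuousAt.eventually_mem (s := {r}) ((isOpen_discrete _).mem_nhds rfl)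
    have h2 : ∀ᶠ z : X × A in nhds (x, r), φ i z.1 - φ j z.1 = φ i x - φ j x :=
      (continuous_fst.tendsto (x, r)).eventually (hφ i j x hx)
    refine (continuousAt_const (y := r + (φ i x - φ j x))).congr ?_
    filter_upwards [h1, h2] with z hz hz'
    rw [hz, hz']
  coordChange_comp i j k x _ r := by abel

theorem exists_primitive {X ι A : Type*} [TopologicalSpace X] [SimplyConnectedSpace X]
    [LocallyPathConnectedSpace X] [AddCommGroup A] {U : ι → Set X} (hU : ∀ i, IsOpen (U i))
    (hcov : ∀ x, ∃ i, x ∈ U i) {φ : ι → X → A}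
    (hφ : ∀ i j, ∀ x ∈ U i ∩ U j, ∀ᶠ y in nhds x, φ i y - φ j y = φ i x - φ j x) :
    ∃ F : X → A, ∀ i, ∀ x ∈ U i, ∀ᶠ y in nhds x, F y - φ i y = F x - φ i x := by
  let _ : TopologicalSpace A := ⊥
  have _ : DiscreteTopology A := ⟨rfl⟩
  choose ix hix using hcov
  let Z := primitiveCore U hU ix hix φ hφ
  have hcover : IsCoveringMap Z.proj := fun x =>
    (IsEvenlyCovered.of_trivialization (t := Z.localTrivAt x)
      (Z.mem_localTrivAt_baseSet x)).to_isEvenlyCovered_preimage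
  obtain ⟨x₀⟩ : Nonempty X := inferInstance
  obtain ⟨s, ⟨-, hs⟩, -⟩ := hcover.existsUnique_continuousMap_lifts (ContinuousMap.id X) x₀
    (⟨x₀, (0 : A)⟩ : Z.TotalSpace) rfl
  have hs1 : ∀ x, (s x).1 = x := fun x => congrFun hs x
  let r : X → A := fun x => (s x).2
  refine ⟨fun x => r x + φ (ix x) x, fun i x hx => ?_⟩
  have h1 : ContinuousAt (fun y => (Z.localTriv i (s y)).2) x := by
    refine continuousAt_snd.comp (ContinuousAt.comp ?_ s.continuous.continuousAt)
    refine (Z.localTriv i).continuousAt ?_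
    rw [Z.mem_localTriv_source, hs1]
    exact hx
  have h2 : ∀ y, (Z.localTriv i (s y)).2 = r y + (φ (ix y) y - φ i y) := fun y => by
    have : (Z.localTriv i (s y)).2 = r y + (φ (ix (s y).1) (s y).1 - φ i (s y).1) := rfl
    rw [this, hs1]
  simp only [h2] at h1
  have h3 := h1.eventually_mem (s := {r x + (φ (ix x) x - φ i x)}) (by simp [nhds_discrete])
  filter_upwards [h3] with y hy
  rw [add_sub_assoc, add_sub_assoc]
  exact hy

end Primitive

/-! ### Quotients of topological groups -/

section TopologicalGroup

open scoped Pointwise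

variable {G : Type*} [TopologicalSpace G] [Group G] [IsTopologicalGroup G] (H : Subgroup G)

theorem compactSpace_of_compactSpace_quotient [LocallyCompactSpace G] [CompactSpace H]
    [CompactSpace (G ⧸ H)] : CompactSpace G := by
  obtain ⟨K, hK, hK1⟩ := exists_compact_mem_nhds (1 : G)
  have hopen : ∀ g : G, IsOpen ((QuotientGroup.mk : G → G ⧸ H) '' (g • interior K)) := fun g =>
    QuotientGroup.isOpenMap_coe _ (isOpen_interior.smul g)
  obtain ⟨t, ht⟩ := isCompact_univ.elim_finite_subcover
    (fun g : G => (QuotientGroup.mk : G → G ⧸ H) '' (g • interior K)) hopen fun x _ => by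
      obtain ⟨g, rfl⟩ := QuotientGroup.mk_surjective x
      exact Set.mem_iUnion.2 ⟨g, g, ⟨1, mem_interior_iff_mem_nhds.2 hK1, mul_one g⟩, rfl⟩
  have hH : IsCompact (H : Set G) := isCompact_iff_compactSpace.2 inferInstance
  have hc : IsCompact (⋃ g ∈ t, g • (K * (H : Set G))) :=
    t.isCompact_biUnion fun g _ => (hK.mul hH).smul g
  refine ⟨hc.of_isClosed_subset isClosed_univ fun x _ => ?_⟩
  obtain ⟨g, hg, y, ⟨k, hk, rfl⟩, hy⟩ := Set.mem_iUnion₂.1 (ht (Set.mem_univ (x : G ⧸ H)))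
  refine Set.mem_iUnion₂.2 ⟨g, hg, Set.mem_smul_set.2 ⟨g⁻¹ * x, ⟨k, interior_subset hk,
    k⁻¹ * (g⁻¹ * x), ?_, by simp⟩, by simp⟩⟩
  have := QuotientGroup.eq.1 hy
  simpa [mul_assoc] using! this

theorem connectedSpace_of_connectedSpace_quotient [ConnectedSpace H] [ConnectedSpace (G ⧸ H)] :
    ConnectedSpace G := by
  have hH : IsConnected (H : Set G) := isConnected_iff_connectedSpace.2 inferInstance
  have h := QuotientGroup.isOpenQuotientMap_mk (N := H) |>.isQuotientMap.isCoinducing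
    |>.isConnected_preimage_of_isClosed (t := Set.univ) (fun x => ?_) isClosed_univ isConnected_univ
  · rw [Set.preimage_univ] at h
    exact connectedSpace_iff_univ.2 h
  · obtain ⟨g, rfl⟩ := QuotientGroup.mk_surjective x
    have h1 : (QuotientGroup.mk : G → G ⧸ H) ⁻¹' {(g : G ⧸ H)} = (fun y => g * y) '' (H : Set G) := by
      ext y
      simp only [Set.mem_preimage, Set.mem_singleton_iff, Set.mem_image]
      rw [eq_comm, QuotientGroup.eq]
      exact ⟨fun h => ⟨_, h, by simp⟩, by rintro ⟨z, hz, rfl⟩; simpa using hz⟩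
    rw [h1]
    exact hH.image _ (continuous_const_mul g).continuousOn

theorem Subgroup.eq_top_of_mem_nhds_one [PreconnectedSpace G] (K : Subgroup G)
    (hK : (K : Set G) ∈ nhds 1) : K = ⊤ := by
  have h1 : IsOpen (K : Set G) := K.isOpen_of_mem_nhds hK
  have h2 := IsClopen.eq_univ ⟨K.isClosed_of_isOpen h1, h1⟩ ⟨1, K.one_mem⟩
  exact SetLike.coe_injective (h2.trans Subgroup.coe_top.symm)

end TopologicalGroup

/-! ### Local homomorphisms of topological groups -/

section LocalHom

variable {G : Type*} [TopologicalSpace G] [Group G] [IsTopologicalGroup G] {A : Type*}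
  [AddCommGroup A] {f : G → A}

theorem exists_nhds_one_forall_map_mul
    (hf : ∀ᶠ z : G × G in nhds (1, 1), f (z.1 * z.2) = f z.1 + f z.2) :
    ∃ W ∈ nhds (1 : G), ∀ x ∈ W, ∀ y ∈ W, f (x * y) = f x + f y := by
  rw [nhds_prod_eq] at hf
  exact Filter.eventually_prod_self_iff.1 hf

theorem map_one_of_eventually_map_mul
    (hf : ∀ᶠ z : G × G in nhds (1, 1), f (z.1 * z.2) = f z.1 + f z.2) : f 1 = 0 := by
  have := hf.self_of_nhds
  simpa using this

theorem tendsto_mul_mul_inv_nhds_one (h : G) :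
    Filter.Tendsto (fun x : G => h * x * h⁻¹) (nhds 1) (nhds 1) := by
  have : Continuous fun x : G => h * x * h⁻¹ := by fun_prop
  simpa using this.tendsto 1

theorem exists_isOpen_symm_mul_mem {W : Set G} (hW : W ∈ nhds 1) :
    ∃ V : Set G, IsOpen V ∧ 1 ∈ V ∧ (∀ x ∈ V, x⁻¹ ∈ V) ∧ ∀ x ∈ V, ∀ y ∈ V, x * y ∈ W := by
  obtain ⟨V, hV, hV1, hVW⟩ := exists_open_nhds_one_mul_subset hW
  refine ⟨V ∩ V⁻¹, hV.inter hV.inv, ⟨hV1, by simpa using hV1⟩, fun x hx => ⟨hx.2, by simpa using hx.1⟩,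
    fun x hx y hy => hVW (Set.mul_mem_mul hx.1 hy.1)⟩

/-- The germ of a local homomorphism of a connected group to an abelian group is invariant under the
conjugations. -/
theorem eventually_map_conj [PreconnectedSpace G]
    (hf : ∀ᶠ z : G × G in nhds (1, 1), f (z.1 * z.2) = f z.1 + f z.2) (h : G) :
    ∀ᶠ x in nhds (1 : G), f (h * x * h⁻¹) = f x := by
  let K : Subgroup G :=
    { carrier := {h | ∀ᶠ x in nhds (1 : G), f (h * x * h⁻¹) = f x}
      one_mem' := by simp
      mul_mem' := fun {a b} ha hb => by
        filter_upwards [hb, (tendsto_mul_mul_inv_nhds_one b).eventually ha] with x hx hx'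
        rw [← hx, ← hx']
        simp [mul_assoc]
      inv_mem' := fun {a} ha => by
        filter_upwards [(tendsto_mul_mul_inv_nhds_one a⁻¹).eventually ha] with x hx
        rw [← hx]
        simp [mul_assoc] }
  have hK : K = ⊤ := by
    refine K.eq_top_of_mem_nhds_one ?_
    obtain ⟨W, hW, hWf⟩ := exists_nhds_one_forall_map_mul hf
    obtain ⟨V, hV, hV1, hVi, hVV⟩ := exists_isOpen_symm_mul_mem hW
    have hVW : ∀ x ∈ V, x ∈ W := fun x hx => by simpa using hVV x hx 1 hV1
    filter_upwards [hV.mem_nhds hV1] with a ha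
    change ∀ᶠ x in nhds (1 : G), f (a * x * a⁻¹) = f x
    filter_upwards [hV.mem_nhds hV1] with x hx
    rw [hWf _ (hVV a ha x hx) _ (hVW _ (hVi a ha)), hWf _ (hVW a ha) _ (hVW x hx)]
    have h1 := hWf _ (hVW a ha) _ (hVW _ (hVi a ha))
    rw [mul_inv_cancel, map_one_of_eventually_map_mul hf] at h1
    rw [add_right_comm, ← h1, zero_add]
  have : h ∈ K := hK ▸ Subgroup.mem_top h
  exact this

/-- A local homomorphism of a connected group `G` to an abelian group which is trivial on `H` comes
from a function on `G ⧸ H`, if `G ⧸ H` is simply connected. -/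
theorem exists_quotient_primitive [PreconnectedSpace G] {H : Subgroup G}
    [SimplyConnectedSpace (G ⧸ H)] [LocallyPathConnectedSpace (G ⧸ H)]
    (hf : ∀ᶠ z : G × G in nhds (1, 1), f (z.1 * z.2) = f z.1 + f z.2)
    (hH : ∀ᶠ x in nhds (1 : G), x ∈ H → f x = 0) :
    ∃ F : G ⧸ H → A, ∀ x : G, ∀ᶠ v in nhds (1 : G),
      F ((x * v : G) : G ⧸ H) = F (x : G ⧸ H) + f v := by
  classical
  obtain ⟨W', hW', hWf⟩ := exists_nhds_one_forall_map_mul hf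
  obtain ⟨V, hV, hV1, hVi, hVV⟩ := exists_isOpen_symm_mul_mem (Filter.inter_mem hW' hH)
  have hVW : ∀ x ∈ V, x ∈ W' := fun x hx => by simpa using (hVV x hx 1 hV1).1
  have hadd : ∀ x ∈ W', ∀ y ∈ W', f (x * y) = f x + f y := hWf
  have hf1 : f 1 = 0 := map_one_of_eventually_map_mul hf
  let U : G → Set (G ⧸ H) := fun x => {b | ∃ v ∈ V, ((x * v : G) : G ⧸ H) = b}
  let φ : G → G ⧸ H → A := fun x b => if h : ∃ v ∈ V, ((x * v : G) : G ⧸ H) = b then f h.choose else 0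
  have hU : ∀ x, IsOpen (U x) := fun x => by
    have h1 : U x = (QuotientGroup.mk : G → G ⧸ H) '' ((fun v => x * v) '' V) := by
      rw [Set.image_image]
      rfl
    rw [h1]
    exact QuotientGroup.isOpenMap_coe _ (isOpenMap_mul_left x _ hV)
  have hφ : ∀ x, ∀ v ∈ V, φ x ((x * v : G) : G ⧸ H) = f v := fun x v hv => by
    have h1 : ∃ w ∈ V, ((x * w : G) : G ⧸ H) = ((x * v : G) : G ⧸ H) := ⟨v, hv, rfl⟩
    have h2 : φ x ((x * v : G) : G ⧸ H) = f h1.choose := dif_pos h1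
    obtain ⟨h3, h4⟩ := h1.choose_spec
    rw [h2]
    set w := h1.choose
    have h5 : v⁻¹ * w ∈ H := by simpa [mul_assoc] using! QuotientGroup.eq.1 h4.symm
    have h6 := hVV _ (hVi v hv) w h3
    have h7 := hadd v (hVW v hv) _ h6.1
    rwa [mul_inv_cancel_left, h6.2 h5, add_zero] at h7
  have hnhds : ∀ x : G, nhds (x : G ⧸ H) = (nhds (1 : G)).map fun v => ((x * v : G) : G ⧸ H) :=
    fun x => by rw [QuotientGroup.nhds_eq, ← map_mul_left_nhds_one x, Filter.map_map]; rfl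
  have hmul : ∀ v ∈ V, ∀ᶠ u in nhds (1 : G), v * u ∈ V := fun v hv => by
    have h1 : Continuous fun u : G => v * u := continuous_const_mul v
    exact (h1.tendsto 1).eventually_mem (hV.mem_nhds (by simpa using hv))
  obtain ⟨F, hF⟩ := exists_primitive (φ := φ) hU (fun b => by
    obtain ⟨x, rfl⟩ := QuotientGroup.mk_surjective b
    exact ⟨x, 1, hV1, by rw [mul_one]⟩) (fun x y b hb => by
      obtain ⟨⟨v, hv, rfl⟩, w, hw, hvw⟩ := hb
      have hh : (y * w)⁻¹ * (x * v) ∈ H := QuotientGroup.eq.1 hvw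
      set h := (y * w)⁻¹ * (x * v) with hhdef
      have h1 : φ y ((x * v : G) : G ⧸ H) = f w := by rw [← hvw, hφ y w hw]
      rw [hφ x v hv, h1, hnhds, Filter.eventually_map]
      have ht := tendsto_mul_mul_inv_nhds_one h
      filter_upwards [hmul v hv, ht.eventually (hmul w hw), hW', ht.eventually_mem hW',
        eventually_map_conj hf h] with u hu1 hu2 hu3 hu4 hu5
      have h2 : ((x * v * u : G) : G ⧸ H) = ((y * (w * (h * u * h⁻¹)) : G) : G ⧸ H) := by
        rw [eq_comm, QuotientGroup.eq]
        have : (y * (w * (h * u * h⁻¹)))⁻¹ * (x * v * u) = h := by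
          rw [hhdef]
          group
        rw [this]
        exact hh
      rw [h2, hφ y _ hu2, ← h2, mul_assoc x v u, hφ x _ hu1, hadd v (hVW v hv) u hu3,
        hadd w (hVW w hw) _ hu4, hu5]
      abel)
  refine ⟨F, fun x => ?_⟩
  have h1 := hF x (x : G ⧸ H) ⟨1, hV1, by rw [mul_one]⟩
  have h2 : φ x (x : G ⧸ H) = 0 := by
    have := hφ x 1 hV1
    rwa [mul_one, hf1] at this
  rw [h2, hnhds, Filter.eventually_map] at h1
  filter_upwards [h1, hV.mem_nhds hV1] with v hv hv'
  rw [hφ x v hv', sub_zero] at hv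
  exact sub_eq_iff_eq_add.1 hv

theorem isLocalMax_one_of_eventually_map_mul [PreconnectedSpace G] {H : Subgroup G}
    [SimplyConnectedSpace (G ⧸ H)] [LocallyPathConnectedSpace (G ⧸ H)] [CompactSpace (G ⧸ H)]
    {f : G → ℝ} (hc : ContinuousAt f 1)
    (hf : ∀ᶠ z : G × G in nhds (1, 1), f (z.1 * z.2) = f z.1 + f z.2)
    (hH : ∀ᶠ x in nhds (1 : G), x ∈ H → f x = 0) : IsLocalMax f 1 := by
  obtain ⟨F, hF⟩ := exists_quotient_primitive hf hH
  have hf1 : f 1 = 0 := map_one_of_eventually_map_mul hf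
  have hFc : Continuous F := by
    refine continuous_iff_continuousAt.2 fun b => ?_
    obtain ⟨x, rfl⟩ := QuotientGroup.mk_surjective b
    have h1 : nhds (x : G ⧸ H) = (nhds (1 : G)).map fun v => ((x * v : G) : G ⧸ H) := by
      rw [QuotientGroup.nhds_eq, ← map_mul_left_nhds_one x, Filter.map_map]; rfl
    rw [ContinuousAt, h1, Filter.tendsto_map'_iff]
    have h2 : Filter.Tendsto (fun v => F (x : G ⧸ H) + f v) (nhds 1) (nhds (F (x : G ⧸ H) + f 1)) :=
      tendsto_const_nhds.add hc
    rw [hf1, add_zero] at h2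
    refine h2.congr' ?_
    filter_upwards [hF x] with v hv
    exact hv.symm
  obtain ⟨b, -, hb⟩ := isCompact_univ.exists_isMaxOn ⟨((1 : G) : G ⧸ H), Set.mem_univ _⟩
    hFc.continuousOn
  obtain ⟨x, rfl⟩ := QuotientGroup.mk_surjective b
  filter_upwards [hF x] with v hv
  have := hb (Set.mem_univ ((x * v : G) : G ⧸ H))
  simp only [Set.mem_ofPred_eq] at this
  rw [hf1]
  linarith

end LocalHom

/-! ### Local homomorphisms with a given derivative -/

section LocalHomDeriv

variable {E : Type*} [NormedAddCommGroup E] [NormedSpace ℝ E]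
  {G : Type*} [TopologicalSpace G] [ChartedSpace E G] [Group G] [LieGroup 𝓘(ℝ, E) ∞ G]

theorem chartMul_assoc_deriv {x y : E} (hx : x ∈ (unitChart E G).target)
    (hy : y ∈ (unitChart E G).target)
    (hxy : (unitChart E G).symm x * (unitChart E G).symm y ∈ (unitChart E G).source) (v : E) :
    fderiv ℝ (fun z => chartMul E G (x, z)) y (chartLeft E G y v) =
      chartLeft E G (chartMul E G (x, y)) v := by
  have hm : chartMul E G (x, y) ∈ (unitChart E G).target := (unitChart E G).map_source hxy
  have h1 := hasFDerivAt_chartMul_right hm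
  have h2 : HasFDerivAt (fun z => chartMul E G (x, z))
      (fderiv ℝ (fun z => chartMul E G (x, z)) y) (chartMul E G (y, unitChart E G 1)) := by
    rw [chartMul_right_one hy]
    exact DifferentiableAt.hasFDerivAt (DifferentiableAt.comp (g := chartMul E G) y
      ((contDiffAt_chartMul hx hy hxy).differentiableAt (by simp))
      (hasFDerivAt_prodMk_right x y).differentiableAt)
  have h3 := h2.comp (unitChart E G 1) (hasFDerivAt_chartMul_right hy)
  have h4 : ContinuousAt (fun z => (unitChart E G).symm z) (unitChart E G 1) :=
    (contMDiffAt_unitChart_symm unitChart_one_mem_target).continuousAt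
  have h5 : ∀ᶠ z in nhds (unitChart E G 1),
      (unitChart E G).symm y * (unitChart E G).symm z ∈ (unitChart E G).source := by
    have h6 : ContinuousAt (fun z => (unitChart E G).symm y * (unitChart E G).symm z)
        (unitChart E G 1) :=
      ((contMDiff_mul_left (I := 𝓘(ℝ, E)) (n := ∞)
        (a := (unitChart E G).symm y)).continuous.continuousAt).comp h4
    refine h6.eventually_mem ((isOpen_extChartAt_source (1 : G)).mem_nhds ?_)
    rw [unitChart_symm_one, mul_one]
    exact unitChart_symm_mem_source hy
  have h7 : (fun z => chartMul E G (chartMul E G (x, y), z)) =ᶠ[nhds (unitChart E G 1)]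
      (fun z => chartMul E G (x, z)) ∘ fun z => chartMul E G (y, z) := by
    filter_upwards [h5] with z hz
    simp only [Function.comp, chartMul]
    rw [(unitChart E G).left_inv hz, (unitChart E G).left_inv hxy, mul_assoc]
  exact DFunLike.congr_fun ((h3.congr_of_eventuallyEq h7).unique h1) v

/-- The left-invariant 1-form with the value `l` at the identity, in the chart at the identity. -/
noncomputable def chartForm (G : Type*) [TopologicalSpace G] [ChartedSpace E G] [Group G]
    (l : E →L[ℝ] ℝ) (y : E) : E →L[ℝ] ℝ :=
  l ∘L Ring.inverse (chartLeft E G y)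

theorem chartForm_chartLeft (l : E →L[ℝ] ℝ) {y : E} (hy : IsUnit (chartLeft E G y)) (v : E) :
    chartForm G l y (chartLeft E G y v) = l v :=
  congrArg l (DFunLike.congr_fun (Ring.inverse_mul_cancel _ hy) v)

theorem exists_chartLeft_eq {y : E} (hy : IsUnit (chartLeft E G y)) (v : E) :
    ∃ w, chartLeft E G y w = v :=
  ⟨_, DFunLike.congr_fun (Ring.mul_inverse_cancel _ hy) v⟩

variable [CompleteSpace E]

theorem differentiableAt_chartForm (l : E →L[ℝ] ℝ) {y : E} (hyt : y ∈ (unitChart E G).target)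
    (hy : IsUnit (chartLeft E G y)) : DifferentiableAt ℝ (chartForm G l) y := by
  have h1 : DifferentiableAt ℝ (fun y => Ring.inverse (chartLeft E G y)) y :=
    DifferentiableAt.comp y (differentiableAt_inverse hy)
      ((contDiffAt_chartLeft hyt).differentiableAt (by simp))
  exact (differentiableAt_const l).clm_comp h1

theorem fderiv_chartForm_symm {l : E →L[ℝ] ℝ}
    (hl : ∀ X Y : GroupLieAlgebra 𝓘(ℝ, E) G, l (⁅X, Y⁆ : GroupLieAlgebra 𝓘(ℝ, E) G) = 0) {y : E}
    (hyt : y ∈ (unitChart E G).target) (hy : IsUnit (chartLeft E G y)) (u v : E) :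
    fderiv ℝ (chartForm G l) y u v = fderiv ℝ (chartForm G l) y v u := by
  have hL := (contDiffAt_chartLeft (G := G) hyt).differentiableAt (by simp) |>.hasFDerivAt
  have hω := (differentiableAt_chartForm l hyt hy).hasFDerivAt
  have hev : ∀ᶠ z in nhds y, IsUnit (chartLeft E G z) :=
    hL.continuousAt.eventually_mem (Units.isOpen.mem_nhds hy)
  have h1 : ∀ a w : E, fderiv ℝ (chartForm G l) y a (chartLeft E G y w) =
      - chartForm G l y (fderiv ℝ (chartLeft E G) y a w) := fun a w => by
    have h2 := hω.clm_apply (hL.clm_apply (hasFDerivAt_const w y))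
    have h3 : HasFDerivAt (fun z => chartForm G l z (chartLeft E G z w)) (0 : E →L[ℝ] ℝ) y := by
      refine (hasFDerivAt_const (l w) y).congr_of_eventuallyEq ?_
      filter_upwards [hev] with z hz
      exact chartForm_chartLeft l hz w
    have h4 := DFunLike.congr_fun (h2.unique h3) a
    simp at h4
    linarith
  obtain ⟨a, rfl⟩ := exists_chartLeft_eq hy u
  obtain ⟨b, rfl⟩ := exists_chartLeft_eq hy v
  rw [h1, h1]
  have h5 : ∀ a b : GroupLieAlgebra 𝓘(ℝ, E) G, chartForm G l y
      (fderiv ℝ (chartLeft E G) y (chartLeft E G y a) b -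
        fderiv ℝ (chartLeft E G) y (chartLeft E G y b) a) = 0 := fun a b =>
    (congrArg (chartForm G l y) (chartLeft_lie (G := G) hyt a b)).symm.trans
      ((chartForm_chartLeft l hy _).trans (hl a b))
  have h7 := h5 a b
  rw [map_sub] at h7
  rw [sub_eq_zero.1 h7]

/-- A linear form on the Lie algebra which vanishes at all the brackets is the derivative of a local
homomorphism. -/
theorem exists_hasMFDerivAt_eventually_map_mul {l : E →L[ℝ] ℝ}
    (hl : ∀ X Y : GroupLieAlgebra 𝓘(ℝ, E) G, l (⁅X, Y⁆ : GroupLieAlgebra 𝓘(ℝ, E) G) = 0) :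
    ∃ f : G → ℝ, HasMFDerivAt 𝓘(ℝ, E) 𝓘(ℝ, ℝ) f 1 l ∧
      ∀ᶠ z : G × G in nhds (1, 1), f (z.1 * z.2) = f z.1 + f z.2 := by
  set e := unitChart E G 1 with he
  have het : e ∈ (unitChart E G).target := unitChart_one_mem_target
  have hL1 : chartLeft E G e = ((1 : (E →L[ℝ] E)ˣ) : E →L[ℝ] E) := chartLeft_one
  have hev : ∀ᶠ y in nhds e, y ∈ (unitChart E G).target ∧ IsUnit (chartLeft E G y) := by
    have h1 : ∀ᶠ y in nhds e, y ∈ (unitChart E G).target := unitChart_target_mem_nhds het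
    refine h1.and ((contDiffAt_chartLeft het).continuousAt.eventually_mem
      (Units.isOpen.mem_nhds ?_))
    rw [hL1]
    exact Units.isUnit _
  obtain ⟨r, hr, hball⟩ := Metric.eventually_nhds_iff_ball.1 hev
  have hdiff : DifferentiableOn ℝ (chartForm G l) (Metric.ball e r) := fun y hy =>
    (differentiableAt_chartForm l (hball y hy).1 (hball y hy).2).differentiableWithinAt
  obtain ⟨q, hq⟩ := (convex_ball e r).exists_forall_hasFDerivAt_of_fderiv_symmetric
    Metric.isOpen_ball hdiff
    (fun y hy => fderiv_chartForm_symm hl (hball y hy).1 (hball y hy).2)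
  have hsymm : ContinuousAt (unitChart E G).symm e := (contMDiffAt_unitChart_symm het).continuousAt
  have hev2 : ∀ᶠ z : E × E in nhds (e, e), chartMul E G z ∈ Metric.ball e r ∧
      (unitChart E G).symm z.1 * (unitChart E G).symm z.2 ∈ (unitChart E G).source := by
    refine ((contDiffAt_chartMul_right het).continuousAt.eventually_mem ?_).and ?_
    · rw [chartMul_right_one het]
      exact Metric.ball_mem_nhds e hr
    · have h1 : ContinuousAt (fun z : E × E => (unitChart E G).symm z.1 * (unitChart E G).symm z.2)
          (e, e) := by
        have : ContMDiffAt 𝓘(ℝ, E × E) 𝓘(ℝ, E) ∞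
            (fun z : E × E => (unitChart E G).symm z.1 * (unitChart E G).symm z.2) (e, e) :=
          (ContMDiffAt.comp (e, e) (contMDiffAt_unitChart_symm het)
            contDiff_fst.contMDiff.contMDiffAt).mul
          (ContMDiffAt.comp (e, e) (contMDiffAt_unitChart_symm het)
            contDiff_snd.contMDiff.contMDiffAt)
        exact this.continuousAt
      refine h1.eventually_mem ((isOpen_extChartAt_source (1 : G)).mem_nhds ?_)
      simp only [he]
      rw [unitChart_symm_one, mul_one]
      exact mem_extChartAt_source _
  rw [nhds_prod_eq] at hev2
  obtain ⟨U, hU, hUm⟩ : ∃ U ∈ nhds e, ∀ x ∈ U, ∀ y ∈ U, chartMul E G (x, y) ∈ Metric.ball e r ∧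
      (unitChart E G).symm x * (unitChart E G).symm y ∈ (unitChart E G).source :=
    Filter.eventually_prod_self_iff.1 hev2
  obtain ⟨δ, hδ, hδU⟩ := Metric.mem_nhds_iff.1 (Filter.inter_mem hU (Metric.ball_mem_nhds e hr))
  have hadd : ∀ x ∈ Metric.ball e δ, ∀ y ∈ Metric.ball e δ,
      q (chartMul E G (x, y)) - q e = (q x - q e) + (q y - q e) := by
    intro x hx y hy
    have hd : ∀ z ∈ Metric.ball e δ,
        HasFDerivAt (fun z => q (chartMul E G (x, z)) - q z) (0 : E →L[ℝ] ℝ) z := fun z hz => by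
      obtain ⟨hm, hxz⟩ := hUm x (hδU hx).1 z (hδU hz).1
      have hxt := (hball x (hδU hx).2).1
      have hzt := (hball z (hδU hz).2).1
      have h1 : HasFDerivAt (fun z => chartMul E G (x, z))
          (fderiv ℝ (fun z => chartMul E G (x, z)) z) z :=
        DifferentiableAt.hasFDerivAt (DifferentiableAt.comp (g := chartMul E G) z
          ((contDiffAt_chartMul hxt hzt hxz).differentiableAt (by simp))
          (hasFDerivAt_prodMk_right x z).differentiableAt)
      refine (((hq _ hm).comp z h1).sub (hq z (hδU hz).2)).congr_fderiv ?_
      ext v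
      obtain ⟨w, rfl⟩ := exists_chartLeft_eq (hball z (hδU hz).2).2 v
      rw [sub_apply, ContinuousLinearMap.comp_apply, chartMul_assoc_deriv hxt hzt hxz,
        chartForm_chartLeft l (hball _ hm).2, chartForm_chartLeft l (hball z (hδU hz).2).2, sub_self]
      rfl
    have h1 := (convex_ball e δ).is_const_of_fderivWithin_eq_zero (𝕜 := ℝ)
      (fun z hz => (hd z hz).differentiableAt.differentiableWithinAt)
      (fun z hz => ((hd z hz).hasFDerivWithinAt).fderivWithin
        (Metric.isOpen_ball.uniqueDiffWithinAt hz)) hy (Metric.mem_ball_self hδ)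
    rw [chartMul_right_one (hball x (hδU hx).2).1] at h1
    linarith
  refine ⟨fun x => q (unitChart E G x) - q e, ?_, ?_⟩
  · have h1 := (hq e (Metric.mem_ball_self hr)).sub_const (q e)
    have h2 : chartForm G l e = l := by
      rw [chartForm, hL1, Ring.inverse_unit]
      rfl
    rw [h2] at h1
    exact HasMFDerivAt.comp (1 : G) h1.hasMFDerivAt hasMFDerivAt_unitChart
  · have h1 : ∀ᶠ x in nhds (1 : G), x ∈ (unitChart E G).source ∧ unitChart E G x ∈ Metric.ball e δ :=
      (Filter.inter_mem (extChartAt_source_mem_nhds (I := 𝓘(ℝ, E)) (1 : G))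
        ((continuousAt_extChartAt (I := 𝓘(ℝ, E)) (1 : G)) (Metric.ball_mem_nhds e hδ)))
    rw [nhds_prod_eq]
    filter_upwards [h1.prod_mk h1] with z hz
    obtain ⟨⟨h1, h2⟩, h3, h4⟩ := hz
    have := hadd _ h2 _ h4
    simp only [chartMul] at this
    rwa [(unitChart E G).left_inv h1, (unitChart E G).left_inv h3] at this

omit [CompleteSpace E] in
/-- A local homomorphism with zero derivative is trivial near the identity. -/
theorem eventually_eq_zero_of_hasMFDerivAt_zero {f : G → ℝ}
    (hf : ∀ᶠ z : G × G in nhds (1, 1), f (z.1 * z.2) = f z.1 + f z.2)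
    (hd : HasMFDerivAt 𝓘(ℝ, E) 𝓘(ℝ, ℝ) f 1 0) : ∀ᶠ x in nhds (1 : G), f x = 0 := by
  have := topologicalGroup_of_lieGroup 𝓘(ℝ, E) ∞ (G := G)
  obtain ⟨W, hW, hWf⟩ := exists_nhds_one_forall_map_mul hf
  have h1 : ∀ᶠ a in nhds (1 : G), HasMFDerivAt 𝓘(ℝ, E) 𝓘(ℝ, ℝ) f a 0 := by
    filter_upwards [hW] with a ha
    have h1 : HasMFDerivAt 𝓘(ℝ, E) 𝓘(ℝ, E) (fun x : G => x * a⁻¹) a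
        (mfderiv 𝓘(ℝ, E) 𝓘(ℝ, E) (fun x : G => x * a⁻¹) a) :=
      (contMDiff_mul_right (I := 𝓘(ℝ, E)) (n := ∞) (a := a⁻¹)).mdifferentiable (by simp) a
        |>.hasMFDerivAt
    rw [← mul_inv_cancel a] at hd
    have h2 := (HasMFDerivAt.comp a hd h1).add (hasMFDerivAt_const (f a) a)
    have h3 : ∀ᶠ x in nhds a, x * a⁻¹ ∈ W := by
      refine (continuous_mul_const a⁻¹).continuousAt.eventually_mem ?_
      rwa [mul_inv_cancel]
    refine (h2.congr_of_eventuallyEq ?_).congr_mfderiv ?_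
    · filter_upwards [h3] with x hx
      have := hWf _ hx _ ha
      rwa [inv_mul_cancel_right] at this
    · rw [ContinuousLinearMap.zero_comp]
      exact add_zero _
  have h2 := eventually_eq_of_hasMFDerivAt_zero h1
  rwa [map_one_of_eventually_map_mul hf] at h2

end LocalHomDeriv

section Perfect

variable {E : Type*} [NormedAddCommGroup E] [NormedSpace ℝ E] [FiniteDimensional ℝ E]
  {EH : Type*} [NormedAddCommGroup EH] [NormedSpace ℝ EH] [FiniteDimensional ℝ EH]
  {G : Type*} [TopologicalSpace G] [ChartedSpace E G] [Group G] [LieGroup 𝓘(ℝ, E) ∞ G]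
  {H : Subgroup G} [ChartedSpace EH H] [LieGroup 𝓘(ℝ, EH) ∞ H]

theorem eventually_mem_imp_eq_zero (hsub : IsLieSubgroup E EH H)
    (hsimple : LieAlgebra.IsSimple ℝ (GroupLieAlgebra 𝓘(ℝ, EH) H)) {l : E →L[ℝ] ℝ}
    (hl : ∀ X Y : GroupLieAlgebra 𝓘(ℝ, E) G, l (⁅X, Y⁆ : GroupLieAlgebra 𝓘(ℝ, E) G) = 0)
    {f : G → ℝ} (hd : HasMFDerivAt 𝓘(ℝ, E) 𝓘(ℝ, ℝ) f 1 l)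
    (hf : ∀ᶠ z : G × G in nhds (1, 1), f (z.1 * z.2) = f z.1 + f z.2) :
    ∀ᶠ x in nhds (1 : G), x ∈ H → f x = 0 := by
  have hi : HasMFDerivAt 𝓘(ℝ, EH) 𝓘(ℝ, E) (fun x : H => (x : G)) 1
      (mfderiv 𝓘(ℝ, EH) 𝓘(ℝ, E) (fun x : H => (x : G)) 1) :=
    (hsub.smooth.mdifferentiable (by simp) 1).hasMFDerivAt
  have h1 := HasMFDerivAt.comp (1 : H) hd hi
  let l' : GroupLieAlgebra 𝓘(ℝ, E) G →ₗ[ℝ] ℝ := l.toLinearMap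
  have h2 : l' ∘ₗ lieInclusion E EH H = 0 :=
    hsimple.eq_zero_of_forall_lie_eq_zero _ fun Z W =>
      (congrArg l' (lieInclusion_lie hsub Z W)).trans (hl _ _)
  have h3 : HasMFDerivAt 𝓘(ℝ, EH) 𝓘(ℝ, ℝ) (fun x : H => f x) 1 0 := by
    refine h1.congr_mfderiv ?_
    ext Z
    exact LinearMap.congr_fun h2 Z
  have hc : Continuous fun z : H × H => ((z.1 : G), (z.2 : G)) := by fun_prop
  have h4 := eventually_eq_zero_of_hasMFDerivAt_zero (f := fun x : H => f x)
    ((hc.tendsto (1, 1)).eventually hf) h3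
  rw [nhds_subtype_eq_comap, Filter.eventually_comap] at h4
  filter_upwards [h4] with x hx hxH
  exact hx ⟨x, hxH⟩ rfl

/-- The Lie algebra of `G` is perfect, if `G ⧸ H` is compact and simply connected. -/
theorem eq_zero_of_forall_lie_eq_zero [PreconnectedSpace G] [SimplyConnectedSpace (G ⧸ H)]
    [LocallyPathConnectedSpace (G ⧸ H)] [CompactSpace (G ⧸ H)] (hsub : IsLieSubgroup E EH H)
    (hsimple : LieAlgebra.IsSimple ℝ (GroupLieAlgebra 𝓘(ℝ, EH) H))
    (l : GroupLieAlgebra 𝓘(ℝ, E) G →ₗ[ℝ] ℝ)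
    (hl : ∀ X Y : GroupLieAlgebra 𝓘(ℝ, E) G, l ⁅X, Y⁆ = 0) : l = 0 := by
  have := topologicalGroup_of_lieGroup 𝓘(ℝ, E) ∞ (G := G)
  let l' : E →L[ℝ] ℝ := LinearMap.toContinuousLinearMap (E := E) l
  obtain ⟨f, hd, hf⟩ := exists_hasMFDerivAt_eventually_map_mul (G := G) (l := l') hl
  have hmax : IsLocalMax f 1 := isLocalMax_one_of_eventually_map_mul hd.continuousAt hf
    (eventually_mem_imp_eq_zero hsub hsimple (l := l') hl hd hf)
  have h2 : HasFDerivAt (f ∘ (unitChart E G).symm) l' (unitChart E G 1) := by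
    have := hd.2
    rw [ModelWithCorners.range_eq_univ] at this
    exact hasFDerivWithinAt_univ.1 this
  have hc : ContinuousAt (unitChart E G).symm (unitChart E G 1) :=
    (contMDiffAt_unitChart_symm unitChart_one_mem_target).continuousAt
  have h3 : IsLocalMax (f ∘ (unitChart E G).symm) (unitChart E G 1) := by
    have h4 : Filter.Tendsto (unitChart E G).symm (nhds (unitChart E G 1)) (nhds 1) := by
      have := hc.tendsto
      rwa [unitChart_symm_one] at this
    filter_upwards [h4.eventually hmax] with y hy
    simp only [Function.comp]
    rwa [unitChart_symm_one]
  have h5 := h3.hasFDerivAt_eq_zero h2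
  ext X
  exact DFunLike.congr_fun h5 X

end Perfect

section Averaging

variable {E : Type*} [NormedAddCommGroup E] [NormedSpace ℝ E] [FiniteDimensional ℝ E]
  {G : Type*} [TopologicalSpace G] [ChartedSpace E G] [Group G] [LieGroup 𝓘(ℝ, E) ∞ G]

theorem continuous_lieAd (X : GroupLieAlgebra 𝓘(ℝ, E) G) :
    Continuous fun a : G => lieAdCLM E a X := by
  have := topologicalGroup_of_lieGroup 𝓘(ℝ, E) ∞ (G := G)
  refine continuous_iff_continuousAt.2 fun a => ?_
  obtain ⟨A, -, hA⟩ := exists_hasMFDerivAt_lieAd (E := E) (G := G) (lieAd E a X)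
  have h1 : (fun b : G => lieAdCLM E b X) =
      (fun b : G => lieAdCLM E b (lieAd E a X)) ∘ fun b => b * a⁻¹ :=
    funext fun b => by
      have := lieAd_mul (b * a⁻¹) a X
      rw [inv_mul_cancel_right] at this
      exact this
  rw [h1]
  refine ContinuousAt.comp ?_ (continuous_mul_const a⁻¹).continuousAt
  rw [mul_inv_cancel]
  exact hA.continuousAt

theorem exists_isInnerProduct (V : Type*) [AddCommGroup V] [Module ℝ V] [FiniteDimensional ℝ V] :
    ∃ B : LinearMap.BilinForm ℝ V, IsInnerProduct B := by
  let b := Module.finBasis ℝ V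
  refine ⟨∑ i, LinearMap.BilinForm.linMulLin (b.coord i) (b.coord i), fun X Y => ?_, fun X hX => ?_⟩
  · simp [LinearMap.sum_apply, mul_comm]
  · simp only [LinearMap.sum_apply, LinearMap.BilinForm.linMulLin_apply]
    refine (Finset.sum_nonneg fun i _ => mul_self_nonneg _).lt_of_ne' fun h => hX ?_
    rw [Finset.sum_eq_zero_iff_of_nonneg fun i _ => mul_self_nonneg _] at h
    refine b.ext_elem fun i => ?_
    simpa using h i (Finset.mem_univ i)

/-- The Lie algebra of a compact Lie group has an invariant inner product. -/
theorem exists_isInnerProduct_lieInvariant [CompactSpace G] :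
    ∃ S : LinearMap.BilinForm ℝ (GroupLieAlgebra 𝓘(ℝ, E) G),
      IsInnerProduct S ∧ S.lieInvariant (GroupLieAlgebra 𝓘(ℝ, E) G) := by
  have := topologicalGroup_of_lieGroup 𝓘(ℝ, E) ∞ (G := G)
  have := Manifold.locallyCompact_of_finiteDimensional (M := G) 𝓘(ℝ, E)
  let _ : MeasurableSpace G := borel G
  have _ : BorelSpace G := ⟨rfl⟩
  let μ : MeasureTheory.Measure G := MeasureTheory.Measure.haar
  obtain ⟨B, hB⟩ := exists_isInnerProduct E
  let q : E →L[ℝ] E →L[ℝ] ℝ := B.toContinuousBilinearMap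
  have hq : ∀ X Y, q X Y = B X Y := fun X Y => rfl
  have hcont : ∀ X Y : E, Continuous fun a : G => B (lieAdCLM E a⁻¹ X) (lieAdCLM E a⁻¹ Y) :=
    fun X Y => q.continuous₂.comp (((continuous_lieAd X).comp continuous_inv).prodMk
      ((continuous_lieAd Y).comp continuous_inv))
  have hint : ∀ X Y : E, MeasureTheory.Integrable
      (fun a : G => B (lieAdCLM E a⁻¹ X) (lieAdCLM E a⁻¹ Y)) μ := fun X Y =>
    (hcont X Y).integrable_of_hasCompactSupport (HasCompactSupport.of_compactSpace _)
  let S : LinearMap.BilinForm ℝ E := LinearMap.mk₂ ℝ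
    (fun X Y => ∫ a : G, B (lieAdCLM E a⁻¹ X) (lieAdCLM E a⁻¹ Y) ∂μ)
    (fun X Y Z => by
      rw [← MeasureTheory.integral_add (hint _ _) (hint _ _)]
      simp)
    (fun c X Y => by
      rw [← MeasureTheory.integral_smul]
      simp)
    (fun X Y Z => by
      rw [← MeasureTheory.integral_add (hint _ _) (hint _ _)]
      simp)
    (fun c X Y => by
      rw [← MeasureTheory.integral_smul]
      simp)
  have hS : ∀ X Y, S X Y = ∫ a : G, B (lieAdCLM E a⁻¹ X) (lieAdCLM E a⁻¹ Y) ∂μ := fun X Y => rfl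
  have hsymm : ∀ X Y, S X Y = S Y X := fun X Y => by
    rw [hS, hS]
    simp only [hB.1]
  have hpos : ∀ X, X ≠ 0 → 0 < S X X := fun X hX => by
    rw [hS]
    refine (hcont X X).integral_pos_of_hasCompactSupport_nonneg_nonzero
      (HasCompactSupport.of_compactSpace _) (fun a => hB.self_nonneg _) (x := 1) (ne_of_gt ?_)
    refine hB.2 _ fun h => hX ?_
    rw [inv_one] at h
    exact (lieAd_one (G := G) X).symm.trans h
  have hinv : ∀ (b : G) X Y, S (lieAdCLM E b X) (lieAdCLM E b Y) = S X Y := fun b X Y => by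
    have h1 : ∀ (a : G) (Z : E), lieAdCLM E (b⁻¹ * a)⁻¹ Z = lieAdCLM E a⁻¹ (lieAdCLM E b Z) :=
      fun a Z => by
        rw [mul_inv_rev, inv_inv]
        exact lieAd_mul _ _ Z
    have h2 := MeasureTheory.integral_mul_left_eq_self (μ := μ)
      (fun a : G => B (lieAdCLM E a⁻¹ X) (lieAdCLM E a⁻¹ Y)) b⁻¹
    simp only [h1] at h2
    exact h2
  exact ⟨S, ⟨hsymm, hpos⟩, lieInvariant_of_lieAd hinv⟩

end Averaging

section Effective

variable {E : Type*} [NormedAddCommGroup E] [NormedSpace ℝ E] [FiniteDimensional ℝ E]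
  {EH : Type*} [NormedAddCommGroup EH] [NormedSpace ℝ EH] [FiniteDimensional ℝ EH]
  {G : Type*} [TopologicalSpace G] [ChartedSpace E G] [Group G] [LieGroup 𝓘(ℝ, E) ∞ G]
  {H : Subgroup G} [ChartedSpace EH H] [LieGroup 𝓘(ℝ, EH) ∞ H]

theorem contMDiff_quotientMk {EM : Type*} [NormedAddCommGroup EM] [NormedSpace ℝ EM]
    [ChartedSpace EM (G ⧸ H)] [IsManifold 𝓘(ℝ, EM) ∞ (G ⧸ H)]
    [ContMDiffSMul 𝓘(ℝ, E) 𝓘(ℝ, EM) ∞ G (G ⧸ H)] :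
    ContMDiff 𝓘(ℝ, E) 𝓘(ℝ, EM) ∞ (fun x : G => (x : G ⧸ H)) := by
  have h : (fun x : G => (x : G ⧸ H)) = (fun x : G => x) • fun _ : G => ((1 : G) : G ⧸ H) := by
    ext x
    change (x : G ⧸ H) = ((x * 1 : G) : G ⧸ H)
    rw [mul_one]
  rw [h]
  exact ContMDiff.smul (I := 𝓘(ℝ, E)) contMDiff_id contMDiff_const

theorem projDeriv_lieInclusion {EM : Type*} [NormedAddCommGroup EM] [NormedSpace ℝ EM]
    [ChartedSpace EM (G ⧸ H)] [IsManifold 𝓘(ℝ, EM) ∞ (G ⧸ H)]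
    [ContMDiffSMul 𝓘(ℝ, E) 𝓘(ℝ, EM) ∞ G (G ⧸ H)]
    (hsub : IsLieSubgroup E EH H) (Z : GroupLieAlgebra 𝓘(ℝ, EH) H) :
    projDeriv E EM H (lieInclusion E EH H Z) = 0 := by
  have h1 := mfderiv_comp (I := 𝓘(ℝ, EH)) (I' := 𝓘(ℝ, E)) (I'' := 𝓘(ℝ, EM)) (1 : H)
    ((contMDiff_quotientMk (E := E) (EM := EM) (H := H)).mdifferentiable (by simp) ((1 : H) : G))
    (hsub.smooth.mdifferentiable (by simp) 1)
  have h2 : (fun x : G => (x : G ⧸ H)) ∘ (fun x : H => (x : G)) = fun _ => ((1 : G) : G ⧸ H) :=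
    funext fun x => (QuotientGroup.eq.2 (by simp)).symm
  rw [h2, mfderiv_const] at h1
  exact (DFunLike.congr_fun h1 Z).symm

/-- If the Lie algebra of `H` is invariant under the adjoint representation of `G` and `H` is
connected, `H` is normal in `G`. -/
theorem normal_of_lieAd_mem_range (EM : Type*) [NormedAddCommGroup EM] [NormedSpace ℝ EM]
    [ChartedSpace EM (G ⧸ H)] [IsManifold 𝓘(ℝ, EM) ∞ (G ⧸ H)]
    [ContMDiffSMul 𝓘(ℝ, E) 𝓘(ℝ, EM) ∞ G (G ⧸ H)]
    (hsub : IsLieSubgroup E EH H) [PreconnectedSpace H]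
    (h : ∀ (a : G) Z, lieAd E a (lieInclusion E EH H Z) ∈ LinearMap.range (lieInclusion E EH H)) :
    H.Normal := by
  refine ⟨fun x hx a => ?_⟩
  let f : H → G ⧸ H := fun y => ((a * y * a⁻¹ : G) : G ⧸ H)
  have h1 : HasMFDerivAt 𝓘(ℝ, EH) 𝓘(ℝ, EM) f 1 0 := by
    have h2 := (contMDiff_quotientMk (E := E) (EM := EM) (H := H)).mdifferentiable (by simp)
      (a * ((1 : H) : G) * a⁻¹) |>.hasMFDerivAt
    have h3 := (contMDiff_conj (E := E) a).mdifferentiable (by simp) ((1 : H) : G) |>.hasMFDerivAt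
    have h4 := (hsub.smooth.mdifferentiable (by simp) (1 : H)).hasMFDerivAt
    have h5 := HasMFDerivAt.comp (1 : H) h2 (HasMFDerivAt.comp (1 : H) h3 h4)
    refine h5.congr_mfderiv ?_
    ext Z
    obtain ⟨W, hW⟩ := h a Z
    have h6 := mfderiv_congr_point (I := 𝓘(ℝ, E)) (I' := 𝓘(ℝ, EM)) (f := fun x : G => (x : G ⧸ H))
      (show a * ((1 : H) : G) * a⁻¹ = 1 by simp)
    exact (DFunLike.congr_fun h6 _).trans ((congrArg (projDeriv E EM H) hW).symm.trans
      (projDeriv_lieInclusion hsub W))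
  have h2 : ∀ y : H, HasMFDerivAt 𝓘(ℝ, EH) 𝓘(ℝ, EM) f y 0 := fun y => by
    have h3 : HasMFDerivAt 𝓘(ℝ, EH) 𝓘(ℝ, EH) (fun x : H => y⁻¹ * x) y
        (mfderiv 𝓘(ℝ, EH) 𝓘(ℝ, EH) (fun x : H => y⁻¹ * x) y) :=
      (contMDiff_mul_left (I := 𝓘(ℝ, EH)) (n := ∞) (a := y⁻¹)).mdifferentiable (by simp) y
        |>.hasMFDerivAt
    rw [← inv_mul_cancel y] at h1
    have h4 := (ContMDiffSMul.contMDiff_const_smul (I := 𝓘(ℝ, E)) (I' := 𝓘(ℝ, EM)) (n := ∞)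
      (M := G ⧸ H) (a * y * a⁻¹ : G)).mdifferentiable (by simp) (f (y⁻¹ * y)) |>.hasMFDerivAt
    have h5 := HasMFDerivAt.comp y h4 (HasMFDerivAt.comp y h1 h3)
    have h6 : (fun b : G ⧸ H => (a * y * a⁻¹ : G) • b) ∘ f ∘ (fun x : H => y⁻¹ * x) = f := by
      ext z
      change ((a * y * a⁻¹ * (a * ((y⁻¹ * z : H) : G) * a⁻¹) : G) : G ⧸ H) = f z
      congr 1
      push_cast
      group
    rw [h6] at h5
    refine h5.congr_mfderiv ?_
    rw [ContinuousLinearMap.zero_comp, ContinuousLinearMap.comp_zero]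
    rfl
  have h3 := (isLocallyConstant_of_hasMFDerivAt_zero (F := EM) h2).apply_eq_of_preconnectedSpace
    1 ⟨x, hx⟩
  have h4 := QuotientGroup.eq.1 h3
  simpa using h4

theorem ker_ne_range_lieInclusion (EM : Type*) [NormedAddCommGroup EM] [NormedSpace ℝ EM]
    [ChartedSpace EM (G ⧸ H)] [IsManifold 𝓘(ℝ, EM) ∞ (G ⧸ H)]
    [ContMDiffSMul 𝓘(ℝ, E) 𝓘(ℝ, EM) ∞ G (G ⧸ H)]
    [PreconnectedSpace G] (hsub : IsLieSubgroup E EH H)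
    (hsimple : IsSimpleLieGroup EH H) (heff : IsAlmostEffective H)
    (Q : LinearMap.BilinForm ℝ (GroupLieAlgebra 𝓘(ℝ, E) G))
    (hQ : Q.lieInvariant (GroupLieAlgebra 𝓘(ℝ, E) G)) :
    LinearMap.ker Q ≠ LinearMap.range (lieInclusion E EH H) := by
  intro hker
  have := hsimple.connected
  have hnormal : H.Normal := normal_of_lieAd_mem_range EM hsub fun a Z => by
    rw [← hker, LinearMap.mem_ker]
    refine lieAd_mem_of_ker hQ a ?_
    rw [← LinearMap.mem_ker, hker]
    exact LinearMap.mem_range_self _ Z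
  have := heff H hnormal le_rfl
  have hss : Subsingleton H := PreconnectedSpace.trivial_of_discrete
  have h1 : (id : H → H) = fun _ => 1 := funext fun x => Subsingleton.elim _ _
  have h2 : mfderiv 𝓘(ℝ, EH) 𝓘(ℝ, EH) (id : H → H) 1 =
      mfderiv 𝓘(ℝ, EH) 𝓘(ℝ, EH) (fun _ : H => (1 : H)) 1 := by rw [h1]
  have h3 : ∀ Z : GroupLieAlgebra 𝓘(ℝ, EH) H, Z = 0 := fun Z =>
    DFunLike.congr_fun (mfderiv_id.symm.trans (h2.trans mfderiv_const)) Z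
  exact hsimple.isSimple.non_abelian ⟨fun X Y => h3 _⟩

end Effective

theorem theorem1
    {E : Type*} [NormedAddCommGroup E] [NormedSpace ℝ E] [FiniteDimensional ℝ E]
    {EH : Type*} [NormedAddCommGroup EH] [NormedSpace ℝ EH] [FiniteDimensional ℝ EH]
    {EM : Type*} [NormedAddCommGroup EM] [NormedSpace ℝ EM] [FiniteDimensional ℝ EM]
    {G : Type*} [TopologicalSpace G] [T2Space G] [ChartedSpace E G] [Group G]
    [LieGroup 𝓘(ℝ, E) ∞ G]
    (H : Subgroup G) [ChartedSpace EH H] [LieGroup 𝓘(ℝ, EH) ∞ H]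
    [ChartedSpace EM (G ⧸ H)] [IsManifold 𝓘(ℝ, EM) ∞ (G ⧸ H)]
    [ContMDiffSMul 𝓘(ℝ, E) 𝓘(ℝ, EM) ∞ G (G ⧸ H)]
    [CompactSpace H] [CompactSpace (G ⧸ H)] [SimplyConnectedSpace (G ⧸ H)]
    (hsub : IsLieSubgroup E EH H) (hsimple : IsSimpleLieGroup EH H)
    (heff : IsAlmostEffective H)
    (g : MetricOnQuotient EM H) (hg : IsInvariantMetric g) :
    (∃ N : ℕ, Nonempty (SimpleIdealDecomposition (GroupLieAlgebra 𝓘(ℝ, E) G) (Fin N))) ∧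
    ∀ (N : ℕ) (D : SimpleIdealDecomposition (GroupLieAlgebra 𝓘(ℝ, E) G) (Fin N)),
      ∃ c : Fin N → ℝ, D.IsNormalization (lieInclusion E EH H) c ∧
        (IsNaturallyReductive E EH g ↔
          ∃ (p : Submodule ℝ (GroupLieAlgebra 𝓘(ℝ, E) G)) (B : LinearMap.BilinForm ℝ p),
            IsGeneratedBy E EH g p B ∧
              (D.IsIdealPair (lieInclusion E EH H) p B ∨
                D.IsFormPair (lieInclusion E EH H) c p B)) ∧
        (∀ (p : Submodule ℝ (GroupLieAlgebra 𝓘(ℝ, E) G)) (B : LinearMap.BilinForm ℝ p),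
          IsNaturallyReductivePair E EH H p B ↔
            (D.IsIdealPair (lieInclusion E EH H) p B ∨
              D.IsFormPair (lieInclusion E EH H) c p B)) ∧
        (∀ j, Function.Bijective (D.subProj (lieInclusion E EH H) j) →
          ∀ B : LinearMap.BilinForm ℝ (D.complIdeal j).toSubmodule,
            (IsInnerProduct B ∧ IsAdInvariant (D.complIdeal j).toSubmodule B) ↔
              ∃ β : Fin N → ℝ, (∀ i, i ≠ j → 0 < β i) ∧
                ∀ X Y : (D.complIdeal j).toSubmodule,
                  B X Y = ∑ i ∈ Finset.univ.erase j, β i * D.form c i X Y) := by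
  have := hsimple.connected
  have := topologicalGroup_of_lieGroup 𝓘(ℝ, E) ∞ (G := G)
  have := Manifold.locallyCompact_of_finiteDimensional (M := G) 𝓘(ℝ, E)
  have := ChartedSpace.locallyPathConnectedSpace EM (G ⧸ H)
  have := compactSpace_of_compactSpace_quotient H
  have := connectedSpace_of_connectedSpace_quotient H
  have : FiniteDimensional ℝ (GroupLieAlgebra 𝓘(ℝ, E) G) := inferInstanceAs (FiniteDimensional ℝ E)
  have : FiniteDimensional ℝ (GroupLieAlgebra 𝓘(ℝ, EH) H) :=
    inferInstanceAs (FiniteDimensional ℝ EH)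
  obtain ⟨S, hS, hSL⟩ := exists_isInnerProduct_lieInvariant (E := E) (G := G)
  have hK := hsimple.isSimple
  have hinc := lieInclusion_injective hsub
  have := isSemisimple_of_isInnerProduct hS hSL (eq_zero_of_forall_lie_eq_zero hsub hK)
  refine ⟨exists_simpleIdealDecomposition, fun N D => ?_⟩
  obtain ⟨c, hc⟩ := D.exists_isNormalization hS hSL hK (lieInclusionHom hsub) hinc
  have hpair : ∀ (p : Submodule ℝ (GroupLieAlgebra 𝓘(ℝ, E) G)) (B : LinearMap.BilinForm ℝ p),
      IsNaturallyReductivePair E EH H p B ↔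
        (D.IsIdealPair (lieInclusion E EH H) p B ∨ D.IsFormPair (lieInclusion E EH H) c p B) := by
    intro p B
    have hiff := D.isInfinitesimallyNaturallyReductive_iff (p := p) (B := B) hS hSL hK hinc hc
      (ker_ne_range_lieInclusion EM hsub hsimple heff)
    refine ⟨fun h => hiff.1 (h.isInfinitesimallyNaturallyReductive hsub), fun h => ?_⟩
    obtain ⟨Q, -, hQ, hB, hp⟩ := D.exists_lieInvariant_of_pair hS hSL hc h
    exact (hiff.2 h).isNaturallyReductivePair hQ hB hp
  refine ⟨c, hc, ⟨?_, ?_⟩, hpair, fun j _ B =>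
    D.isInnerProduct_and_isAdInvariant_iff hS hSL (SimpleIdealDecomposition.IsNormalization.pos D hc)
      j B⟩
  · rintro ⟨p, B, h⟩
    exact ⟨p, B, h, (hpair p B).1 h.1⟩
  · rintro ⟨p, B, h, -⟩
    exact ⟨p, B, h⟩
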